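/- Let $(X,d)$ be a metric space all of whose balls are relatively compact, let $m$ be a Radon measure on $X$ with full support, and let $(\mathcal E,\mathcal F)$ be a regular symmetric Dirichlet form in $L^2(X;m)$. Write $C_0(X)$ for the continuous functions with compact support, and assume that $\mathcal E$ has no killing part, i.e. its Beurling–Deny decomposition is $$\mathcal E(u,v)=\mathcal E^{(c)}(u,v)+\mathcal E^{(j)}(u,v),\qquad \mathcal E^{(j)}(u,v)=\iint_{x\ne y}(u(x)-u(y))(v(x)-v(y))\,j(x,dy)\,m(dx),$$ where $j(x,dy)$ is an (s-finite) kernel such that the measure $J(dx,dy)=j(x,dy)\,m(dx)$ off the diagonal is symmetric, and $\mathcal E^{(c)}$ is a non-negative definite symmetric form that is strongly local on $\mathcal F\cap C_0(X)$: $\mathcal E^{(c)}(f,g)=0$ if $g$ is constant on a neighbourhood of $\operatorname{supp} f$. (Since $J$ is symmetric with a kernel with respect to $m$, the integrals do not depend on the choice of $m$-versions of $u,v$.) Assume that for $u,v\in\mathcal F\cap L^\infty$ the energy measure $\mu_{\langle u,v\rangle}$ of $\mathcal E^{(c)}$, determined by $$\int f\,d\mu_{\langle u,v\rangle}=\mathcal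 E^{(c)}(uf,v)+\mathcal E^{(c)}(vf,u)-\mathcal E^{(c)}(uv,f)\qquad (f\in\mathcal F\cap C_0(X)),$$ is absolutely continuous with respect to $m$, with density $\Gamma^{(c)}(u,v)\in L^1(X;m)$. Let $\mathcal F_{\rm loc}$ be the set of measurable functions that agree $m$-a.e. on each relatively compact open set with an element of $\mathcal F$, and extend $\Gamma^{(c)}$ to $\mathcal F_{\rm loc}\cap L^\infty$ by locality: on a relatively compact open set $G$, $\Gamma^{(c)}(u,v)=\Gamma^{(c)}(w_1,w_2)$ $m$-a.e. whenever $w_1,w_2\in\mathcal F\cap L^\infty$, $u=w_1$ and $v=w_2$ $m$-a.e. on $G$. Put $$\Gamma^{(j)}(u,v)(x)=\int_{y\neq x}(u(x)-u(y))(v(x)-v(y))\,j(x,dy),\qquad \Gamma=\tfrac12\Gamma^{(c)}+\Gamma^{(j)},\qquad \Gamma[u]=\Gamma(u,u).$$ Suppose that the jump range is uniformly bounded: there is $a>0$ with $\operatorname{supp} j(x,\cdot)\subset B(x,a)$ for every $x\in X$. Let $u\in\mathcal F\cap L^\infty$, and let $\varphi\in\mathcal F_{\rm loc}\cap L^\infty$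 be constant $m$-a.e. outside a compact set. Then $u\varphi\in\mathcal F$, the functions $u\,\Gamma(u,\varphi)$ and $\varphi\,\Gamma[u]$ are $m$-integrable, and $$\mathcal E(u,u\varphi)=\int_X u\,\Gamma(u,\varphi)\,dm+\int_X\varphi\,\Gamma[u]\,dm .$$ -/

import Mathlib

open MeasureTheory ProbabilityTheory Set Filter Topology

/-- A symmetric Dirichlet form `(form, domain)` in `L²(X; m)`: a densely defined, non-negative,
symmetric, closed bilinear form on which the unit contraction operates. -/
structure DirichletForm {X : Type*} [MeasurableSpace X] (m : Measure X) where
  domain : Submodule ℝ (Lp ℝ 2 m)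
  form : domain →ₗ[ℝ] domain →ₗ[ℝ] ℝ
  dense : Dense (domain : Set (Lp ℝ 2 m))
  symm : ∀ u v : domain, form u v = form v u
  nonneg : ∀ u : domain, 0 ≤ form u u
  /-- `domain` is complete for the norm `(form u u + ‖u‖²)^(1/2)`. -/
  closed : ∀ u : ℕ → domain,
    (∀ ε > 0, ∃ N, ∀ k ≥ N, ∀ l ≥ N,
      form (u k - u l) (u k - u l) + ‖(u k - u l : Lp ℝ 2 m)‖ ^ 2 < ε) →
    ∃ v : domain, Tendsto
      (fun k => form (u k - v) (u k - v) + ‖(u k - v : Lp ℝ 2 m)‖ ^ 2) atTop (𝓝 0)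
  /-- `(0 ∨ u) ∧ 1` lies in the domain and has no larger energy than `u`. -/
  markov : ∀ (u : domain) (v : Lp ℝ 2 m),
    (v : X → ℝ) =ᵐ[m] (fun x => min (max 0 ((u : Lp ℝ 2 m) x)) 1) →
    ∃ hv : v ∈ domain, form ⟨v, hv⟩ ⟨v, hv⟩ ≤ form u u

namespace DirichletForm

section Basic

variable {X : Type*} [MeasurableSpace X] {m : Measure X} (D : DirichletForm m)

/-- The function `u` (that is, its `m`-class) belongs to the domain `F`. -/
def Mem (u : X → ℝ) : Prop :=
  ∃ h : MemLp u 2 m, h.toLp u ∈ D.domain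

/-- `u ∈ F ∩ L^∞`. -/
def MemBdd (u : X → ℝ) : Prop :=
  D.Mem u ∧ MemLp u ⊤ m

open Classical in
/-- The value `E(u, v)` for functions `u, v ∈ F` (by convention `0` outside the domain). -/
noncomputable def energy (u v : X → ℝ) : ℝ :=
  if h : D.Mem u ∧ D.Mem v then D.form ⟨_, h.1.choose_spec⟩ ⟨_, h.2.choose_spec⟩ else 0

end Basic

section Jump

variable {X : Type*} [MeasurableSpace X]

/-- The jump measure `J(dx, dy) = j(x, dy) m(dx)` off the diagonal. -/
noncomputable def jumpMeasure (m : Measure X) (j : Kernel X X) : Measure (X × X) :=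
  (m.compProd j).restrict {p | p.1 ≠ p.2}

/-- The jump part `E^(j)(u, v) = ∬_{x ≠ y} (u(x) - u(y)) (v(x) - v(y)) j(x, dy) m(dx)`.
When `J` is symmetric both marginals of `J` are absolutely continuous with respect to `m`, so any
`m`-version of `u` and `v`, in particular a quasi-continuous one, gives the same value. -/
noncomputable def jumpEnergy (m : Measure X) (j : Kernel X X) (u v : X → ℝ) : ℝ :=
  ∫ p, (u p.1 - u p.2) * (v p.1 - v p.2) ∂(jumpMeasure m j)

/-- `Γ^(j)(u, v)(x) = ∫_{y ≠ x} (u(x) - u(y)) (v(x) - v(y)) j(x, dy)`. By `gammaJ_congr` below it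
does not depend on the chosen `m`-versions, so quasi-continuous versions need not be singled out. -/
noncomputable def gammaJ (j : Kernel X X) (u v : X → ℝ) (x : X) : ℝ :=
  ∫ y in {x}ᶜ, (u x - u y) * (v x - v y) ∂(j x)

/-- For a symmetric jump measure, `Γ^(j)(u, v)` depends, up to `m`-null sets, only on the
`m`-classes of `u` and `v`. -/
theorem gammaJ_congr [MeasurableEq X] {m : Measure X} [SFinite m] {j : Kernel X X}
    [IsSFiniteKernel j] (hJ : (jumpMeasure m j).map Prod.swap = jumpMeasure m j)
    {u u' v v' : X → ℝ} (hu : u =ᵐ[m] u') (hv : v =ᵐ[m] v') :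
    gammaJ j u v =ᵐ[m] gammaJ j u' v' := by
  have hswap : ∀ {w w' : X → ℝ}, w =ᵐ[m] w' → ∀ᵐ x ∂m, ∀ᵐ y ∂(j x), x ≠ y → w y = w' y := by
    intro w w' hw
    obtain ⟨N, hNsub, hN, hN0⟩ := exists_measurable_superset_of_null (ae_iff.1 hw)
    have h1 : jumpMeasure m j (N ×ˢ univ) = 0 := by
      refine le_antisymm ((Measure.restrict_apply_le _ _).trans ?_) zero_le
      rw [Measure.compProd_apply_prod hN MeasurableSet.univ, setLIntegral_measure_zero _ _ hN0]
    have h2 : jumpMeasure m j (univ ×ˢ N) = 0 := by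
      rw [← hJ, Measure.map_apply measurable_swap (MeasurableSet.univ.prod hN), preimage_swap_prod]
      exact h1
    have hd : MeasurableSet {p : X × X | p.1 ≠ p.2} :=
      (measurableSet_eq_fun measurable_fst measurable_snd).compl
    have h3 : ∀ᵐ p ∂(m.compProd j), p.1 ≠ p.2 → p.2 ∉ N := by
      refine (ae_restrict_iff' hd).1 (ae_iff.2 (measure_mono_null ?_ h2))
      intro p hp
      simpa using hp
    filter_upwards [Measure.ae_ae_of_ae_compProd h3] with x hx
    filter_upwards [hx] with y hy hxy
    by_contra hne
    exact hy hxy (hNsub hne)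
  filter_upwards [hu, hv, hswap hu, hswap hv] with x hux hvx huy hvy
  refine setIntegral_congr_ae (measurableSet_singleton x).compl ?_
  filter_upwards [huy, hvy] with y h1 h2 hy
  have hxy : x ≠ y := fun h => hy h.symm
  rw [hux, hvx, h1 hxy, h2 hxy]

/-- The remaining part `E^(c) = E - E^(j)` of the form. -/
noncomputable def localEnergy {m : Measure X} (D : DirichletForm m) (j : Kernel X X)
    (u v : X → ℝ) : ℝ :=
  D.energy u v - jumpEnergy m j u v

end Jump

section Topological

variable {X : Type*} [MetricSpace X] [MeasurableSpace X] {m : Measure X} (D : DirichletForm m)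

/-- `f ∈ F ∩ C₀(X)`, where `C₀(X)` is the space of continuous functions of compact support. -/
def MemCore (f : X → ℝ) : Prop :=
  Continuous f ∧ HasCompactSupport f ∧ D.Mem f

/-- Regularity: `F ∩ C₀(X)` is dense in `F` for the `E₁`-norm and dense in `C₀(X)` for the
uniform norm. -/
def IsRegular : Prop :=
  (∀ u, D.Mem u → ∀ ε > 0, ∃ f, D.MemCore f ∧
    D.energy (u - f) (u - f) + ∫ x, (u x - f x) ^ 2 ∂m < ε) ∧
  (∀ g : X → ℝ, Continuous g → HasCompactSupport g → ∀ ε > 0, ∃ f, D.MemCore f ∧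
    ∀ x, |f x - g x| < ε)

/-- `u ∈ F_loc`: on every relatively compact open set `u` agrees `m`-a.e. with an element
of `F`. -/
def MemLoc (u : X → ℝ) : Prop :=
  AEStronglyMeasurable u m ∧
    ∀ G : Set X, IsOpen G → IsCompact (closure G) → ∃ w, D.Mem w ∧ u =ᵐ[m.restrict G] w

/-- The Beurling-Deny decomposition of the form is `E = E^(c) + E^(j)`: the jump measure is given
by the symmetric kernel `j`, `E^(c)` is a (non-negative) strongly local symmetric form on
`F ∩ C₀(X)`, and there is no killing part. -/
structure HasJumpKernel (j : Kernel X X) : Prop where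
  symm : (jumpMeasure m j).map Prod.swap = jumpMeasure m j
  integrable : ∀ f, D.MemCore f →
    Integrable (fun p : X × X => (f p.1 - f p.2) ^ 2) (jumpMeasure m j)
  nonneg : ∀ f, D.MemCore f → 0 ≤ D.localEnergy j f f
  /-- `E^(c)(f, g) = 0` if `g` is constant on a neighbourhood of the support of `f`. -/
  stronglyLocal : ∀ f g, D.MemCore f → D.MemCore g →
    (∃ (c : ℝ) (U : Set X), IsOpen U ∧ tsupport f ⊆ U ∧ ∀ x ∈ U, g x = c) →
    D.localEnergy j f g = 0

/-- For `u, v ∈ F ∩ L^∞`: the energy measure `μ_⟨u,v⟩` of the strongly local part, i.e. the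
signed measure with `∫ f dμ_⟨u,v⟩ = E^(c)(u f, v) + E^(c)(v f, u) - E^(c)(u v, f)` for all
`f ∈ F ∩ C₀(X)` (for `u = v`: `2 E^(c)(u f, u) - E^(c)(u², f)`), is `g dm` with `g ∈ L¹(X; m)`.
Its total mass is `2 E^(c)(u, v)`. -/
def IsEnergyDensity (j : Kernel X X) (u v g : X → ℝ) : Prop :=
  Integrable g m ∧ ∀ f, D.MemCore f →
    ∫ x, f x * g x ∂m =
      D.localEnergy j (u * f) v + D.localEnergy j (v * f) u - D.localEnergy j (u * v) f

/-- The energy measures of the strongly local part are absolutely continuous with respect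
to `m`. -/
def HasEnergyDensities (j : Kernel X X) : Prop :=
  ∀ u v, D.MemBdd u → D.MemBdd v → ∃ g, D.IsEnergyDensity j u v g

/-- `g` is the density of the energy measure `μ_⟨u,v⟩` for functions `u, v` that agree locally with
functions of `F ∩ L^∞`: on each relatively compact open set `G` on which `u = w₁` and `v = w₂`
with `w₁, w₂ ∈ F ∩ L^∞`, it is the density of `μ_⟨w₁,w₂⟩`. If `u, v ∈ F ∩ L^∞` themselves,
then (with `w₁ = u`, `w₂ = v`) `g` is the density of `μ_⟨u,v⟩`. -/
def IsLocalEnergyDensity (j : Kernel X X) (u v g : X → ℝ) : Prop :=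
  AEStronglyMeasurable g m ∧
    ∀ G : Set X, IsOpen G → IsCompact (closure G) →
      ∀ w₁ w₂ h, D.MemBdd w₁ → D.MemBdd w₂ → u =ᵐ[m.restrict G] w₁ → v =ᵐ[m.restrict G] w₂ →
        D.IsEnergyDensity j w₁ w₂ h → g =ᵐ[m.restrict G] h

open Classical in
/-- `Γ^(c)(u, v)`, the density of the energy measure `μ_⟨u,v⟩` with respect to `m`. -/
noncomputable def gammaC (j : Kernel X X) (u v : X → ℝ) : X → ℝ :=
  if h : ∃ g, D.IsLocalEnergyDensity j u v g then h.choose else 0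

/-- `Γ(u, v) = ½ Γ^(c)(u, v) + Γ^(j)(u, v)`, so that `E(u, v) = ∫ Γ(u, v) dm`. -/
noncomputable def gamma (j : Kernel X X) (u v : X → ℝ) (x : X) : ℝ :=
  1 / 2 * D.gammaC j u v x + gammaJ j u v x

end Topological

end DirichletForm

/-- The jump range is uniformly bounded: for some `a > 0`, `supp j(x, ·) ⊆ B(x, a)` for
every `x`. -/
def HasBoundedJumpRange {X : Type*} [MetricSpace X] [MeasurableSpace X] (j : Kernel X X) : Prop :=
  ∃ a > 0, ∀ x, (j x).support ⊆ Metric.ball x a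

/-! Since `φ` is a constant `c` off a compact set, cutting off gives `φ = ψ + c` a.e. with `ψ ∈ F ∩
L^∞` (`MemLoc.exists_memBdd`). The claim then splits into the Leibniz rule for `E(u, uψ)` and,
multiplied by `c`, the identity `E(u, u) = ∫ Γ[u] dm`.

The Leibniz rule for the jump part is a symmetrization in `(x, y)`. For the local part, the identity
defining the energy density is applied to `μ_⟨u,ψ⟩` with test function `u` and to `μ_⟨u,u⟩` with
test function `ψ`; adding the two leaves `2 E^(c)(u, uψ)`. These test functions are only in `F ∩
L^∞`, so the identity is first extended from the core (`IsEnergyDensity.integral_mul`). This rests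
on two facts: energy-bounded sequences converging in `L²` converge weakly in `F`, and `F ∩ L^∞` is
an algebra with an energy estimate (`Mem.mul`).

The identity for `E(u, u)` says that `μ_⟨u,u⟩` has total mass `2 E^(c)(u, u)`
(`IsEnergyDensity.integral_eq`). For `u` in the core this is strong locality, tested with cutoffs
equal to 1 near the support of `u`. To pass to general `u` one needs the density of a core function
to be non-negative. Resolvent approximation yields positivity only for the whole form, that is `g +
2 Γ^(j)[u] ≥ 0`. The jump term is removed by composing with sawtooth functions of slope `±1` and
height `2⁻ⁿ`: off the dyadic levels they leave the local density unchanged, while their `Γ^(j)`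
tends to 0. The dyadic levels are reached by shifting the function by `1/3`. -/

set_option linter.unusedSectionVars false

namespace DirichletForm

/-! ### The domain as a Hilbert space, and weak compactness. -/

section Hilbert

variable {X : Type*} [MeasurableSpace X] {m : Measure X} (D : DirichletForm m)

/-- The domain of a Dirichlet form, to be normed by the form norm `E₁`. -/
def Dom : Type _ := D.domain

instance : AddCommGroup D.Dom := inferInstanceAs (AddCommGroup D.domain)

instance : Module ℝ D.Dom := inferInstanceAs (Module ℝ D.domain)

/-- The inclusion of the domain into `L²`. -/
def incl : D.Dom →ₗ[ℝ] Lp ℝ 2 m := D.domain.subtype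

/-- The form on the domain. -/
def domForm : D.Dom →ₗ[ℝ] D.Dom →ₗ[ℝ] ℝ := D.form

theorem incl_injective : Function.Injective D.incl := D.domain.injective_subtype

theorem domForm_symm (u v : D.Dom) : D.domForm u v = D.domForm v u := D.symm u v

theorem domForm_nonneg (u : D.Dom) : 0 ≤ D.domForm u u := D.nonneg u

/-- The inner product lives on the synonym `Dom` because `D.domain`, as a submodule of `Lp`, already
carries the `L²` norm. -/
noncomputable instance domCore : InnerProductSpace.Core ℝ D.Dom where
  inner u v := D.domForm u v + inner ℝ (D.incl u) (D.incl v)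
  conj_inner_symm u v := by
    simp only [conj_trivial]
    rw [D.domForm_symm, real_inner_comm]
  re_inner_nonneg u := by
    have h1 := D.domForm_nonneg u
    have h2 : 0 ≤ inner ℝ (D.incl u) (D.incl u) := real_inner_self_nonneg
    simpa using add_nonneg h1 h2
  add_left u v w := by
    simp only [map_add, LinearMap.add_apply, inner_add_left]; ring
  smul_left u v r := by
    simp only [map_smul, LinearMap.smul_apply, inner_smul_left, smul_eq_mul, conj_trivial]; ring
  definite u h := by
    have h1 := D.domForm_nonneg u
    have h2 : 0 ≤ inner ℝ (D.incl u) (D.incl u) := real_inner_self_nonneg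
    have h3 : inner ℝ (D.incl u) (D.incl u) = 0 := by
      have h' : D.domForm u u + inner ℝ (D.incl u) (D.incl u) = 0 := h
      linarith
    exact D.incl_injective (by rw [inner_self_eq_zero.1 h3, map_zero])

noncomputable instance : NormedAddCommGroup D.Dom :=
  InnerProductSpace.Core.toNormedAddCommGroup (𝕜 := ℝ)

noncomputable instance : InnerProductSpace ℝ D.Dom := InnerProductSpace.ofCore _

theorem inner_dom (u v : D.Dom) :
    inner ℝ u v = D.domForm u v + inner ℝ (D.incl u) (D.incl v) := rfl

theorem norm_sq_dom (u : D.Dom) : ‖u‖ ^ 2 = D.domForm u u + ‖D.incl u‖ ^ 2 := by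
  rw [← real_inner_self_eq_norm_sq, inner_dom, real_inner_self_eq_norm_sq]

instance : CompleteSpace D.Dom := by
  refine Metric.complete_of_cauchySeq_tendsto fun u hu => ?_
  have hcl := D.closed u (fun ε hε => by
    obtain ⟨N, hN⟩ := Metric.cauchySeq_iff.1 hu (Real.sqrt ε) (Real.sqrt_pos.2 hε)
    refine ⟨N, fun k hk l hl => ?_⟩
    have h := hN k hk l hl
    rw [dist_eq_norm] at h
    have h2 := D.norm_sq_dom (u k - u l)
    have h3 : ‖u k - u l‖ ^ 2 < ε := by
      calc _ < Real.sqrt ε ^ 2 := by gcongr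
        _ = ε := Real.sq_sqrt hε.le
    rw [h2] at h3
    exact h3)
  obtain ⟨v, hv⟩ := hcl
  let v' : D.Dom := v
  have h2 : Tendsto (fun k => ‖u k - v'‖ ^ 2) atTop (𝓝 0) :=
    hv.congr fun k => (D.norm_sq_dom (u k - v')).symm
  refine ⟨v', ?_⟩
  rw [tendsto_iff_norm_sub_tendsto_zero]
  have h3 := h2.sqrt
  simpa [Real.sqrt_sq] using h3

theorem norm_incl_le (u : D.Dom) : ‖D.incl u‖ ≤ ‖u‖ := by
  have := D.norm_sq_dom u
  have := D.domForm_nonneg u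
  exact le_of_sq_le_sq (by linarith) (norm_nonneg _)

/-- The inclusion of the domain into `L²` as a continuous map. -/
noncomputable def inclL : D.Dom →L[ℝ] Lp ℝ 2 m :=
  D.incl.mkContinuous 1 (fun u => by simpa using D.norm_incl_le u)

/-- The adjoint of the inclusion `F → L²` for the `E₁` inner product is the resolvent `G₁`. -/
theorem exists_resolvent_one (u : Lp ℝ 2 m) :
    ∃ w : D.Dom, ∀ v : D.Dom, D.domForm w v + inner ℝ (D.incl w) (D.incl v)
      = inner ℝ u (D.incl v) :=
  ⟨D.inclL.adjoint u, fun v => by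
    rw [← inner_dom, ContinuousLinearMap.adjoint_inner_left]; rfl⟩

/-- Bounded sequences in the domain that converge in `L²` converge weakly in the domain. -/
theorem exists_tendsto_of_bounded (w : ℕ → D.Dom) (C : ℝ) (hC : ∀ n, ‖w n‖ ≤ C)
    (u : Lp ℝ 2 m) (hu : Tendsto (fun n => D.incl (w n)) atTop (𝓝 u)) :
    ∃ z : D.Dom, D.incl z = u ∧
      ∀ l : D.Dom →L[ℝ] ℝ, Tendsto (fun n => l (w n)) atTop (𝓝 (l z)) := by
  set A : Lp ℝ 2 m →L[ℝ] D.Dom := D.inclL.adjoint with hA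
  have hAl : ∀ (h : Lp ℝ 2 m) (v : D.Dom), inner ℝ (A h) v = inner ℝ h (D.incl v) := fun h v => by
    rw [hA, ContinuousLinearMap.adjoint_inner_left]; rfl
  have hlim : ∀ h, Tendsto (fun n => inner ℝ (A h) (w n)) atTop (𝓝 (inner ℝ h u)) := fun h => by
    simp only [hAl]
    exact (continuous_const.inner continuous_id).continuousAt.tendsto.comp hu
  -- Vectors `A h` see `z` only through its `L²` class. As the inclusion is injective, the range of
  -- `A` has trivial orthogonal complement, hence is dense.
  have hdense : ∀ z : D.Dom, (∀ h, inner ℝ (A h) z = 0) → z = 0 := fun z hz => by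
    have := hz (D.incl z)
    rw [hAl, inner_self_eq_zero] at this
    exact D.incl_injective (by rw [this, map_zero])
  have hrange : Dense (Set.range A) := by
    have : (LinearMap.range A.toLinearMap).topologicalClosure = ⊤ := by
      rw [Submodule.topologicalClosure_eq_top_iff, Submodule.eq_bot_iff]
      intro z hz
      refine hdense z fun h => ?_
      exact (Submodule.mem_orthogonal _ _).1 hz _ ⟨h, rfl⟩
    have h2 := Submodule.dense_iff_topologicalClosure_eq_top.2 this
    have h3 : ((LinearMap.range A.toLinearMap : Submodule ℝ D.Dom) : Set D.Dom) = Set.range A :=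
      LinearMap.coe_range _
    rwa [h3] at h2
  -- Banach–Alaoglu gives a weak cluster point. Testing against the range of `A` identifies it with
  -- `u`, and density together with the norm bound then makes the whole sequence converge weakly.
  let W : ℕ → WeakDual ℝ D.Dom :=
    fun n => StrongDual.toWeakDual (InnerProductSpace.toDual ℝ D.Dom (w n))
  have hWc := WeakDual.isCompact_closedBall (𝕜 := ℝ) (E := D.Dom) 0 C
  obtain ⟨f, -, hf⟩ := hWc.exists_mapClusterPt (f := atTop) (u := W) (by
    refine Filter.le_principal_iff.2 (Filter.mem_map.2 (Filter.univ_mem' fun n => ?_))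
    simp [W, hC n])
  set z : D.Dom := (InnerProductSpace.toDual ℝ D.Dom).symm (WeakDual.toStrongDual f) with hz
  have hfz : ∀ v, f v = inner ℝ z v := fun v => by
    rw [hz, InnerProductSpace.toDual_symm_apply]; rfl
  have hclu : ∀ h, inner ℝ (A h) z = inner ℝ h u := fun h => by
    have hev : Continuous (fun g : WeakDual ℝ D.Dom => g (A h)) := WeakDual.eval_continuous _
    have h1 : MapClusterPt (f (A h)) atTop (fun n => W n (A h)) :=
      MapClusterPt.continuousAt_comp hev.continuousAt hf
    have h2 : (fun n => W n (A h)) = fun n => inner ℝ (A h) (w n) := by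
      funext n
      rw [real_inner_comm]
      rfl
    rw [h2] at h1
    have h3 : f (A h) = inner ℝ h u := by
      obtain ⟨l, hl1, hl2⟩ := mapClusterPt_iff_ultrafilter.1 h1
      exact tendsto_nhds_unique hl2 ((hlim h).mono_left hl1)
    rw [← h3, hfz, real_inner_comm]
  have hzu : D.incl z = u := by
    have : ∀ h, inner ℝ h (D.incl z) = inner ℝ h u := fun h => by rw [← hAl, hclu]
    exact ext_inner_left ℝ this
  refine ⟨z, hzu, fun l => ?_⟩
  obtain ⟨y, rfl⟩ := (InnerProductSpace.toDual ℝ D.Dom).surjective l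
  simp only [InnerProductSpace.toDual_apply_apply]
  have hCpos : 0 ≤ C := (norm_nonneg _).trans (hC 0)
  rw [Metric.tendsto_atTop]
  intro ε hε
  set K := C + ‖z‖ + 1 with hK
  have hKpos : 0 < K := by positivity
  obtain ⟨_, hy, ⟨h, rfl⟩⟩ := Metric.dense_iff.1 hrange y (ε / 2 / K) (by positivity)
  have hy' : ‖y - A h‖ < ε / 2 / K := by
    rw [Metric.mem_ball, dist_comm, dist_eq_norm] at hy; exact hy
  obtain ⟨N, hN⟩ := Metric.tendsto_atTop.1 (hlim h) (ε / 2) (by positivity)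
  refine ⟨N, fun n hn => ?_⟩
  have h1 := hN n hn
  rw [← hclu h, Real.dist_eq, ← inner_sub_right] at h1
  rw [Real.dist_eq, ← inner_sub_right]
  have h2 : inner ℝ y (w n - z) = inner ℝ (y - A h) (w n - z) + inner ℝ (A h) (w n - z) := by
    rw [← inner_add_left, sub_add_cancel]
  have h3 : |inner ℝ (y - A h) (w n - z)| ≤ ε / 2 / K * K := by
    refine (abs_real_inner_le_norm _ _).trans ?_
    gcongr
    calc ‖w n - z‖ ≤ ‖w n‖ + ‖z‖ := norm_sub_le _ _
      _ ≤ K := by rw [hK]; linarith [hC n]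
  rw [div_mul_cancel₀ _ hKpos.ne'] at h3
  rw [h2]
  calc _ ≤ _ := abs_add_le _ _
    _ < ε := by linarith

end Hilbert

end DirichletForm

namespace DirichletForm

/-! ### The form on functions, independently of representatives. -/

section Functions

variable {X : Type*} [MeasurableSpace X] {m : Measure X} {D : DirichletForm m}
  {u v w u' v' : X → ℝ}

theorem Mem.memLp (h : D.Mem u) : MemLp u 2 m := h.1

theorem mem_iff : D.Mem u ↔ ∃ w : D.Dom, (D.incl w : X → ℝ) =ᵐ[m] u := by
  constructor
  · rintro ⟨h, hd⟩
    exact ⟨⟨_, hd⟩, h.coeFn_toLp⟩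
  · rintro ⟨w, hw⟩
    have h : MemLp u 2 m := (memLp_congr_ae hw).1 (Lp.memLp _)
    refine ⟨h, ?_⟩
    have : h.toLp u = D.incl w := Lp.ext (h.coeFn_toLp.trans hw.symm)
    rw [this]
    exact w.2

/-- Frees `energy` from the choices in its definition: any domain elements representing the two
functions may be used. -/
theorem energy_eq {a b : D.Dom} (ha : (D.incl a : X → ℝ) =ᵐ[m] u)
    (hb : (D.incl b : X → ℝ) =ᵐ[m] v) : D.energy u v = D.domForm a b := by
  have hu : D.Mem u := mem_iff.2 ⟨a, ha⟩
  have hv : D.Mem v := mem_iff.2 ⟨b, hb⟩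
  rw [energy, dif_pos ⟨hu, hv⟩]
  have h1 : (⟨_, hu.choose_spec⟩ : D.domain) = a :=
    Subtype.ext (Lp.ext (hu.choose.coeFn_toLp.trans ha.symm))
  have h2 : (⟨_, hv.choose_spec⟩ : D.domain) = b :=
    Subtype.ext (Lp.ext (hv.choose.coeFn_toLp.trans hb.symm))
  rw [h1, h2]
  rfl

theorem incl_add_ae {a b : D.Dom} (ha : (D.incl a : X → ℝ) =ᵐ[m] u)
    (hb : (D.incl b : X → ℝ) =ᵐ[m] v) : (D.incl (a + b) : X → ℝ) =ᵐ[m] u + v := by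
  rw [map_add]
  exact (Lp.coeFn_add _ _).trans (ha.add hb)

theorem incl_smul_ae {a : D.Dom} (c : ℝ) (ha : (D.incl a : X → ℝ) =ᵐ[m] u) :
    (D.incl (c • a) : X → ℝ) =ᵐ[m] c • u := by
  rw [map_smul]
  exact (Lp.coeFn_smul _ _).trans (ha.const_smul c)

theorem Mem.congr (h : D.Mem u) (huv : u =ᵐ[m] v) : D.Mem v := by
  obtain ⟨a, ha⟩ := mem_iff.1 h
  exact mem_iff.2 ⟨a, ha.trans huv⟩

theorem mem_congr (huv : u =ᵐ[m] v) : D.Mem u ↔ D.Mem v :=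
  ⟨fun h => h.congr huv, fun h => h.congr huv.symm⟩

theorem Mem.add (hu : D.Mem u) (hv : D.Mem v) : D.Mem (u + v) := by
  obtain ⟨a, ha⟩ := mem_iff.1 hu
  obtain ⟨b, hb⟩ := mem_iff.1 hv
  exact mem_iff.2 ⟨a + b, incl_add_ae ha hb⟩

theorem Mem.smul (c : ℝ) (hu : D.Mem u) : D.Mem (c • u) := by
  obtain ⟨a, ha⟩ := mem_iff.1 hu
  exact mem_iff.2 ⟨c • a, incl_smul_ae c ha⟩

theorem Mem.neg (hu : D.Mem u) : D.Mem (-u) := by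
  have := hu.smul (-1); rwa [neg_one_smul] at this

theorem Mem.sub (hu : D.Mem u) (hv : D.Mem v) : D.Mem (u - v) := by
  rw [sub_eq_add_neg]; exact hu.add hv.neg

theorem energy_congr (hu : u =ᵐ[m] u') (hv : v =ᵐ[m] v') : D.energy u v = D.energy u' v' := by
  by_cases h : D.Mem u ∧ D.Mem v
  · obtain ⟨a, ha⟩ := mem_iff.1 h.1
    obtain ⟨b, hb⟩ := mem_iff.1 h.2
    rw [energy_eq ha hb, energy_eq (ha.trans hu) (hb.trans hv)]
  · have h' : ¬ (D.Mem u' ∧ D.Mem v') := by rwa [← mem_congr hu, ← mem_congr hv]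
    rw [energy, energy, dif_neg h, dif_neg h']

theorem energy_comm (u v : X → ℝ) : D.energy u v = D.energy v u := by
  by_cases h : D.Mem u ∧ D.Mem v
  · obtain ⟨a, ha⟩ := mem_iff.1 h.1
    obtain ⟨b, hb⟩ := mem_iff.1 h.2
    rw [energy_eq ha hb, energy_eq hb ha, domForm_symm]
  · have h' : ¬ (D.Mem v ∧ D.Mem u) := by rwa [and_comm]
    rw [energy, energy, dif_neg h, dif_neg h']

theorem energy_self_nonneg (u : X → ℝ) : 0 ≤ D.energy u u := by
  by_cases h : D.Mem u
  · obtain ⟨a, ha⟩ := mem_iff.1 h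
    rw [energy_eq ha ha]
    exact D.domForm_nonneg a
  · rw [energy, dif_neg (by tauto)]

theorem energy_add_left (hu : D.Mem u) (hv : D.Mem v) (hw : D.Mem w) :
    D.energy (u + v) w = D.energy u w + D.energy v w := by
  obtain ⟨a, ha⟩ := mem_iff.1 hu
  obtain ⟨b, hb⟩ := mem_iff.1 hv
  obtain ⟨c, hc⟩ := mem_iff.1 hw
  rw [energy_eq (incl_add_ae ha hb) hc, energy_eq ha hc, energy_eq hb hc, map_add,
    LinearMap.add_apply]

theorem energy_smul_left (c : ℝ) (hu : D.Mem u) (hw : D.Mem w) :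
    D.energy (c • u) w = c * D.energy u w := by
  obtain ⟨a, ha⟩ := mem_iff.1 hu
  obtain ⟨b, hb⟩ := mem_iff.1 hw
  rw [energy_eq (incl_smul_ae c ha) hb, energy_eq ha hb, map_smul, LinearMap.smul_apply,
    smul_eq_mul]

theorem energy_add_right (hu : D.Mem u) (hv : D.Mem v) (hw : D.Mem w) :
    D.energy w (u + v) = D.energy w u + D.energy w v := by
  rw [energy_comm, energy_add_left hu hv hw, energy_comm u, energy_comm v]

theorem energy_smul_right (c : ℝ) (hu : D.Mem u) (hw : D.Mem w) :
    D.energy w (c • u) = c * D.energy w u := by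
  rw [energy_comm, energy_smul_left c hu hw, energy_comm u]

theorem energy_sub_left (hu : D.Mem u) (hv : D.Mem v) (hw : D.Mem w) :
    D.energy (u - v) w = D.energy u w - D.energy v w := by
  have h : u - v = u + (-1 : ℝ) • v := by rw [neg_one_smul, sub_eq_add_neg]
  rw [h, energy_add_left hu (hv.smul _) hw, energy_smul_left _ hv hw]; ring

theorem energy_sub_right (hu : D.Mem u) (hv : D.Mem v) (hw : D.Mem w) :
    D.energy w (u - v) = D.energy w u - D.energy w v := by
  rw [energy_comm, energy_sub_left hu hv hw, energy_comm u, energy_comm v]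

theorem energy_add_self (hu : D.Mem u) (hv : D.Mem v) :
    D.energy (u + v) (u + v) = D.energy u u + 2 * D.energy u v + D.energy v v := by
  rw [energy_add_left hu hv (hu.add hv), energy_add_right hu hv hu, energy_add_right hu hv hv,
    energy_comm v u]; ring

theorem energy_sub_self (hu : D.Mem u) (hv : D.Mem v) :
    D.energy (u - v) (u - v) = D.energy u u - 2 * D.energy u v + D.energy v v := by
  rw [energy_sub_left hu hv (hu.sub hv), energy_sub_right hu hv hu, energy_sub_right hu hv hv,
    energy_comm v u]; ring

theorem energy_smul_self (c : ℝ) (hu : D.Mem u) :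
    D.energy (c • u) (c • u) = c ^ 2 * D.energy u u := by
  rw [energy_smul_left c hu (hu.smul c), energy_smul_right c hu hu]; ring

theorem energy_neg_self (hu : D.Mem u) : D.energy (-u) (-u) = D.energy u u := by
  rw [← neg_one_smul ℝ u, energy_smul_self _ hu]; ring

theorem energy_add_self_le (hu : D.Mem u) (hv : D.Mem v) :
    D.energy (u + v) (u + v) ≤ 2 * (D.energy u u + D.energy v v) := by
  have h1 := energy_sub_self hu hv
  have h2 := energy_self_nonneg (D := D) (u - v)
  rw [energy_add_self hu hv]; linarith

theorem energy_sub_self_le (hu : D.Mem u) (hv : D.Mem v) :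
    D.energy (u - v) (u - v) ≤ 2 * (D.energy u u + D.energy v v) := by
  rw [sub_eq_add_neg, ← energy_neg_self hv]
  exact energy_add_self_le hu hv.neg

end Functions

/-- The Cauchy-Schwarz inequality, from non-negativity of a quadratic polynomial. -/
theorem sq_le_mul_of_quadratic_nonneg {a b c : ℝ}
    (h : ∀ t : ℝ, 0 ≤ a * t ^ 2 + 2 * b * t + c) : b ^ 2 ≤ a * c := by
  have := discrim_le_zero (a := a) (b := 2 * b) (c := c) (fun x => by have := h x; nlinarith)
  rw [discrim] at this
  nlinarith

/-! ### Bounded functionals and weak limits of energy-bounded sequences. -/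

section Functionals

variable {X : Type*} [MeasurableSpace X] {m : Measure X} {D : DirichletForm m}
  {u v w : X → ℝ}

theorem energy_sq_le (hu : D.Mem u) (hv : D.Mem v) :
    D.energy u v ^ 2 ≤ D.energy u u * D.energy v v := by
  refine sq_le_mul_of_quadratic_nonneg fun t => ?_
  have h := energy_self_nonneg (D := D) (t • u + v)
  rw [energy_add_self (hu.smul t) hv, energy_smul_self t hu, energy_smul_left t hu hv] at h
  linarith

theorem sqrt_energy_add_le (hu : D.Mem u) (hv : D.Mem v) :
    √(D.energy (u + v) (u + v)) ≤ √(D.energy u u) + √(D.energy v v) := by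
  refine Real.sqrt_le_iff.2 ⟨by positivity, ?_⟩
  have h1 : D.energy u v ≤ √(D.energy u u) * √(D.energy v v) := by
    rw [← Real.sqrt_mul (energy_self_nonneg u)]
    exact Real.le_sqrt_of_sq_le (energy_sq_le hu hv)
  rw [energy_add_self hu hv, add_sq, Real.sq_sqrt (energy_self_nonneg u),
    Real.sq_sqrt (energy_self_nonneg v)]
  linarith

variable (D) in
/-- A linear functional on the domain that is bounded by a multiple of the form. -/
structure IsBoundedFunctional (l : (X → ℝ) → ℝ) : Prop where
  congr : ∀ u v, u =ᵐ[m] v → l u = l v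
  add : ∀ u v, D.Mem u → D.Mem v → l (u + v) = l u + l v
  smul : ∀ (c : ℝ) u, D.Mem u → l (c • u) = c * l u
  bound : ∃ K : ℝ, ∀ u, D.Mem u → l u ^ 2 ≤ K * D.energy u u

theorem isBoundedFunctional_energy (hv : D.Mem v) :
    D.IsBoundedFunctional (fun u => D.energy u v) where
  congr _ _ h := energy_congr h EventuallyEq.rfl
  add _ _ h h' := energy_add_left h h' hv
  smul c _ h := energy_smul_left c h hv
  bound := ⟨D.energy v v, fun u hu => by rw [mul_comm]; exact energy_sq_le hu hv⟩

/-- The continuous linear form on the domain given by a bounded functional. -/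
theorem IsBoundedFunctional.exists_clm {l : (X → ℝ) → ℝ} (hl : D.IsBoundedFunctional l) :
    ∃ L : D.Dom →L[ℝ] ℝ, ∀ (a : D.Dom) (u : X → ℝ), (D.incl a : X → ℝ) =ᵐ[m] u → L a = l u := by
  obtain ⟨K, hK⟩ := hl.bound
  have hmem : ∀ a : D.Dom, D.Mem (D.incl a : X → ℝ) := fun a => mem_iff.2 ⟨a, .rfl⟩
  let L0 : D.Dom →ₗ[ℝ] ℝ :=
    { toFun := fun a => l (D.incl a : X → ℝ)
      map_add' := fun a b => by
        rw [hl.congr _ _ (incl_add_ae (a := a) (b := b) .rfl .rfl), hl.add _ _ (hmem a) (hmem b)]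
      map_smul' := fun c a => by
        rw [hl.congr _ _ (incl_smul_ae (a := a) c .rfl), hl.smul _ _ (hmem a)]; rfl }
  -- The absolute value is needed because the constant in `bound` is not assumed non-negative.
  refine ⟨L0.mkContinuous (√|K|) fun a => ?_, fun a u h => hl.congr _ _ h⟩
  rw [Real.norm_eq_abs]
  refine abs_le_of_sq_le_sq ?_ (by positivity)
  rw [mul_pow, Real.sq_sqrt (abs_nonneg K)]
  calc L0 a ^ 2 ≤ K * D.energy (D.incl a) (D.incl a) := hK _ (hmem a)
    _ ≤ |K| * D.energy (D.incl a) (D.incl a) := by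
        gcongr
        · exact energy_self_nonneg _
        · exact le_abs_self K
    _ ≤ |K| * ‖a‖ ^ 2 := by
        rw [energy_eq (a := a) (b := a) .rfl .rfl, norm_sq_dom]
        gcongr
        nlinarith [norm_nonneg (D.incl a)]

/-- Weak compactness of energy-bounded sets, for sequences converging in `L²`. -/
theorem mem_of_energy_bounded {w : ℕ → X → ℝ} (hw : ∀ n, D.Mem (w n)) {C : ℝ}
    (hC : ∀ n, D.energy (w n) (w n) ≤ C) (hu : MemLp u 2 m)
    (hlim : Tendsto (fun n => eLpNorm (w n - u) 2 m) atTop (𝓝 0)) :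
    D.Mem u ∧ ∀ l, D.IsBoundedFunctional l → Tendsto (fun n => l (w n)) atTop (𝓝 (l u)) := by
  choose a ha using fun n => mem_iff.1 (hw n)
  have hlim' : Tendsto (fun n => D.incl (a n)) atTop (𝓝 (hu.toLp u)) := by
    rw [Lp.tendsto_Lp_iff_tendsto_eLpNorm']
    refine hlim.congr fun n => eLpNorm_congr_ae ?_
    exact (ha n).symm.sub hu.coeFn_toLp.symm
  obtain ⟨B, hB⟩ := hlim'.norm.bddAbove_range
  obtain ⟨z, hz, hz'⟩ := D.exists_tendsto_of_bounded a (√(C + B ^ 2)) (fun n => by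
    refine Real.le_sqrt_of_sq_le ?_
    have h1 : ‖D.incl (a n)‖ ≤ B := hB ⟨n, rfl⟩
    have h2 := hC n
    rw [energy_eq (ha n) (ha n)] at h2
    rw [norm_sq_dom]
    gcongr) _ hlim'
  have hzu : (D.incl z : X → ℝ) =ᵐ[m] u := by rw [hz]; exact hu.coeFn_toLp
  refine ⟨mem_iff.2 ⟨z, hzu⟩, fun l hl => ?_⟩
  obtain ⟨L, hL⟩ := hl.exists_clm
  have := hz' L
  rw [hL z u hzu] at this
  exact this.congr fun n => hL _ _ (ha n)

theorem tendsto_energy_of_bounded {w : ℕ → X → ℝ} (hw : ∀ n, D.Mem (w n)) {C : ℝ}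
    (hC : ∀ n, D.energy (w n) (w n) ≤ C) (hu : MemLp u 2 m)
    (hlim : Tendsto (fun n => eLpNorm (w n - u) 2 m) atTop (𝓝 0)) (hv : D.Mem v) :
    Tendsto (fun n => D.energy (w n) v) atTop (𝓝 (D.energy u v)) :=
  (mem_of_energy_bounded hw hC hu hlim).2 _ (isBoundedFunctional_energy hv)

/-- Lower semicontinuity of the energy: test the weak convergence with the limit itself, so that
Cauchy–Schwarz gives `E(u,u)² ≤ C E(u,u)`. -/
theorem energy_le_of_bounded {w : ℕ → X → ℝ} (hw : ∀ n, D.Mem (w n)) {C : ℝ}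
    (hC : ∀ n, D.energy (w n) (w n) ≤ C) (hu : MemLp u 2 m)
    (hlim : Tendsto (fun n => eLpNorm (w n - u) 2 m) atTop (𝓝 0)) : D.energy u u ≤ C := by
  have hmem := (mem_of_energy_bounded hw hC hu hlim).1
  have ht := tendsto_energy_of_bounded hw hC hu hlim hmem
  have hu0 := energy_self_nonneg (D := D) u
  have h2 : D.energy u u ^ 2 ≤ C * D.energy u u := by
    refine le_of_tendsto (ht.pow 2) (Eventually.of_forall fun n => ?_)
    exact (energy_sq_le (hw n) hmem).trans (by gcongr; exact hC n)
  rcases hu0.eq_or_lt with h0 | h0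
  · rw [← h0]; exact (energy_self_nonneg _).trans (hC 0)
  · nlinarith

end Functionals

/-! ### Existence of the resolvents. -/

section Resolvent

variable {X : Type*} [MeasurableSpace X] {m : Measure X} (D : DirichletForm m) {u v w : X → ℝ}

/-- The Dirichlet form multiplied by a positive constant. -/
noncomputable def scale (c : ℝ) (hc : 0 < c) : DirichletForm m where
  domain := D.domain
  form := c • D.form
  dense := D.dense
  symm u v := by simp [D.symm u v]
  nonneg u := by simpa using mul_nonneg hc.le (D.nonneg u)
  closed u hu := by
    -- `E + ‖·‖²` and `cE + ‖·‖²` are equivalent, with constants `min c 1` and `max c 1`.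
    have hmin : 0 < min c 1 := by positivity
    obtain ⟨v, hv⟩ := D.closed u (fun ε hε => by
      obtain ⟨N, hN⟩ := hu (min c 1 * ε) (by positivity)
      refine ⟨N, fun k hk l hl => ?_⟩
      have h := hN k hk l hl
      simp only [LinearMap.smul_apply, smul_eq_mul] at h
      have h1 := D.nonneg (u k - u l)
      refine lt_of_mul_lt_mul_left (lt_of_le_of_lt ?_ h) hmin.le
      rw [mul_add]
      refine add_le_add (by gcongr; exact min_le_left _ _) ?_
      exact mul_le_of_le_one_left (by positivity) (min_le_right _ _))
    refine ⟨v, ?_⟩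
    have h0 := hv.const_mul (max c 1)
    rw [mul_zero] at h0
    refine squeeze_zero (fun k => ?_) (fun k => ?_) h0
    · have := D.nonneg (u k - v)
      simp only [LinearMap.smul_apply, smul_eq_mul]
      positivity
    · have := D.nonneg (u k - v)
      simp only [LinearMap.smul_apply, smul_eq_mul]
      rw [mul_add]
      refine add_le_add (by gcongr; exact le_max_left _ _) ?_
      exact le_mul_of_one_le_left (by positivity) (le_max_right _ _)
  markov u v h := by
    obtain ⟨hv, hle⟩ := D.markov u v h
    refine ⟨hv, ?_⟩
    simp only [LinearMap.smul_apply, smul_eq_mul]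
    gcongr

/-- The function `αG_α u`, characterized by its weak equation. -/
theorem exists_resolvent {α : ℝ} (hα : 0 < α) (hu : MemLp u 2 m) :
    ∃ w, D.Mem w ∧ ∀ v, D.Mem v → D.energy w v = α * ∫ x, (u x - w x) * v x ∂m := by
  -- `αG_α u` solves `α⁻¹E(w, v) + (w, v) = (u, v)`, so it is the 1-resolvent of the form `α⁻¹E`.
  obtain ⟨w, hw⟩ := (D.scale α⁻¹ (by positivity)).exists_resolvent_one (hu.toLp u)
  let w' : D.Dom := w
  refine ⟨D.incl w', mem_iff.2 ⟨w', .rfl⟩, fun v hv => ?_⟩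
  obtain ⟨b, hb⟩ := mem_iff.1 hv
  have h := hw b
  have h1 : (D.scale α⁻¹ (by positivity)).domForm w b = α⁻¹ * D.domForm w' b := rfl
  have h2 : (D.scale α⁻¹ (by positivity)).incl w = D.incl w' := rfl
  have h3 : (D.scale α⁻¹ (by positivity)).incl b = D.incl b := rfl
  rw [h1, h2, h3] at h
  rw [energy_eq .rfl hb]
  have h4 : ∫ x, (u x - D.incl w' x) * v x ∂m = inner ℝ (hu.toLp u - D.incl w') (D.incl b) := by
    rw [L2.inner_def]
    refine integral_congr_ae ?_
    filter_upwards [hu.coeFn_toLp, hb, Lp.coeFn_sub (hu.toLp u) (D.incl w')] with x h1 h2 h3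
    rw [h3, Pi.sub_apply, h1, h2]
    simp [mul_comm]
  rw [h4, inner_sub_left, ← h]
  field_simp
  ring

end Resolvent

end DirichletForm

theorem eLpNorm_two_eq_ofReal_sqrt {X : Type*} [MeasurableSpace X] {m : Measure X} {f : X → ℝ}
    (hf : MemLp f 2 m) : eLpNorm f 2 m = ENNReal.ofReal (√(∫ x, f x ^ 2 ∂m)) := by
  rw [hf.eLpNorm_eq_integral_rpow_norm (by norm_num) (by norm_num)]
  norm_num [Real.sqrt_eq_rpow]

theorem tendsto_eLpNorm_two_iff {X ι : Type*} [MeasurableSpace X] {m : Measure X}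
    {f : ι → X → ℝ} {l : Filter ι} (hf : ∀ n, MemLp (f n) 2 m) :
    Tendsto (fun n => eLpNorm (f n) 2 m) l (𝓝 0) ↔
      Tendsto (fun n => ∫ x, f n x ^ 2 ∂m) l (𝓝 0) := by
  have h0 : ∀ n, 0 ≤ ∫ x, f n x ^ 2 ∂m := fun n => integral_nonneg fun x => sq_nonneg _
  constructor
  · intro h
    have h1 := (ENNReal.tendsto_toReal ENNReal.zero_ne_top).comp h
    have h2 := h1.pow 2
    simp only [ENNReal.toReal_zero, ne_eq, OfNat.ofNat_ne_zero, not_false_eq_true, zero_pow] at h2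
    refine h2.congr fun n => ?_
    rw [Function.comp_apply, eLpNorm_two_eq_ofReal_sqrt (hf n),
      ENNReal.toReal_ofReal (Real.sqrt_nonneg _), Real.sq_sqrt (h0 n)]
  · intro h
    have h1 := ENNReal.tendsto_ofReal h.sqrt
    rw [Real.sqrt_zero, ENNReal.ofReal_zero] at h1
    exact h1.congr fun n => (eLpNorm_two_eq_ofReal_sqrt (hf n)).symm

namespace DirichletForm

/-! ### Contractions and truncations. -/

section Contractions

variable {X : Type*} [MeasurableSpace X] {m : Measure X} {D : DirichletForm m}
  {u v w f : X → ℝ}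

/-- The unit contraction, rescaled. -/
theorem Mem.clamp (hu : D.Mem u) {t : ℝ} (ht : 0 < t) :
    D.Mem (fun x => min (max 0 (u x)) t) ∧
      D.energy (fun x => min (max 0 (u x)) t) (fun x => min (max 0 (u x)) t) ≤ D.energy u u := by
  obtain ⟨a, ha⟩ := mem_iff.1 (hu.smul t⁻¹)
  have hmeas : AEStronglyMeasurable (fun x => min (max 0 ((D.incl a : X → ℝ) x)) 1) m := by
    have := (Lp.memLp (D.incl a)).1
    exact (aestronglyMeasurable_const.sup this).inf aestronglyMeasurable_const
  have hL : MemLp (fun x => min (max 0 ((D.incl a : X → ℝ) x)) 1) 2 m := by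
    refine (Lp.memLp (D.incl a)).mono hmeas (ae_of_all _ fun x => ?_)
    rw [Real.norm_eq_abs, Real.norm_eq_abs, abs_of_nonneg (by positivity)]
    exact (min_le_left _ _).trans (max_le (abs_nonneg _) (le_abs_self _))
  obtain ⟨hb, hle⟩ := D.markov a (hL.toLp _) hL.coeFn_toLp
  let b : D.Dom := ⟨_, hb⟩
  have hbe : (D.incl b : X → ℝ) =ᵐ[m] fun x => min (max 0 ((D.incl a : X → ℝ) x)) 1 :=
    hL.coeFn_toLp
  have hle' : D.domForm b b ≤ D.domForm a a := hle
  have htb : (D.incl (t • b) : X → ℝ) =ᵐ[m] fun x => min (max 0 (u x)) t := by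
    refine (incl_smul_ae t .rfl).trans ?_
    filter_upwards [hbe, ha] with x h1 h2
    rw [Pi.smul_apply, h1, h2, Pi.smul_apply, smul_eq_mul, smul_eq_mul, mul_min_of_nonneg _ _ ht.le,
      mul_max_of_nonneg _ _ ht.le, mul_zero, mul_one, mul_inv_cancel_left₀ ht.ne']
  refine ⟨mem_iff.2 ⟨_, htb⟩, ?_⟩
  have hu2 := energy_smul_self t⁻¹ hu
  rw [energy_eq ha ha] at hu2
  have h4 : D.domForm (t • b) (t • b) = t * (t * D.domForm b b) := by
    simp only [map_smul, LinearMap.smul_apply, smul_eq_mul]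
  rw [energy_eq htb htb, h4]
  have h3 : t ^ 2 * (t⁻¹ ^ 2 * D.energy u u) = D.energy u u := by field_simp
  rw [← h3, ← hu2]
  nlinarith [sq_nonneg t]

/-- First variation: in `E(p + εq) = E(p) + 2εE(p,q) + ε²E(q)` a negative linear term would win for
small `ε`. -/
theorem energy_nonneg_of_perturbation {p q : X → ℝ} (hp : D.Mem p) (hq : D.Mem q)
    (h : ∀ ε : ℝ, 0 < ε → ε ≤ 1 → D.energy p p ≤ D.energy (p + ε • q) (p + ε • q)) :
    0 ≤ D.energy p q := by
  by_contra! hneg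
  have hq0 := energy_self_nonneg (D := D) q
  set e := min 1 (-D.energy p q / (D.energy q q + 1)) with he
  have he0 : 0 < e := lt_min one_pos (div_pos (by linarith) (by linarith))
  have h1 := h e he0 (min_le_left _ _)
  rw [energy_add_self hp (hq.smul e), energy_smul_right e hq hp, energy_smul_self e hq] at h1
  have h2 : e * (D.energy q q + 1) ≤ -D.energy p q :=
    (le_div_iff₀ (by linarith)).1 (min_le_right _ _)
  nlinarith [mul_pos he0 he0]

/-- Clamping `p - εq` to `[0, M]` returns `p`, so the first variation of the energy at `p` in
direction `-q` is non-negative. -/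
theorem energy_nonpos_of_disjoint {p q : X → ℝ} (hp : D.Mem p) (hq : D.Mem q) {M : ℝ} (hM : 0 < M)
    (h : ∀ᵐ x ∂m, 0 ≤ p x ∧ p x ≤ M ∧ 0 ≤ q x ∧ p x * q x = 0) : D.energy p q ≤ 0 := by
  have h1 : 0 ≤ D.energy p (-q) := by
    refine energy_nonneg_of_perturbation hp hq.neg fun ε hε _ => ?_
    have h2 := ((hp.add (hq.neg.smul ε)).clamp hM).2
    rwa [energy_congr (u' := p) (v' := p)] at h2
    all_goals
      filter_upwards [h] with x ⟨h1, h2, h3, h4⟩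
      simp only [Pi.add_apply, Pi.smul_apply, Pi.neg_apply, smul_eq_mul]
      rcases mul_eq_zero.1 h4 with h5 | h5
      · rw [h5, max_eq_left (by nlinarith), min_eq_left hM.le]
      · rw [h5, max_eq_right (by linarith), min_eq_left (by linarith)]; ring
  rw [← neg_one_smul ℝ q, energy_smul_right _ hq hp] at h1
  linarith

theorem Mem.min_const (hu : D.Mem u) (h0 : ∀ᵐ x ∂m, 0 ≤ u x) {t : ℝ} (ht : 0 < t) :
    D.Mem (fun x => min (u x) t) := by
  refine (hu.clamp ht).1.congr ?_
  filter_upwards [h0] with x hx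
  rw [max_eq_right hx]

/-- Moving from `u ∧ t` towards `u` and clamping at `t` leads back to `u ∧ t`, so the first
variation applies. -/
theorem energy_min_sub_min_nonneg (hu : D.Mem u) (h0 : ∀ᵐ x ∂m, 0 ≤ u x) {t : ℝ} (ht : 0 < t) :
    0 ≤ D.energy (fun x => min (u x) t) (u - fun x => min (u x) t) := by
  have ha := hu.min_const h0 ht
  refine energy_nonneg_of_perturbation ha (hu.sub ha) fun ε hε hε1 => ?_
  have h2 := ((ha.add ((hu.sub ha).smul ε)).clamp ht).2
  rwa [energy_congr (u' := fun x => min (u x) t) (v' := fun x => min (u x) t)] at h2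
  all_goals
    filter_upwards [h0] with x hx
    simp only [Pi.add_apply, Pi.smul_apply, Pi.sub_apply, smul_eq_mul]
    rcases le_total (u x) t with h | h
    · simp [min_eq_left h, max_eq_right hx]
    · rw [min_eq_right h, min_eq_right]
      exact le_max_of_le_right (by nlinarith)

theorem MemBdd.exists_bound (hu : D.MemBdd u) : ∃ M : ℝ, 0 < M ∧ ∀ᵐ x ∂m, |u x| ≤ M := by
  have h := hu.2.2
  refine ⟨(eLpNorm u ⊤ m).toReal + 1, by positivity, ?_⟩
  filter_upwards [ae_le_eLpNormEssSup (f := u) (μ := m)] with x hx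
  rw [← eLpNorm_exponent_top] at hx
  have := ENNReal.toReal_mono h.ne hx
  rw [toReal_enorm, Real.norm_eq_abs] at this
  linarith

theorem Mem.memBdd (hu : D.Mem u) {M : ℝ} (h : ∀ᵐ x ∂m, |u x| ≤ M) : D.MemBdd u :=
  ⟨hu, memLp_top_of_bound hu.memLp.1 M h⟩

theorem MemBdd.congr (hu : D.MemBdd u) (h : u =ᵐ[m] v) : D.MemBdd v :=
  ⟨hu.1.congr h, (memLp_congr_ae h).1 hu.2⟩

theorem MemBdd.add (hu : D.MemBdd u) (hv : D.MemBdd v) : D.MemBdd (u + v) :=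
  ⟨hu.1.add hv.1, hu.2.add hv.2⟩

theorem MemBdd.sub (hu : D.MemBdd u) (hv : D.MemBdd v) : D.MemBdd (u - v) :=
  ⟨hu.1.sub hv.1, hu.2.sub hv.2⟩

theorem MemBdd.smul (c : ℝ) (hu : D.MemBdd u) : D.MemBdd (c • u) :=
  ⟨hu.1.smul c, hu.2.const_smul c⟩

theorem Mem.posPart (hu : D.Mem u) {M : ℝ} (hM : 0 < M) (h : ∀ᵐ x ∂m, |u x| ≤ M) :
    D.Mem (fun x => max 0 (u x)) ∧
      D.energy (fun x => max 0 (u x)) (fun x => max 0 (u x)) ≤ D.energy u u := by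
  have hc := hu.clamp hM
  have he : (fun x => min (max 0 (u x)) M) =ᵐ[m] fun x => max 0 (u x) := by
    filter_upwards [h] with x hx
    exact min_eq_left (max_le hM.le ((le_abs_self _).trans hx))
  rwa [energy_congr he he, mem_congr he] at hc

theorem Mem.negPart (hu : D.Mem u) {M : ℝ} (hM : 0 < M) (h : ∀ᵐ x ∂m, |u x| ≤ M) :
    D.Mem (fun x => max 0 (-u x)) ∧
      D.energy (fun x => max 0 (-u x)) (fun x => max 0 (-u x)) ≤ D.energy u u := by
  rw [← energy_neg_self hu]
  exact hu.neg.posPart hM (by simpa using h)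

/-- Truncation at the levels `±M` of a bounded function of the domain. -/
theorem MemBdd.truncate (hu : D.MemBdd u) {M : ℝ} (hM : 0 < M) :
    D.Mem (fun x => max (-M) (min (u x) M)) ∧
      D.energy (fun x => max (-M) (min (u x) M)) (fun x => max (-M) (min (u x) M))
        ≤ D.energy u u := by
  obtain ⟨B, hB, hbd⟩ := hu.exists_bound
  set p : X → ℝ := fun x => max 0 (u x)
  set q : X → ℝ := fun x => max 0 (-u x)
  have hp : D.Mem p := (hu.1.posPart hB hbd).1
  have hq : D.Mem q := (hu.1.negPart hB hbd).1
  have hp0 : ∀ᵐ x ∂m, 0 ≤ p x := ae_of_all _ fun x => le_max_left _ _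
  have hq0 : ∀ᵐ x ∂m, 0 ≤ q x := ae_of_all _ fun x => le_max_left _ _
  set a : X → ℝ := fun x => min (p x) M with ha_def
  set b : X → ℝ := fun x => min (q x) M with hb_def
  have ha : D.Mem a := hp.min_const hp0 hM
  have hb : D.Mem b := hq.min_const hq0 hM
  -- `u` is the truncation `a - b` plus the remainder `(p - a) - (q - b)`. The four signs below make
  -- the energy between these two non-negative, so dropping the remainder lowers the energy.
  have h1 : 0 ≤ D.energy a (p - a) := energy_min_sub_min_nonneg hp hp0 hM
  have h2 : 0 ≤ D.energy b (q - b) := energy_min_sub_min_nonneg hq hq0 hM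
  have h3 : D.energy a (q - b) ≤ 0 := by
    refine energy_nonpos_of_disjoint ha (hq.sub hb) hM (ae_of_all _ fun x => ?_)
    refine ⟨le_min (le_max_left _ _) hM.le, min_le_right _ _, sub_nonneg.2 (min_le_left _ _), ?_⟩
    simp only [Pi.sub_apply, ha_def, hb_def, p, q]
    rcases le_total 0 (u x) with h | h
    · simp [max_eq_left (neg_nonpos.2 h), hM.le]
    · simp [max_eq_left h, hM.le]
  have h4 : D.energy b (p - a) ≤ 0 := by
    refine energy_nonpos_of_disjoint hb (hp.sub ha) hM (ae_of_all _ fun x => ?_)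
    refine ⟨le_min (le_max_left _ _) hM.le, min_le_right _ _, sub_nonneg.2 (min_le_left _ _), ?_⟩
    simp only [Pi.sub_apply, ha_def, hb_def, p, q]
    rcases le_total 0 (u x) with h | h
    · simp [max_eq_left (neg_nonpos.2 h), hM.le]
    · simp [max_eq_left h, hM.le]
  have hT : (fun x => max (-M) (min (u x) M)) = a - b := by
    funext x
    simp only [Pi.sub_apply, ha_def, hb_def, p, q]
    rcases le_total 0 (u x) with h | h
    · rw [max_eq_left (neg_nonpos.2 h), max_eq_right h, min_eq_left hM.le, sub_zero,
        max_eq_right]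
      exact le_min (by linarith) (by linarith)
    · rw [max_eq_right (neg_nonneg.2 h), max_eq_left h, min_eq_left hM.le, zero_sub,
        min_eq_left (by linarith), ← max_neg_neg, neg_neg, max_comm]
  have hR : u = (a - b) + ((p - a) - (q - b)) := by
    funext x
    simp only [Pi.sub_apply, Pi.add_apply, p, q]
    rcases le_total 0 (u x) with h | h
    · rw [max_eq_left (neg_nonpos.2 h), max_eq_right h]; ring
    · rw [max_eq_right (neg_nonneg.2 h), max_eq_left h]; ring
  have hr : D.Mem ((p - a) - (q - b)) := (hp.sub ha).sub (hq.sub hb)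
  rw [hT]
  refine ⟨ha.sub hb, ?_⟩
  conv_rhs => rw [hR]
  rw [energy_add_self (ha.sub hb) hr, energy_sub_left ha hb hr,
    energy_sub_right (hp.sub ha) (hq.sub hb) ha, energy_sub_right (hp.sub ha) (hq.sub hb) hb]
  have := energy_self_nonneg (D := D) ((p - a) - (q - b))
  linarith

end Contractions

/-! ### Bounded functions of the domain form an algebra. -/

/-- The tent map. -/
noncomputable def tent (t : ℝ) : ℝ := 4 * min t (1 / 2) - 2 * t

theorem tent_of_le {t : ℝ} (h : t ≤ 1 / 2) : tent t = 2 * t := by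
  rw [tent, min_eq_left h]; ring

theorem tent_of_ge {t : ℝ} (h : 1 / 2 ≤ t) : tent t = 2 - 2 * t := by
  rw [tent, min_eq_right h]; ring

theorem tent_mem_Icc {t : ℝ} (h : t ∈ Icc (0 : ℝ) 1) : tent t ∈ Icc (0 : ℝ) 1 := by
  rcases le_total t (1 / 2) with h1 | h1
  · rw [tent_of_le h1]; constructor <;> linarith [h.1, h.2]
  · rw [tent_of_ge h1]; constructor <;> linarith [h.1, h.2]

theorem iterate_tent_mem_Icc {t : ℝ} (h : t ∈ Icc (0 : ℝ) 1) (n : ℕ) :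
    tent^[n] t ∈ Icc (0 : ℝ) 1 := by
  induction n with
  | zero => exact h
  | succ n ih => rw [Function.iterate_succ_apply']; exact tent_mem_Icc ih

theorem tent_le (t : ℝ) : tent t ≤ 2 * t := by
  rw [tent]; linarith [min_le_left t (1 / 2)]

theorem iterate_tent_le (t : ℝ) (n : ℕ) : tent^[n] t ≤ 2 ^ n * t := by
  induction n with
  | zero => simp
  | succ n ih =>
    rw [Function.iterate_succ_apply', pow_succ]
    linarith [tent_le (tent^[n] t)]

/-- Iterated on `[0, 1]`, this gives `t² = t - ∑_{k ≥ 1} 4⁻ᵏ tent^[k] t`, which builds the square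
from contractions. -/
theorem sub_sq_eq_tent (t : ℝ) : t - t ^ 2 = tent t / 4 + (tent t - tent t ^ 2) / 4 := by
  rcases le_total t (1 / 2) with h1 | h1
  · rw [tent_of_le h1]; ring
  · rw [tent_of_ge h1]; ring

section Square

variable {X : Type*} [MeasurableSpace X] {m : Measure X} {D : DirichletForm m}
  {u v w f : X → ℝ}

/-- With `a = u ∧ 1/2` and `r = u - a`, the tent of `u` is `2(a - r)`; since `E(a, r) ≥ 0`, the
energy of `a - r` is at most that of `a + r = u`. -/
theorem Mem.tent (hu : D.Mem u) (h : ∀ᵐ x ∂m, u x ∈ Icc (0 : ℝ) 1) :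
    D.Mem (fun x => tent (u x)) ∧
      D.energy (fun x => DirichletForm.tent (u x)) (fun x => DirichletForm.tent (u x))
        ≤ 4 * D.energy u u := by
  have h0 : ∀ᵐ x ∂m, 0 ≤ u x := h.mono fun x hx => hx.1
  have h2 : (0 : ℝ) < 1 / 2 := by norm_num
  set a : X → ℝ := fun x => min (u x) (1 / 2)
  have ha : D.Mem a := hu.min_const h0 h2
  have hab := energy_min_sub_min_nonneg hu h0 h2
  have ht : (fun x => DirichletForm.tent (u x)) = (2 : ℝ) • (a - (u - a)) := by
    funext x
    simp only [DirichletForm.tent, Pi.smul_apply, Pi.sub_apply, smul_eq_mul, a]; ring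
  have hr := hu.sub ha
  rw [ht]
  refine ⟨(ha.sub hr).smul 2, ?_⟩
  have hua : u = a + (u - a) := by abel
  have h3 : D.energy u u = D.energy (a + (u - a)) (a + (u - a)) := by rw [← hua]
  rw [energy_smul_self 2 (ha.sub hr), h3, energy_add_self ha hr, energy_sub_self ha hr]
  change 0 ≤ D.energy a (u - a) at hab
  linarith

theorem Mem.iterate_tent (hu : D.Mem u) (h : ∀ᵐ x ∂m, u x ∈ Icc (0 : ℝ) 1) (n : ℕ) :
    D.Mem (fun x => DirichletForm.tent^[n] (u x)) ∧
      √(D.energy (fun x => DirichletForm.tent^[n] (u x)) (fun x => DirichletForm.tent^[n] (u x)))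
        ≤ 2 ^ n * √(D.energy u u) := by
  induction n with
  | zero => simpa using hu
  | succ n ih =>
    simp only [Function.iterate_succ_apply']
    have h1 := ih.1.tent (h.mono fun x hx => iterate_tent_mem_Icc hx n)
    refine ⟨h1.1, (Real.sqrt_le_sqrt h1.2).trans ?_⟩
    rw [Real.sqrt_mul (by norm_num), show (4 : ℝ) = 2 ^ 2 by norm_num,
      Real.sqrt_sq (by norm_num), pow_succ]
    linarith [ih.2]

/-- In the seminorm `√E` the `k`-th term of the tent series costs at most `4⁻ᵏ 2ᵏ √E(u)`, so all
partial sums stay below `2√E(u)`. They converge to `u²` in `L²`, and lower semicontinuity concludes.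
-/
theorem Mem.sq_of_mem_Icc (hu : D.Mem u) (h : ∀ᵐ x ∂m, u x ∈ Icc (0 : ℝ) 1) :
    D.Mem (u * u) ∧ D.energy (u * u) (u * u) ≤ 4 * D.energy u u := by
  let A : ℕ → X → ℝ := fun n => Nat.rec u
    (fun k f => f - ((1 / 4 : ℝ) ^ (k + 1)) • fun x => DirichletForm.tent^[k + 1] (u x)) n
  have hA0 : A 0 = u := rfl
  have hA1 : ∀ n, A (n + 1) = A n - ((1 / 4 : ℝ) ^ (n + 1)) •
    fun x => DirichletForm.tent^[n + 1] (u x) := fun n => rfl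
  have hrep : ∀ n x, A n x = u x * u x +
      (1 / 4) ^ n * (DirichletForm.tent^[n] (u x) - DirichletForm.tent^[n] (u x) ^ 2) := by
    intro n x
    induction n with
    | zero => rw [hA0]; simp; ring
    | succ n ih =>
      rw [hA1, Pi.sub_apply, ih, sub_sq_eq_tent, Pi.smul_apply, smul_eq_mul,
        Function.iterate_succ_apply']
      ring
  have hA : ∀ n, D.Mem (A n) ∧
      √(D.energy (A n) (A n)) ≤ (2 - (1 / 2) ^ n) * √(D.energy u u) := by
    intro n
    induction n with
    | zero => rw [hA0]; exact ⟨hu, by norm_num⟩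
    | succ n ih =>
      have h1 := hu.iterate_tent h (n + 1)
      have h2 := h1.1.smul (-(1 / 4 : ℝ) ^ (n + 1))
      rw [hA1, sub_eq_add_neg, ← neg_smul]
      refine ⟨ih.1.add h2, (sqrt_energy_add_le ih.1 h2).trans ?_⟩
      rw [energy_smul_self _ h1.1, Real.sqrt_mul (sq_nonneg _), Real.sqrt_sq_eq_abs, abs_neg,
        abs_of_nonneg (by positivity)]
      have h3 : (1 / 4 : ℝ) ^ (n + 1) * √(D.energy (fun x => DirichletForm.tent^[n + 1] (u x))
          (fun x => DirichletForm.tent^[n + 1] (u x)))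
          ≤ (1 / 4 : ℝ) ^ (n + 1) * (2 ^ (n + 1) * √(D.energy u u)) := by
        gcongr
        exact h1.2
      have h4 : (1 / 4 : ℝ) ^ (n + 1) * (2 ^ (n + 1) * √(D.energy u u))
          = (1 / 2 : ℝ) ^ (n + 1) * √(D.energy u u) := by
        rw [← mul_assoc, ← mul_pow]; norm_num
      have h5 : (1 / 2 : ℝ) ^ n = 2 * (1 / 2) ^ (n + 1) := by rw [pow_succ]; ring
      have h6 := ih.2
      rw [h5] at h6
      linarith
  have hE : ∀ n, D.energy (A n) (A n) ≤ 4 * D.energy u u := by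
    intro n
    have h1 : √(D.energy (A n) (A n)) ≤ 2 * √(D.energy u u) := by
      refine (hA n).2.trans ?_
      gcongr
      have : (0 : ℝ) ≤ (1 / 2) ^ n := by positivity
      linarith
    have h2 := pow_le_pow_left₀ (Real.sqrt_nonneg _) h1 2
    rw [mul_pow, Real.sq_sqrt (energy_self_nonneg _), Real.sq_sqrt (energy_self_nonneg _)] at h2
    linarith
  have hu2 : MemLp (u * u) 2 m := by
    refine hu.memLp.mono (hu.memLp.1.mul hu.memLp.1) ?_
    filter_upwards [h] with x hx
    rw [Real.norm_eq_abs, Real.norm_eq_abs, Pi.mul_apply, abs_mul]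
    exact mul_le_of_le_one_left (abs_nonneg _) (abs_le.2 ⟨by linarith [hx.1], hx.2⟩)
  have hlim : Tendsto (fun n => eLpNorm (A n - u * u) 2 m) atTop (𝓝 0) := by
    have h1 : ∀ n, eLpNorm (A n - u * u) 2 m ≤ ENNReal.ofReal ((1 / 2) ^ n) * eLpNorm u 2 m := by
      intro n
      refine eLpNorm_le_mul_eLpNorm_of_ae_le_mul ?_ 2
      filter_upwards [h] with x hx
      have h2 := iterate_tent_mem_Icc hx n
      have h3 := iterate_tent_le (u x) n
      rw [Pi.sub_apply, hrep, Pi.mul_apply, add_sub_cancel_left, Real.norm_eq_abs,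
        Real.norm_eq_abs, abs_of_nonneg hx.1, abs_of_nonneg]
      · calc _ ≤ (1 / 4 : ℝ) ^ n * (2 ^ n * u x) := by
              gcongr; nlinarith [sq_nonneg (DirichletForm.tent^[n] (u x))]
          _ = _ := by rw [← mul_assoc, ← mul_pow]; norm_num
      · have : 0 ≤ DirichletForm.tent^[n] (u x) - DirichletForm.tent^[n] (u x) ^ 2 := by
          nlinarith [h2.1, h2.2]
        positivity
    have h2 : Tendsto (fun n : ℕ => ENNReal.ofReal ((1 / 2) ^ n) * eLpNorm u 2 m) atTop (𝓝 0) := by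
      have h3 : Tendsto (fun n : ℕ => ENNReal.ofReal ((1 / 2 : ℝ) ^ n)) atTop (𝓝 0) := by
        rw [← ENNReal.ofReal_zero]
        exact ENNReal.tendsto_ofReal
          (tendsto_pow_atTop_nhds_zero_of_lt_one (by norm_num) (by norm_num))
      have h4 := ENNReal.Tendsto.mul_const h3 (Or.inr hu.memLp.2.ne)
      rwa [zero_mul] at h4
    exact tendsto_of_tendsto_of_tendsto_of_le_of_le tendsto_const_nhds h2 (fun _ => zero_le) h1
  exact ⟨(mem_of_energy_bounded (fun n => (hA n).1) hE hu2 hlim).1,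
    energy_le_of_bounded (fun n => (hA n).1) hE hu2 hlim⟩

theorem Mem.sq_of_abs_le_one (hu : D.Mem u) (h : ∀ᵐ x ∂m, |u x| ≤ 1) :
    D.Mem (u * u) ∧ D.energy (u * u) (u * u) ≤ 16 * D.energy u u := by
  have hp := hu.posPart one_pos h
  have hq := hu.negPart one_pos h
  have hp2 := hp.1.sq_of_mem_Icc (h.mono fun x hx =>
    ⟨le_max_left _ _, max_le zero_le_one (le_of_abs_le hx)⟩)
  have hq2 := hq.1.sq_of_mem_Icc (h.mono fun x hx =>
    ⟨le_max_left _ _, max_le zero_le_one (by linarith [neg_le_of_abs_le hx])⟩)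
  have he : u * u = (fun x => max 0 (u x)) * (fun x => max 0 (u x)) +
      (fun x => max 0 (-u x)) * (fun x => max 0 (-u x)) := by
    funext x
    simp only [Pi.mul_apply, Pi.add_apply]
    rcases le_total 0 (u x) with h | h
    · rw [max_eq_right h, max_eq_left (neg_nonpos.2 h)]; ring
    · rw [max_eq_left h, max_eq_right (neg_nonneg.2 h)]; ring
  rw [he]
  refine ⟨hp2.1.add hq2.1, (energy_add_self_le hp2.1 hq2.1).trans ?_⟩
  linarith [hp.2, hq.2, hp2.2, hq2.2]

/-- The bounded functions of the domain form an algebra. -/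
theorem Mem.mul (hu : D.Mem u) (hv : D.Mem v) {M : ℝ} (hM : 0 < M)
    (hub : ∀ᵐ x ∂m, |u x| ≤ M) (hvb : ∀ᵐ x ∂m, |v x| ≤ M) :
    D.Mem (u * v) ∧ D.energy (u * v) (u * v) ≤ 32 * M ^ 2 * (D.energy u u + D.energy v v) := by
  -- Polarization: `uv = M²(a² - b²)` with `a, b = (u ± v)/(2M)`, both bounded by 1.
  have hs := ((hu.add hv).smul (1 / (2 * M))).sq_of_abs_le_one (by
    filter_upwards [hub, hvb] with x h1 h2
    rw [Pi.smul_apply, Pi.add_apply, smul_eq_mul, abs_mul, abs_of_pos (by positivity),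
      one_div_mul_eq_div, div_le_one (by positivity)]
    exact (abs_add_le _ _).trans (by linarith))
  have hd := ((hu.sub hv).smul (1 / (2 * M))).sq_of_abs_le_one (by
    filter_upwards [hub, hvb] with x h1 h2
    rw [Pi.smul_apply, Pi.sub_apply, smul_eq_mul, abs_mul, abs_of_pos (by positivity),
      one_div_mul_eq_div, div_le_one (by positivity)]
    exact (abs_sub _ _).trans (by linarith))
  set a := (1 / (2 * M)) • (u + v)
  set b := (1 / (2 * M)) • (u - v)
  have he : u * v = (M ^ 2) • (a * a - b * b) := by
    funext x
    simp only [a, b, Pi.smul_apply, Pi.mul_apply, Pi.add_apply, Pi.sub_apply, smul_eq_mul]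
    field_simp
    ring
  rw [he]
  refine ⟨(hs.1.sub hd.1).smul _, ?_⟩
  rw [energy_smul_self _ (hs.1.sub hd.1)]
  have h1 := energy_sub_self_le hs.1 hd.1
  have h2 : D.energy a a + D.energy b b = (1 / (2 * M ^ 2)) * (D.energy u u + D.energy v v) := by
    simp only [a, b]
    rw [energy_smul_self _ (hu.add hv), energy_smul_self _ (hu.sub hv), energy_add_self hu hv,
      energy_sub_self hu hv]
    field_simp
    ring
  calc (M ^ 2) ^ 2 * D.energy (a * a - b * b) (a * a - b * b)
      ≤ (M ^ 2) ^ 2 * (32 * (D.energy a a + D.energy b b)) := by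
        gcongr
        linarith [hs.2, hd.2]
    _ = 16 * M ^ 2 * (D.energy u u + D.energy v v) := by rw [h2]; field_simp; ring
    _ ≤ _ := by
        have := energy_self_nonneg (D := D) u
        have := energy_self_nonneg (D := D) v
        gcongr
        norm_num

theorem MemBdd.mul (hu : D.MemBdd u) (hv : D.MemBdd v) : D.MemBdd (u * v) := by
  obtain ⟨A, hA, hA'⟩ := hu.exists_bound
  obtain ⟨B, hB, hB'⟩ := hv.exists_bound
  refine ⟨(hu.1.mul hv.1 (M := max A B) (by positivity) (hA'.mono fun x hx => hx.trans (le_max_left _ _))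
    (hB'.mono fun x hx => hx.trans (le_max_right _ _))).1, ?_⟩
  have : MemLp (u * v) ⊤ m := hv.2.mul hu.2
  exact this

theorem MemBdd.iterate_tent (hu : D.MemBdd u) (h : ∀ᵐ x ∂m, u x ∈ Icc (0 : ℝ) 1) (n : ℕ) :
    D.MemBdd (fun x => DirichletForm.tent^[n] (u x)) :=
  (hu.1.iterate_tent h n).1.memBdd (M := 1) (h.mono fun x hx => by
    have := iterate_tent_mem_Icc hx n
    exact abs_le.2 ⟨by linarith [this.1], this.2⟩)

end Square

end DirichletForm

namespace DirichletForm

/-! ### Sub-Markovian resolvents and positivity of the full energy measure. -/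

section Resolvent

variable {X : Type*} [MeasurableSpace X] {m : Measure X} {D : DirichletForm m} {α : ℝ}
  {u v w f u' w' : X → ℝ}

variable (D) in
/-- `w = αG_α u`. -/
structure IsResolvent (α : ℝ) (u w : X → ℝ) : Prop where
  memLp : MemLp u 2 m
  mem : D.Mem w
  eq : ∀ v, D.Mem v → D.energy w v = α * ∫ x, (u x - w x) * v x ∂m

theorem exists_isResolvent (hα : 0 < α) (hu : MemLp u 2 m) : ∃ w, D.IsResolvent α u w := by
  obtain ⟨w, hw, h⟩ := D.exists_resolvent hα hu
  exact ⟨w, hu, hw, h⟩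

theorem IsResolvent.add (h : D.IsResolvent α u w) (h' : D.IsResolvent α u' w') :
    D.IsResolvent α (u + u') (w + w') where
  memLp := h.memLp.add h'.memLp
  mem := h.mem.add h'.mem
  eq v hv := by
    rw [energy_add_left h.mem h'.mem hv, h.eq v hv, h'.eq v hv, ← mul_add, ← integral_add]
    · congr 2; funext x; simp only [Pi.add_apply]; ring
    · exact (h.memLp.sub h.mem.memLp).integrable_mul hv.memLp
    · exact (h'.memLp.sub h'.mem.memLp).integrable_mul hv.memLp

theorem IsResolvent.smul (c : ℝ) (h : D.IsResolvent α u w) :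
    D.IsResolvent α (c • u) (c • w) where
  memLp := h.memLp.const_smul c
  mem := h.mem.smul c
  eq v hv := by
    rw [energy_smul_left c h.mem hv, h.eq v hv, mul_left_comm, ← integral_const_mul]
    congr 2; funext x; simp only [Pi.smul_apply, smul_eq_mul]; ring

/-- The resolvent is sub-Markovian. -/
theorem IsResolvent.mem_Icc (hα : 0 < α) (h : D.IsResolvent α u w) {K : ℝ} (hK : 0 < K)
    (hu : ∀ᵐ x ∂m, u x ∈ Icc 0 K) : ∀ᵐ x ∂m, w x ∈ Icc 0 K := by
  obtain ⟨hT, hTle⟩ := h.mem.clamp hK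
  set T : X → ℝ := fun x => min (max 0 (w x)) K with hTdef
  have hd := hT.sub h.mem
  have hTe : T = w + (T - w) := by abel
  -- `E(T) ≤ E(w)` and the resolvent equation give `∫ (u - w)(T - w) ≤ 0`. As `T` projects `w` onto
  -- an interval containing `u`, the integrand dominates `(T - w)²`, so `T = w`.
  rw [hTe, energy_add_self h.mem hd, h.eq _ hd] at hTle
  have hd0 := energy_self_nonneg (D := D) (T - w)
  have hle : ∫ x, (u x - w x) * (T - w) x ∂m ≤ 0 := by
    by_contra! hpos
    nlinarith [mul_pos hα hpos]
  have hsq : ∫ x, (T - w) x ^ 2 ∂m ≤ ∫ x, (u x - w x) * (T - w) x ∂m := by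
    refine integral_mono_ae hd.memLp.integrable_sq
      ((h.memLp.sub h.mem.memLp).integrable_mul hd.memLp) ?_
    filter_upwards [hu] with x hx
    simp only [Pi.sub_apply, hTdef]
    rcases le_total 0 (w x) with h1 | h1
    · rw [max_eq_right h1]
      rcases le_total (w x) K with h2 | h2
      · rw [min_eq_left h2]; simp
      · rw [min_eq_right h2]; nlinarith [hx.2]
    · rw [max_eq_left h1, min_eq_left hK.le]; nlinarith [hx.1]
  have h0 : ∫ x, (T - w) x ^ 2 ∂m = 0 :=
    le_antisymm (hsq.trans hle) (integral_nonneg fun x => sq_nonneg _)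
  rw [integral_eq_zero_iff_of_nonneg (fun x => sq_nonneg _) hd.memLp.integrable_sq] at h0
  filter_upwards [h0] with x hx
  have hx' : T x = w x := by
    have : (T - w) x ^ 2 = 0 := hx
    rw [sq_eq_zero_iff] at this
    simpa [sub_eq_zero] using this
  rw [← hx']
  exact ⟨le_min (le_max_left _ _) hK.le, min_le_right _ _⟩

theorem IsResolvent.unique (hα : 0 < α) (h : D.IsResolvent α u w) (h' : D.IsResolvent α u w') :
    w =ᵐ[m] w' := by
  have h1 := h.add (h'.smul (-1))
  have h2 : ∀ᵐ x ∂m, (u + (-1 : ℝ) • u) x = 0 := ae_of_all _ fun x => by simp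
  -- The difference is a resolvent of 0, which lies in `[0, K]` for every `K > 0`.
  have h3 : ∀ n : ℕ, ∀ᵐ x ∂m, (w + (-1 : ℝ) • w') x ∈ Icc (0 : ℝ) (1 / ((n : ℝ) + 1)) := fun n =>
    h1.mem_Icc hα (by positivity) (h2.mono fun x hx => by rw [hx]; constructor <;> positivity)
  filter_upwards [ae_all_iff.2 h3] with x hx
  have h4 : (w + (-1 : ℝ) • w') x ≤ 0 :=
    ge_of_tendsto tendsto_one_div_add_atTop_nhds_zero_nat (Eventually.of_forall fun n => (hx n).2)
  have h5 := le_antisymm h4 (hx 0).1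
  simp only [Pi.add_apply, Pi.smul_apply, smul_eq_mul] at h5
  linarith

/-- An upper bound for a bounded function passes to its resolvent. -/
theorem IsResolvent.le_of_le (hα : 0 < α) (h : D.IsResolvent α u w) {K B : ℝ} (hK : 0 < K)
    (hB : 0 < B) (hu : ∀ᵐ x ∂m, u x ≤ K) (hb : ∀ᵐ x ∂m, -B ≤ u x) : ∀ᵐ x ∂m, w x ≤ K := by
  have hp : MemLp (fun x => max 0 (u x)) 2 m := h.memLp.pos_part.congr_norm
    (aestronglyMeasurable_const.sup h.memLp.1) (ae_of_all _ fun x => by rw [max_comm])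
  have hq : MemLp (fun x => max 0 (-u x)) 2 m := h.memLp.neg.pos_part.congr_norm
    (aestronglyMeasurable_const.sup h.memLp.1.neg)
    (ae_of_all _ fun x => by rw [max_comm]; rfl)
  -- By linearity `w = p - q`, the resolvents of `u⁺` and `u⁻`, where `p ≤ K` and `q ≥ 0`.
  obtain ⟨p, hp'⟩ := exists_isResolvent (D := D) hα hp
  obtain ⟨q, hq'⟩ := exists_isResolvent (D := D) hα hq
  have h1 := hp'.mem_Icc hα hK (hu.mono fun x hx => ⟨le_max_left _ _, max_le hK.le hx⟩)
  have h2 := hq'.mem_Icc hα hB (hb.mono fun x hx => ⟨le_max_left _ _, max_le hB.le (by linarith)⟩)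
  have h3 := hp'.add (hq'.smul (-1))
  have he : (fun x => max 0 (u x)) + (-1 : ℝ) • (fun x => max 0 (-u x)) = u := by
    funext x
    simp only [Pi.add_apply, Pi.smul_apply, smul_eq_mul]
    rcases le_total 0 (u x) with h | h
    · rw [max_eq_right h, max_eq_left (neg_nonpos.2 h)]; ring
    · rw [max_eq_left h, max_eq_right (neg_nonneg.2 h)]; ring
  rw [he] at h3
  filter_upwards [h1, h2, h.unique hα h3] with x hx1 hx2 hx3
  rw [hx3]
  simp only [Pi.add_apply, Pi.smul_apply, smul_eq_mul]
  linarith [hx1.2, hx2.1]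

/-- Tested with `w - u`, the resolvent equation reads `E(w,w) + α‖w - u‖² = E(w,u)`; the rest is
Cauchy–Schwarz. -/
theorem IsResolvent.energy_le (hα : 0 < α) (h : D.IsResolvent α u w) (hu : D.Mem u) :
    D.energy w w ≤ D.energy u u ∧ ∫ x, (w - u) x ^ 2 ∂m ≤ α⁻¹ * D.energy u u := by
  have h1 := h.eq _ (h.mem.sub hu)
  have h2 : ∫ x, (u x - w x) * (w - u) x ∂m = -∫ x, (w - u) x ^ 2 ∂m := by
    rw [← integral_neg]
    congr 1; funext x; simp only [Pi.sub_apply]; ring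
  rw [h2, energy_sub_right h.mem hu h.mem] at h1
  have h3 : 0 ≤ ∫ x, (w - u) x ^ 2 ∂m := integral_nonneg fun x => sq_nonneg _
  have h4 := energy_sq_le h.mem hu
  have h5 := energy_self_nonneg (D := D) w
  have h6 := energy_self_nonneg (D := D) u
  have h7 : D.energy w w ≤ D.energy w u := by nlinarith [mul_nonneg hα.le h3]
  have h8 : D.energy w w ≤ D.energy u u := by
    rcases h5.eq_or_lt with h0 | h0
    · rw [← h0]; exact h6
    · have : D.energy w w ^ 2 ≤ D.energy w w * D.energy u u :=
        (pow_le_pow_left₀ h5 h7 2).trans h4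
      nlinarith
  have h9 : D.energy w u ≤ D.energy u u := by
    refine le_of_sq_le_sq (h4.trans ?_) h6
    nlinarith
  refine ⟨h8, ?_⟩
  rw [inv_mul_eq_div, le_div_iff₀ hα]
  linarith

/-- Positivity of the energy measure of the whole form. -/
theorem energy_measure_nonneg (hu : D.MemBdd u) (hf : D.MemBdd f) (hf0 : ∀ᵐ x ∂m, 0 ≤ f x) :
    0 ≤ 2 * D.energy (u * f) u - D.energy (u * u) f := by
  obtain ⟨M, hM, hMu⟩ := hu.exists_bound
  have huu := hu.mul hu
  have huf := hu.mul hf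
  choose w hw using fun n : ℕ =>
    exists_isResolvent (D := D) (α := (n : ℝ) + 1) (by positivity) hu.1.memLp
  choose z hz using fun n : ℕ =>
    exists_isResolvent (D := D) (α := (n : ℝ) + 1) (by positivity) huu.1.memLp
  have hlim : ∀ {v : X → ℝ} {y : ℕ → X → ℝ}, D.Mem v →
      (∀ n : ℕ, D.IsResolvent ((n : ℝ) + 1) v (y n)) → ∀ {g}, D.Mem g →
      Tendsto (fun n => D.energy (y n) g) atTop (𝓝 (D.energy v g)) := by
    intro v y hv hy g hg
    have hle := fun n : ℕ => (hy n).energy_le (by positivity) hv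
    refine tendsto_energy_of_bounded (fun n => (hy n).mem) (fun n => (hle n).1) hv.memLp ?_ hg
    rw [tendsto_eLpNorm_two_iff fun n => ((hy n).mem.sub hv).memLp]
    refine squeeze_zero (fun n => integral_nonneg fun x => sq_nonneg _) (fun n => (hle n).2) ?_
    have := tendsto_one_div_add_atTop_nhds_zero_nat (𝕜 := ℝ)
    simpa using this.mul_const (D.energy v v)
  have hl := ((hlim hu.1 hw huf.1).const_mul 2).sub (hlim huu.1 hz hf.1)
  rw [energy_comm (u * f) u]
  refine ge_of_tendsto' hl fun n => ?_
  have hα : (0 : ℝ) < (n : ℝ) + 1 := by positivity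
  rw [(hw n).eq _ huf.1, (hz n).eq _ hf.1]
  -- After approximation by resolvents `w` of `u` and `z` of `u²`, the expression is `α∫ f (u² - 2uw
  -- + z)`. Its integrand is formally `αG_α((u - c)²)` at `c = u(x)`, up to a favourable error.
  -- Since constants need not be in `L²`, the bound `2cu - u² ≤ c²` is passed to the resolvent
  -- instead. Rational `c` share one null set, and continuity reaches `c = u(x)`.
  have hq : ∀ᵐ x ∂m, ∀ c : ℚ, 2 * c * w n x - z n x ≤ c ^ 2 := by
    refine ae_all_iff.2 fun c => ?_
    have h1 := ((hw n).smul (2 * (c : ℝ))).add ((hz n).smul (-1))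
    -- The slack `1/(k + 1)` keeps the upper bound strictly positive when `c = 0`.
    have h2 : ∀ k : ℕ, ∀ᵐ x ∂m,
        ((2 * (c : ℝ)) • w n + (-1 : ℝ) • z n) x ≤ c ^ 2 + 1 / ((k : ℝ) + 1) := by
      intro k
      refine h1.le_of_le hα (by positivity) (B := 2 * |(c : ℝ)| * M + M ^ 2) (by positivity) ?_ ?_
      · refine ae_of_all _ fun x => ?_
        simp only [Pi.add_apply, Pi.smul_apply, smul_eq_mul, Pi.mul_apply]
        have : 0 < 1 / ((k : ℝ) + 1) := by positivity
        nlinarith [sq_nonneg (u x - c)]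
      · filter_upwards [hMu] with x hx
        simp only [Pi.add_apply, Pi.smul_apply, smul_eq_mul, Pi.mul_apply]
        have h3 : u x * u x ≤ M ^ 2 := by
          rw [← pow_two, ← sq_abs]; gcongr
        have h4 : |(c : ℝ) * u x| ≤ |(c : ℝ)| * M := by rw [abs_mul]; gcongr
        have h5 := neg_abs_le ((c : ℝ) * u x)
        linarith
    filter_upwards [ae_all_iff.2 h2] with x hx
    have h3 : Tendsto (fun k : ℕ => (c : ℝ) ^ 2 + 1 / ((k : ℝ) + 1)) atTop (𝓝 ((c : ℝ) ^ 2 + 0)) :=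
      tendsto_const_nhds.add tendsto_one_div_add_atTop_nhds_zero_nat
    rw [add_zero] at h3
    have h4 := ge_of_tendsto' h3 hx
    simp only [Pi.add_apply, Pi.smul_apply, smul_eq_mul] at h4
    linarith
  have hI1 : Integrable (fun x => (u x - w n x) * (u * f) x) m :=
    (hu.1.memLp.sub (hw n).mem.memLp).integrable_mul huf.1.memLp
  have hI2 : Integrable (fun x => ((u * u) x - z n x) * f x) m :=
    (huu.1.memLp.sub (hz n).mem.memLp).integrable_mul hf.1.memLp
  have hkey : 0 ≤ ∫ x, (2 * ((u x - w n x) * (u * f) x) - ((u * u) x - z n x) * f x) ∂m := by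
    refine integral_nonneg_of_ae ?_
    filter_upwards [hq, hf0] with x hx hfx
    have hcl : ∀ r : ℝ, 2 * r * w n x - z n x ≤ r ^ 2 := by
      have hclosed : IsClosed {r : ℝ | 2 * r * w n x - z n x ≤ r ^ 2} :=
        isClosed_le (by fun_prop) (by fun_prop)
      intro r
      have hsub : range ((↑) : ℚ → ℝ) ⊆ {r : ℝ | 2 * r * w n x - z n x ≤ r ^ 2} := by
        rintro _ ⟨c, rfl⟩
        exact hx c
      exact hclosed.closure_subset_iff.2 hsub (by rw [Rat.denseRange_cast.closure_range]; trivial)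
    have h1 := hcl (u x)
    simp only [Pi.mul_apply, Pi.zero_apply]
    nlinarith
  rw [integral_sub (hI1.const_mul 2) hI2, integral_const_mul] at hkey
  nlinarith

end Resolvent

end DirichletForm

namespace DirichletForm

/-! ### Marginals, symmetry and Fubini for the jump measure. -/

section JumpMeasure

variable {X : Type*} [MeasurableSpace X] [MeasurableEq X] {m : Measure X} [SFinite m]
  {j : Kernel X X} [IsSFiniteKernel j]

theorem measurableSet_offDiagonal : MeasurableSet {p : X × X | p.1 ≠ p.2} :=
  (measurableSet_eq_fun measurable_fst measurable_snd).compl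

theorem quasiMeasurePreserving_fst_jumpMeasure :
    Measure.QuasiMeasurePreserving Prod.fst (jumpMeasure m j) m := by
  refine ⟨measurable_fst, Measure.AbsolutelyContinuous.mk fun N hN hN0 => ?_⟩
  rw [Measure.map_apply measurable_fst hN]
  refine le_antisymm ((Measure.restrict_apply_le _ _).trans ?_) zero_le
  rw [show Prod.fst ⁻¹' N = N ×ˢ (univ : Set X) by ext; simp,
    Measure.compProd_apply_prod hN MeasurableSet.univ, setLIntegral_measure_zero _ _ hN0]

theorem quasiMeasurePreserving_snd_jumpMeasure
    (hJ : (jumpMeasure m j).map Prod.swap = jumpMeasure m j) :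
    Measure.QuasiMeasurePreserving Prod.snd (jumpMeasure m j) m := by
  have h : Measure.QuasiMeasurePreserving Prod.swap (jumpMeasure m j) (jumpMeasure m j) :=
    ⟨measurable_swap, hJ.absolutelyContinuous⟩
  exact (quasiMeasurePreserving_fst_jumpMeasure (m := m) (j := j)).comp h

theorem integral_swap_jumpMeasure (hJ : (jumpMeasure m j).map Prod.swap = jumpMeasure m j)
    (F : X × X → ℝ) :
    ∫ p, F p.swap ∂(jumpMeasure m j) = ∫ p, F p ∂(jumpMeasure m j) :=
  (⟨measurable_swap, hJ⟩ : MeasurePreserving Prod.swap (jumpMeasure m j) (jumpMeasure m j)).integral_comp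
    MeasurableEquiv.prodComm.measurableEmbedding F

theorem integrable_swap_jumpMeasure (hJ : (jumpMeasure m j).map Prod.swap = jumpMeasure m j)
    {F : X × X → ℝ} (hF : Integrable F (jumpMeasure m j)) :
    Integrable (fun p => F p.swap) (jumpMeasure m j) :=
  (⟨measurable_swap, hJ⟩ : MeasurePreserving Prod.swap (jumpMeasure m j) (jumpMeasure m j)).integrable_comp_of_integrable
    hF

theorem fubini_jumpMeasure {F : X × X → ℝ} (hF : Integrable F (jumpMeasure m j)) :
    (∀ᵐ x ∂m, IntegrableOn (fun y => F (x, y)) {x}ᶜ (j x)) ∧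
    Integrable (fun x => ∫ y in {x}ᶜ, F (x, y) ∂(j x)) m ∧
    ∫ p, F p ∂(jumpMeasure m j) = ∫ x, ∫ y in {x}ᶜ, F (x, y) ∂(j x) ∂m := by
  have hF' := (integrable_indicator_iff measurableSet_offDiagonal).2 hF
  have hind : ∀ x y, {p : X × X | p.1 ≠ p.2}.indicator F (x, y)
      = ({x}ᶜ : Set X).indicator (fun y => F (x, y)) y := fun x y => by
    by_cases h : x = y
    · subst h; simp
    · have h' : y ≠ x := fun h2 => h h2.symm
      rw [indicator_of_mem (by exact h), indicator_of_mem (by exact h')]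
  have hms : ∀ x : X, MeasurableSet ({x}ᶜ : Set X) := fun x => (measurableSet_singleton x).compl
  refine ⟨?_, ?_, ?_⟩
  · filter_upwards [((Measure.integrable_compProd_iff hF'.1).1 hF').1] with x hx
    simp only [hind] at hx
    exact (integrable_indicator_iff (hms x)).1 hx
  · have h : Integrable (fun x => ∫ y, {p : X × X | p.1 ≠ p.2}.indicator F (x, y) ∂(j x)) m :=
      MeasureTheory.Integrable.integral_compProd hF'
    refine h.congr (ae_of_all _ fun x => ?_)
    simp only [hind, integral_indicator (hms _)]
  · have h := Measure.integral_compProd hF'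
    rw [integral_indicator measurableSet_offDiagonal] at h
    refine h.trans (integral_congr_ae (ae_of_all _ fun x => ?_))
    simp only [hind, integral_indicator (hms _)]

end JumpMeasure

/-- A regular Dirichlet form with a jump kernel and no killing part. -/
structure RegularWithJumps {X : Type*} [MetricSpace X] [MeasurableSpace X] {m : Measure X}
    (D : DirichletForm m) (j : Kernel X X) : Prop where
  regular : D.IsRegular
  jumps : D.HasJumpKernel j

/-- The difference `u(x) - u(y)` as a function on the product. -/
def diff {X : Type*} (u : X → ℝ) (p : X × X) : ℝ := u p.1 - u p.2

/-! ### The strongly local part on the whole domain. -/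

section LocalPart

variable {X : Type*} [MetricSpace X] [ProperSpace X] [MeasurableSpace X] [BorelSpace X]
  {m : Measure X} [IsFiniteMeasureOnCompacts m] {D : DirichletForm m}
  {j : Kernel X X} [IsSFiniteKernel j] {u v w u' v' : X → ℝ}

theorem exists_seq_core (hreg : D.IsRegular) (hu : D.Mem u) :
    ∃ f : ℕ → X → ℝ, (∀ n, D.MemCore (f n)) ∧
      Tendsto (fun n => D.energy (f n - u) (f n - u)) atTop (𝓝 0) ∧
      Tendsto (fun n => eLpNorm (f n - u) 2 m) atTop (𝓝 0) ∧
      ∀ᵐ x ∂m, Tendsto (fun n => f n x) atTop (𝓝 (u x)) := by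
  choose f hf hfe using fun n : ℕ => hreg.1 u hu (1 / ((n : ℝ) + 1)) (by positivity)
  have hnn : ∀ n, 0 ≤ ∫ x, (u x - f n x) ^ 2 ∂m := fun n => integral_nonneg fun x => sq_nonneg _
  have hee : ∀ n, D.energy (f n - u) (f n - u) = D.energy (u - f n) (u - f n) := fun n => by
    rw [← neg_sub, energy_neg_self (hu.sub (hf n).2.2)]
  have h1 : Tendsto (fun n => D.energy (f n - u) (f n - u)) atTop (𝓝 0) := by
    refine squeeze_zero (fun n => energy_self_nonneg _) (fun n => ?_)
      (tendsto_one_div_add_atTop_nhds_zero_nat (𝕜 := ℝ))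
    rw [hee]; linarith [hfe n, hnn n]
  have h2 : Tendsto (fun n => eLpNorm (f n - u) 2 m) atTop (𝓝 0) := by
    rw [tendsto_eLpNorm_two_iff fun n => ((hf n).2.2.sub hu).memLp]
    refine squeeze_zero (fun n => integral_nonneg fun x => sq_nonneg _) (fun n => ?_)
      (tendsto_one_div_add_atTop_nhds_zero_nat (𝕜 := ℝ))
    have h3 : ∫ x, (f n - u) x ^ 2 ∂m = ∫ x, (u x - f n x) ^ 2 ∂m := by
      congr 1; funext x; simp only [Pi.sub_apply]; ring
    rw [h3]; linarith [hfe n, energy_self_nonneg (D := D) (u - f n)]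
  have h3 := tendstoInMeasure_of_tendsto_eLpNorm (by norm_num)
    (fun n => (hf n).2.2.memLp.1) hu.memLp.1 h2
  obtain ⟨ns, hns, hae⟩ := h3.exists_seq_tendsto_ae
  exact ⟨fun n => f (ns n), fun n => hf _, h1.comp hns.tendsto_atTop, h2.comp hns.tendsto_atTop,
    hae⟩

theorem tendsto_energy_self {f : ℕ → X → ℝ} (hf : ∀ n, D.Mem (f n)) (hu : D.Mem u)
    (h : Tendsto (fun n => D.energy (f n - u) (f n - u)) atTop (𝓝 0)) :
    Tendsto (fun n => D.energy (f n) (f n)) atTop (𝓝 (D.energy u u)) := by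
  have h1 : Tendsto (fun n => D.energy (f n - u) u) atTop (𝓝 0) := by
    refine squeeze_zero_norm (a := fun n => √(D.energy (f n - u) (f n - u) * D.energy u u))
      (fun n => ?_) ?_
    · rw [Real.norm_eq_abs]
      exact Real.abs_le_sqrt (energy_sq_le ((hf n).sub hu) hu)
    · have := (h.mul_const (D.energy u u)).sqrt
      simpa using this
  have h2 := (h.add (h1.const_mul 2)).add_const (D.energy u u)
  simp only [mul_zero, add_zero, zero_add] at h2
  refine h2.congr fun n => ?_
  have := energy_add_self ((hf n).sub hu) hu
  rw [sub_add_cancel] at this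
  exact this.symm

theorem aestronglyMeasurable_diff (hj : D.HasJumpKernel j) (hu : AEStronglyMeasurable u m) :
    AEStronglyMeasurable (diff u) (jumpMeasure m j) :=
  (hu.comp_quasiMeasurePreserving quasiMeasurePreserving_fst_jumpMeasure).sub
    (hu.comp_quasiMeasurePreserving (quasiMeasurePreserving_snd_jumpMeasure hj.symm))

theorem diff_congr (hj : D.HasJumpKernel j) (h : u =ᵐ[m] u') :
    diff u =ᵐ[jumpMeasure m j] diff u' := by
  filter_upwards [quasiMeasurePreserving_fst_jumpMeasure.ae h,
    (quasiMeasurePreserving_snd_jumpMeasure hj.symm).ae h] with p h1 h2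
  rw [diff, diff, h1, h2]

theorem jumpEnergy_eq (u v : X → ℝ) :
    jumpEnergy m j u v = ∫ p, diff u p * diff v p ∂(jumpMeasure m j) := rfl

theorem jumpEnergy_self (u : X → ℝ) :
    jumpEnergy m j u u = ∫ p, diff u p ^ 2 ∂(jumpMeasure m j) := by
  simp only [jumpEnergy_eq, pow_two]

/-- On the core the bound says `E^(c) ≥ 0`. It extends by Fatou along an a.e. convergent core
sequence; a.e. convergence for `m` passes to both coordinates of `J` because its marginals are
absolutely continuous. -/
theorem RegularWithJumps.memLp_diff (h : D.RegularWithJumps j) (hu : D.Mem u) :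
    MemLp (diff u) 2 (jumpMeasure m j) ∧ jumpEnergy m j u u ≤ D.energy u u := by
  obtain ⟨f, hf, hfe, -, hae⟩ := exists_seq_core h.regular hu
  have hconv := tendsto_energy_self (fun n => (hf n).2.2) hu hfe
  have hmeas : ∀ {g : X → ℝ}, D.Mem g → AEStronglyMeasurable (diff g) (jumpMeasure m j) :=
    fun hg => aestronglyMeasurable_diff h.jumps hg.memLp.1
  have hcore : ∀ n, ∫⁻ p, ENNReal.ofReal (diff (f n) p ^ 2) ∂(jumpMeasure m j)
      ≤ ENNReal.ofReal (D.energy (f n) (f n)) := fun n => by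
    have hi : Integrable (fun p => diff (f n) p ^ 2) (jumpMeasure m j) :=
      h.jumps.integrable _ (hf n)
    rw [← ofReal_integral_eq_lintegral_ofReal hi
      (ae_of_all _ fun p => sq_nonneg _)]
    refine ENNReal.ofReal_le_ofReal ?_
    have := h.jumps.nonneg _ (hf n)
    rw [localEnergy, jumpEnergy_self] at this
    linarith
  have hfatou : ∫⁻ p, ENNReal.ofReal (diff u p ^ 2) ∂(jumpMeasure m j)
      ≤ ENNReal.ofReal (D.energy u u) := by
    calc ∫⁻ p, ENNReal.ofReal (diff u p ^ 2) ∂(jumpMeasure m j)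
        = ∫⁻ p, liminf (fun n => ENNReal.ofReal (diff (f n) p ^ 2)) atTop ∂(jumpMeasure m j) := by
          refine lintegral_congr_ae ?_
          filter_upwards [quasiMeasurePreserving_fst_jumpMeasure.ae hae,
            (quasiMeasurePreserving_snd_jumpMeasure h.jumps.symm).ae hae] with p h1 h2
          exact (ENNReal.tendsto_ofReal ((h1.sub h2).pow 2)).liminf_eq.symm
      _ ≤ liminf (fun n => ∫⁻ p, ENNReal.ofReal (diff (f n) p ^ 2) ∂(jumpMeasure m j)) atTop :=
          lintegral_liminf_le' fun n => ((hmeas (hf n).2.2).aemeasurable.pow_const 2).ennreal_ofReal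
      _ ≤ liminf (fun n => ENNReal.ofReal (D.energy (f n) (f n))) atTop :=
          liminf_le_liminf (Eventually.of_forall hcore)
      _ = ENNReal.ofReal (D.energy u u) := (ENNReal.tendsto_ofReal hconv).liminf_eq
  have hint : Integrable (fun p => diff u p ^ 2) (jumpMeasure m j) := by
    refine ⟨(hmeas hu).pow 2, ?_⟩
    rw [hasFiniteIntegral_iff_ofReal (ae_of_all _ fun p => sq_nonneg _)]
    exact hfatou.trans_lt ENNReal.ofReal_lt_top
  refine ⟨(memLp_two_iff_integrable_sq (hmeas hu)).2 hint, ?_⟩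
  rw [← ofReal_integral_eq_lintegral_ofReal hint (ae_of_all _ fun p => sq_nonneg _)] at hfatou
  rw [jumpEnergy_self]
  exact (ENNReal.ofReal_le_ofReal_iff (energy_self_nonneg _)).1 hfatou

theorem RegularWithJumps.integrable_diff_mul (h : D.RegularWithJumps j) (hu : D.Mem u)
    (hv : D.Mem v) : Integrable (fun p => diff u p * diff v p) (jumpMeasure m j) :=
  (h.memLp_diff hu).1.integrable_mul (h.memLp_diff hv).1

namespace RegularWithJumps

theorem localEnergy_congr (h : D.RegularWithJumps j) (hu : u =ᵐ[m] u') (hv : v =ᵐ[m] v') :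
    D.localEnergy j u v = D.localEnergy j u' v' := by
  rw [localEnergy, localEnergy, energy_congr hu hv, jumpEnergy_eq, jumpEnergy_eq]
  congr 1
  refine integral_congr_ae ?_
  filter_upwards [diff_congr h.jumps hu, diff_congr h.jumps hv] with p h1 h2
  rw [h1, h2]

theorem _root_.DirichletForm.localEnergy_comm (u v : X → ℝ) :
    D.localEnergy j u v = D.localEnergy j v u := by
  rw [localEnergy, localEnergy, energy_comm, jumpEnergy, jumpEnergy]
  simp only [mul_comm]

theorem localEnergy_add_left (h : D.RegularWithJumps j) (hu : D.Mem u) (hv : D.Mem v) (hw : D.Mem w) :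
    D.localEnergy j (u + v) w = D.localEnergy j u w + D.localEnergy j v w := by
  have : jumpEnergy m j (u + v) w = jumpEnergy m j u w + jumpEnergy m j v w := by
    simp only [jumpEnergy_eq]
    rw [← integral_add (h.integrable_diff_mul hu hw) (h.integrable_diff_mul hv hw)]
    congr 1; funext p; simp only [diff, Pi.add_apply]; ring
  rw [localEnergy, localEnergy, localEnergy, energy_add_left hu hv hw, this]; ring

theorem localEnergy_smul_left (_h : D.RegularWithJumps j) (c : ℝ) (hu : D.Mem u) (hw : D.Mem w) :
    D.localEnergy j (c • u) w = c * D.localEnergy j u w := by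
  have : jumpEnergy m j (c • u) w = c * jumpEnergy m j u w := by
    simp only [jumpEnergy_eq]
    rw [← integral_const_mul]
    congr 1; funext p; simp only [diff, Pi.smul_apply, smul_eq_mul]; ring
  rw [localEnergy, localEnergy, energy_smul_left c hu hw, this]; ring

theorem localEnergy_add_right (h : D.RegularWithJumps j) (hu : D.Mem u) (hv : D.Mem v) (hw : D.Mem w) :
    D.localEnergy j w (u + v) = D.localEnergy j w u + D.localEnergy j w v := by
  rw [localEnergy_comm, h.localEnergy_add_left hu hv hw, localEnergy_comm u, localEnergy_comm v]

theorem localEnergy_smul_right (h : D.RegularWithJumps j) (c : ℝ) (hu : D.Mem u) (hw : D.Mem w) :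
    D.localEnergy j w (c • u) = c * D.localEnergy j w u := by
  rw [localEnergy_comm, h.localEnergy_smul_left c hu hw, localEnergy_comm u]

theorem localEnergy_sub_left (h : D.RegularWithJumps j) (hu : D.Mem u) (hv : D.Mem v) (hw : D.Mem w) :
    D.localEnergy j (u - v) w = D.localEnergy j u w - D.localEnergy j v w := by
  have h1 : u - v = u + (-1 : ℝ) • v := by rw [neg_one_smul, sub_eq_add_neg]
  rw [h1, h.localEnergy_add_left hu (hv.smul _) hw, h.localEnergy_smul_left _ hv hw]; ring

theorem localEnergy_sub_right (h : D.RegularWithJumps j) (hu : D.Mem u) (hv : D.Mem v) (hw : D.Mem w) :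
    D.localEnergy j w (u - v) = D.localEnergy j w u - D.localEnergy j w v := by
  rw [localEnergy_comm, h.localEnergy_sub_left hu hv hw, localEnergy_comm u, localEnergy_comm v]

theorem localEnergy_self_nonneg (h : D.RegularWithJumps j) (hu : D.Mem u) : 0 ≤ D.localEnergy j u u :=
  sub_nonneg.2 (h.memLp_diff hu).2

theorem _root_.DirichletForm.localEnergy_self_le (u : X → ℝ) :
    D.localEnergy j u u ≤ D.energy u u := by
  rw [localEnergy, jumpEnergy]
  exact sub_le_self _ (integral_nonneg fun p => mul_self_nonneg _)

theorem localEnergy_sq_le (h : D.RegularWithJumps j) (hu : D.Mem u) (hv : D.Mem v) :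
    D.localEnergy j u v ^ 2 ≤ D.localEnergy j u u * D.localEnergy j v v := by
  refine sq_le_mul_of_quadratic_nonneg fun t => ?_
  have hn := h.localEnergy_self_nonneg ((hu.smul t).add hv)
  rw [h.localEnergy_add_left (hu.smul t) hv ((hu.smul t).add hv),
    h.localEnergy_add_right (hu.smul t) hv (hu.smul t), h.localEnergy_add_right (hu.smul t) hv hv,
    h.localEnergy_smul_left t hu (hu.smul t), h.localEnergy_smul_left t hu hv,
    h.localEnergy_smul_right t hu hu, h.localEnergy_smul_right t hu hv,
    localEnergy_comm v u] at hn
  linarith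

/-- Because `0 ≤ E^(c) ≤ E` on the diagonal, weak limits in the domain may also be taken inside
`E^(c)`. -/
theorem isBoundedFunctional_localEnergy (h : D.RegularWithJumps j) (hv : D.Mem v) :
    D.IsBoundedFunctional (fun u => D.localEnergy j u v) where
  congr _ _ h' := h.localEnergy_congr h' EventuallyEq.rfl
  add _ _ h1 h2 := h.localEnergy_add_left h1 h2 hv
  smul c _ h1 := h.localEnergy_smul_left c h1 hv
  bound := ⟨D.localEnergy j v v, fun u hu => by
    rw [mul_comm]
    exact (h.localEnergy_sq_le hu hv).trans
      (mul_le_mul_of_nonneg_right (localEnergy_self_le u) (h.localEnergy_self_nonneg hv))⟩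

theorem tendsto_localEnergy_of_bounded (h : D.RegularWithJumps j) {w : ℕ → X → ℝ} (hw : ∀ n, D.Mem (w n)) {C : ℝ}
    (hC : ∀ n, D.energy (w n) (w n) ≤ C) (hu : MemLp u 2 m)
    (hlim : Tendsto (fun n => eLpNorm (w n - u) 2 m) atTop (𝓝 0)) (hv : D.Mem v) :
    Tendsto (fun n => D.localEnergy j (w n) v) atTop (𝓝 (D.localEnergy j u v)) :=
  (mem_of_energy_bounded hw hC hu hlim).2 _ (h.isBoundedFunctional_localEnergy hv)

end RegularWithJumps

end LocalPart

end DirichletForm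

namespace DirichletForm

/-! ### A mode of convergence stable under products. -/

section BoundedConvergence

variable {X : Type*} [MeasurableSpace X] {m : Measure X} {D : DirichletForm m}
  {w w' : ℕ → X → ℝ} {u u' : X → ℝ}

variable (D) in
/-- A sequence in the domain, bounded in energy and uniformly bounded, which converges in `L²` to a
bounded function of the domain. -/
structure BoundedConvergence (w : ℕ → X → ℝ) (u : X → ℝ) : Prop where
  mem : ∀ n, D.Mem (w n)
  limit : D.MemBdd u
  energy_le : ∃ C, ∀ n, D.energy (w n) (w n) ≤ C
  bound : ∃ M, 0 < M ∧ ∀ n, ∀ᵐ x ∂m, |w n x| ≤ M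
  tendsto : Tendsto (fun n => eLpNorm (w n - u) 2 m) atTop (𝓝 0)

theorem BoundedConvergence.const (hu : D.MemBdd u) : D.BoundedConvergence (fun _ => u) u where
  mem _ := hu.1
  limit := hu
  energy_le := ⟨_, fun _ => le_rfl⟩
  bound := by
    obtain ⟨M, hM, h⟩ := hu.exists_bound
    exact ⟨M, hM, fun _ => h⟩
  tendsto := by simp

theorem BoundedConvergence.memBdd (h : D.BoundedConvergence w u) (n : ℕ) : D.MemBdd (w n) := by
  obtain ⟨M, -, hM⟩ := h.bound
  exact (h.mem n).memBdd (hM n)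

theorem BoundedConvergence.sub (h : D.BoundedConvergence w u) (h' : D.BoundedConvergence w' u') :
    D.BoundedConvergence (fun n => w n - w' n) (u - u') where
  mem n := (h.mem n).sub (h'.mem n)
  limit := h.limit.sub h'.limit
  energy_le := by
    obtain ⟨C, hC⟩ := h.energy_le
    obtain ⟨C', hC'⟩ := h'.energy_le
    exact ⟨2 * (C + C'), fun n => (energy_sub_self_le (h.mem n) (h'.mem n)).trans
      (by linarith [hC n, hC' n])⟩
  bound := by
    obtain ⟨M, hM, hb⟩ := h.bound
    obtain ⟨M', hM', hb'⟩ := h'.bound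
    refine ⟨M + M', by positivity, fun n => ?_⟩
    filter_upwards [hb n, hb' n] with x h1 h2
    exact (abs_sub _ _).trans (add_le_add h1 h2)
  tendsto := by
    have h0 := h.tendsto.add h'.tendsto
    rw [add_zero] at h0
    refine tendsto_of_tendsto_of_tendsto_of_le_of_le tendsto_const_nhds h0 (fun _ => zero_le)
      fun n => ?_
    have h1 : w n - w' n - (u - u') = (w n - u) - (w' n - u') := by abel
    rw [h1]
    exact eLpNorm_sub_le ((h.mem n).memLp.1.sub h.limit.1.memLp.1)
      ((h'.mem n).memLp.1.sub h'.limit.1.memLp.1) (by norm_num)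

/-- The uniform bounds let `Mem.mul` control the energies of the products; no strong convergence in
energy is claimed, and weak limits only need these bounds. -/
theorem BoundedConvergence.mul (h : D.BoundedConvergence w u) (h' : D.BoundedConvergence w' u') :
    D.BoundedConvergence (fun n => w n * w' n) (u * u') where
  mem n := ((h.memBdd n).mul (h'.memBdd n)).1
  limit := h.limit.mul h'.limit
  energy_le := by
    obtain ⟨C, hC⟩ := h.energy_le
    obtain ⟨C', hC'⟩ := h'.energy_le
    obtain ⟨M, hM, hb⟩ := h.bound
    obtain ⟨M', hM', hb'⟩ := h'.bound
    refine ⟨32 * (max M M') ^ 2 * (C + C'), fun n => ?_⟩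
    refine ((h.mem n).mul (h'.mem n) (lt_max_of_lt_left hM)
      ((hb n).mono fun x hx => hx.trans (le_max_left _ _))
      ((hb' n).mono fun x hx => hx.trans (le_max_right _ _))).2.trans ?_
    gcongr
    · exact hC n
    · exact hC' n
  bound := by
    obtain ⟨M, hM, hb⟩ := h.bound
    obtain ⟨M', hM', hb'⟩ := h'.bound
    refine ⟨M * M', by positivity, fun n => ?_⟩
    filter_upwards [hb n, hb' n] with x h1 h2
    rw [Pi.mul_apply, abs_mul]
    gcongr
  tendsto := by
    obtain ⟨M, hM, hb⟩ := h.bound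
    obtain ⟨M', hM', hb'⟩ := h'.limit.exists_bound
    have h0 := (ENNReal.Tendsto.const_mul (a := ENNReal.ofReal M) h'.tendsto
      (Or.inr ENNReal.ofReal_ne_top)).add
      (ENNReal.Tendsto.const_mul (a := ENNReal.ofReal M') h.tendsto (Or.inr ENNReal.ofReal_ne_top))
    simp only [mul_zero, add_zero] at h0
    refine tendsto_of_tendsto_of_tendsto_of_le_of_le tendsto_const_nhds h0 (fun _ => zero_le)
      fun n => ?_
    have h1 : w n * w' n - u * u' = w n * (w' n - u') + u' * (w n - u) := by ring
    have hs := (h.mem n).memLp.1.sub h.limit.1.memLp.1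
    have hs' := (h'.mem n).memLp.1.sub h'.limit.1.memLp.1
    simp only
    rw [h1]
    refine (eLpNorm_add_le ((h.mem n).memLp.1.mul hs') (h'.limit.1.memLp.1.mul hs)
      (by norm_num)).trans (add_le_add ?_ ?_)
    · refine eLpNorm_le_mul_eLpNorm_of_ae_le_mul ?_ 2
      filter_upwards [hb n] with x hx
      rw [Pi.mul_apply, norm_mul]
      exact mul_le_mul_of_nonneg_right hx (norm_nonneg _)
    · refine eLpNorm_le_mul_eLpNorm_of_ae_le_mul ?_ 2
      filter_upwards [hb'] with x hx
      rw [Pi.mul_apply, norm_mul]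
      exact mul_le_mul_of_nonneg_right hx (norm_nonneg _)

end BoundedConvergence

/-! ### Core approximation, cutoffs, locality and testing against the core. -/

section Core

variable {X : Type*} [MetricSpace X] [ProperSpace X] [MeasurableSpace X] [BorelSpace X]
  {m : Measure X} [IsFiniteMeasureOnCompacts m] {D : DirichletForm m}
  {j : Kernel X X} [IsSFiniteKernel j] {u v f g χ : X → ℝ}

theorem MemCore.exists_bound (hf : D.MemCore f) : ∃ M, 0 < M ∧ ∀ x, |f x| ≤ M := by
  obtain ⟨C, hC⟩ := hf.2.1.exists_bound_of_continuous hf.1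
  exact ⟨max C 1, by positivity, fun x => (hC x).trans (le_max_left _ _)⟩

theorem MemCore.memBdd (hf : D.MemCore f) : D.MemBdd f := by
  obtain ⟨M, -, hM⟩ := hf.exists_bound
  exact hf.2.2.memBdd (ae_of_all _ hM)

theorem MemCore.mul (hf : D.MemCore f) (hg : D.MemCore g) : D.MemCore (f * g) :=
  ⟨hf.1.mul hg.1, hf.2.1.mul_right, (hf.memBdd.mul hg.memBdd).1⟩

theorem MemCore.add (hf : D.MemCore f) (hg : D.MemCore g) : D.MemCore (f + g) :=
  ⟨hf.1.add hg.1, hf.2.1.add hg.2.1, hf.2.2.add hg.2.2⟩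

theorem MemCore.smul (c : ℝ) (hf : D.MemCore f) : D.MemCore (c • f) :=
  ⟨hf.1.const_smul c, hf.2.1.comp_left (g := fun t => c * t) (mul_zero c), hf.2.2.smul c⟩

theorem MemCore.sub (hf : D.MemCore f) (hg : D.MemCore g) : D.MemCore (f - g) := by
  have := hf.add (hg.smul (-1))
  rwa [neg_one_smul, ← sub_eq_add_neg] at this

theorem MemCore.posPart (hf : D.MemCore f) : D.MemCore (fun x => max 0 (f x)) := by
  obtain ⟨M, hM, hb⟩ := hf.exists_bound
  exact ⟨continuous_const.max hf.1, hf.2.1.comp_left (g := fun t => max 0 t) (max_self 0),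
    (hf.2.2.posPart hM (ae_of_all _ hb)).1⟩

theorem MemCore.truncate (hf : D.MemCore f) {M : ℝ} (hM : 0 < M) :
    D.MemCore (fun x => max (-M) (min (f x) M)) :=
  ⟨continuous_const.max (hf.1.min continuous_const),
    hf.2.1.comp_left (g := fun t => max (-M) (min t M)) (by rw [min_eq_left hM.le,
      max_eq_right (by linarith)]), (hf.memBdd.truncate hM).1⟩

theorem exists_bounded_seq_core (hreg : D.IsRegular) (hu : D.MemBdd u) :
    ∃ f : ℕ → X → ℝ, (∀ n, D.MemCore (f n)) ∧ D.BoundedConvergence f u ∧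
      Tendsto (fun n => D.energy (f n - u) (f n - u)) atTop (𝓝 0) ∧
      (∃ M, ∀ n x, |f n x| ≤ M) ∧
      ∀ᵐ x ∂m, Tendsto (fun n => f n x) atTop (𝓝 (u x)) := by
  obtain ⟨M, hM, hub⟩ := hu.exists_bound
  obtain ⟨f, hf, hfe, hfl, hfa⟩ := exists_seq_core hreg hu.1
  have hTu : ∀ᵐ x ∂m, max (-M) (min (u x) M) = u x := by
    filter_upwards [hub] with x hx
    rw [min_eq_left (le_of_abs_le hx), max_eq_right (neg_le_of_abs_le hx)]
  have hTb : ∀ n x, |max (-M) (min (f n x) M)| ≤ M := fun n x =>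
    abs_le.2 ⟨le_max_left _ _, max_le (by linarith) (min_le_right _ _)⟩
  have hT := fun n => (hf n).truncate hM
  have hTe := fun n => ((hf n).memBdd.truncate hM).2
  have hconv := tendsto_energy_self (fun n => (hf n).2.2) hu.1 hfe
  obtain ⟨C, hC⟩ := hconv.bddAbove_range
  have hL2 : Tendsto (fun n => eLpNorm ((fun x => max (-M) (min (f n x) M)) - u) 2 m) atTop
      (𝓝 0) := by
    refine tendsto_of_tendsto_of_tendsto_of_le_of_le tendsto_const_nhds hfl (fun _ => zero_le)
      fun n => eLpNorm_mono_ae ?_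
    filter_upwards [hTu] with x hx
    rw [Pi.sub_apply, Pi.sub_apply, Real.norm_eq_abs, Real.norm_eq_abs]
    nth_rewrite 1 [← hx]
    exact (abs_max_sub_max_le_max _ _ _ _).trans (max_le (by simp)
      ((abs_min_sub_min_le_max _ _ _ _).trans (by simp)))
  have hbc : D.BoundedConvergence (fun n x => max (-M) (min (f n x) M)) u :=
    ⟨fun n => (hT n).2.2, hu, ⟨C, fun n => (hTe n).trans (hC ⟨n, rfl⟩)⟩,
      ⟨M, hM, fun n => ae_of_all _ (hTb n)⟩, hL2⟩
  refine ⟨fun n x => max (-M) (min (f n x) M), hT, hbc, ?_, ⟨M, hTb⟩, ?_⟩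
  -- Truncation does not increase the energies, which tend to `E(u,u)`; with weak convergence this
  -- upgrades to strong convergence in energy.
  · have h1 := tendsto_energy_of_bounded hbc.mem (fun n => (hTe n).trans (hC ⟨n, rfl⟩)) hu.1.memLp
      hL2 hu.1
    have h2 := (hconv.sub (h1.const_mul 2)).add_const (D.energy u u)
    rw [show D.energy u u - 2 * D.energy u u + D.energy u u = 0 by ring] at h2
    refine squeeze_zero (fun n => energy_self_nonneg _) (fun n => ?_) h2
    rw [energy_sub_self (hT n).2.2 hu.1]
    linarith [hTe n]
  · filter_upwards [hfa, hTu] with x hx hx'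
    have : Continuous (fun t : ℝ => max (-M) (min t M)) := by fun_prop
    have h1 := (this.tendsto (u x)).comp hx
    rwa [hx'] at h1

/-- Cutoff functions in the core. -/
theorem exists_cutoff (hreg : D.IsRegular) {K U : Set X} (hK : IsCompact K) (hU : IsOpen U)
    (hKU : K ⊆ U) : ∃ χ, D.MemCore χ ∧ (∀ x, χ x ∈ Icc (0 : ℝ) 1) ∧ tsupport χ ⊆ U ∧
      ∃ V, IsOpen V ∧ K ⊆ V ∧ ∀ x ∈ V, χ x = 1 := by
  obtain ⟨L, hL, hKL, hLU⟩ := exists_compact_between hK hU hKU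
  obtain ⟨L', hL', hLL', hL'U⟩ := exists_compact_between hL hU hLU
  obtain ⟨g, hg1, hg0, hgc, hgI⟩ := exists_continuous_one_zero_of_isCompact hL
    isOpen_interior.isClosed_compl (disjoint_compl_right_iff_subset.2 hLL')
  -- Approximating `3g` within 1 separates the levels: `f > 2` where `g = 1` and `f < 1` where `g =
  -- 0`. Hence `(f⁺ - 1)⁺ ∧ 1` is exactly 1 and exactly 0 there.
  obtain ⟨f, hf, hfg⟩ := hreg.2 (fun x => 3 * g x) (by fun_prop)
    (hgc.comp_left (g := fun t : ℝ => 3 * t) (mul_zero 3)) 1 one_pos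
  have hp := hf.posPart
  have hp0 : ∀ᵐ x ∂m, 0 ≤ max 0 (f x) := ae_of_all _ fun x => le_max_left _ _
  have hr := hp.2.2.sub (hp.2.2.min_const hp0 one_pos)
  have hχ := (hr.clamp one_pos).1
  set χ : X → ℝ := fun x =>
    min (max 0 (((fun x => max 0 (f x)) - fun x => min (max 0 (f x)) 1) x)) 1 with hχdef
  have hzero : ∀ x, f x ≤ 1 → χ x = 0 := fun x hx => by
    simp only [hχdef, Pi.sub_apply]
    rw [min_eq_left (max_le zero_le_one hx)]; simp
  have hone : ∀ x, 2 ≤ f x → χ x = 1 := fun x hx => by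
    simp only [hχdef, Pi.sub_apply]
    rw [max_eq_right (by linarith : 0 ≤ f x), min_eq_right (by linarith : 1 ≤ f x),
      max_eq_right (by linarith), min_eq_right (by linarith)]
  have hsupp : tsupport χ ⊆ L' := by
    refine closure_minimal (fun x hx => ?_) hL'.isClosed
    by_contra hxL
    have h1 : g x = 0 := hg0 (fun h => hxL (interior_subset h))
    have h2 := hfg x
    rw [h1, mul_zero, sub_zero] at h2
    exact hx (hzero x (le_of_abs_le h2.le))
  refine ⟨χ, ⟨?_, hL'.of_isClosed_subset (isClosed_tsupport _) hsupp, hχ⟩, fun x => ?_,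
    hsupp.trans hL'U, interior L, isOpen_interior, hKL, fun x hx => hone x ?_⟩
  · have := hf.1
    simp only [hχdef, Pi.sub_apply]
    fun_prop
  · exact ⟨le_min (le_max_left _ _) zero_le_one, min_le_right _ _⟩
  · have h1 : g x = 1 := hg1 (interior_subset hx)
    have h2 := (abs_lt.1 (hfg x)).1
    rw [h1] at h2
    linarith

theorem RegularWithJumps.tendsto_localEnergy (h : D.RegularWithJumps j) {w : ℕ → X → ℝ}
    (hw : D.BoundedConvergence w u) (hv : D.Mem v) :
    Tendsto (fun n => D.localEnergy j (w n) v) atTop (𝓝 (D.localEnergy j u v)) := by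
  obtain ⟨C, hC⟩ := hw.energy_le
  exact h.tendsto_localEnergy_of_bounded hw.mem hC hw.limit.1.memLp hw.tendsto hv

/-- Strong locality, for a core function and a bounded function of the domain. -/
theorem RegularWithJumps.localEnergy_eq_zero_of_core (h : D.RegularWithJumps j) (hf : D.MemCore f)
    (hg : D.MemBdd g) {G : Set X} (hG : IsOpen G) (hfG : tsupport f ⊆ G) {c : ℝ}
    (hgc : ∀ᵐ x ∂m.restrict G, g x = c) : D.localEnergy j f g = 0 := by
  -- Write `g = cη + (g - ηg)`. The first summand is constant near the support of `f`; the second is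
  -- a limit of core functions `w n - η * w n` vanishing there.
  obtain ⟨η, hη, -, hηG, V, hV, hfV, hηV⟩ := exists_cutoff h.regular hf.2.1.isCompact hG hfG
  obtain ⟨w, hw, hwg, -⟩ := exists_bounded_seq_core h.regular hg
  have h1 : D.localEnergy j f η = 0 :=
    h.jumps.stronglyLocal _ _ hf hη ⟨1, V, hV, hfV, hηV⟩
  have h2 : ∀ n, D.localEnergy j (w n - η * w n) f = 0 := fun n => by
    rw [localEnergy_comm]
    refine h.jumps.stronglyLocal _ _ hf ((hw n).sub (hη.mul (hw n))) ⟨0, V, hV, hfV, fun x hx => ?_⟩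
    simp [hηV x hx]
  have h3 := h.tendsto_localEnergy (hwg.sub ((BoundedConvergence.const hη.memBdd).mul hwg)) hf.2.2
  simp only [h2] at h3
  have h4 : D.localEnergy j (g - η * g) f = 0 := (tendsto_nhds_unique tendsto_const_nhds h3).symm
  have h5 : g =ᵐ[m] c • η + (g - η * g) := by
    filter_upwards [(ae_restrict_iff' hG.measurableSet).1 hgc] with x hx
    simp only [Pi.add_apply, Pi.smul_apply, Pi.sub_apply, Pi.mul_apply, smul_eq_mul]
    by_cases hxG : x ∈ G
    · rw [hx hxG]; ring
    · rw [image_eq_zero_of_notMem_tsupport fun hx' => hxG (hηG hx')]; ring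
  have h6 := (hg.sub (hη.memBdd.mul hg)).1
  rw [h.localEnergy_congr .rfl h5, h.localEnergy_add_right (hη.2.2.smul c) h6 hf.2.2,
    h.localEnergy_smul_right c hη.2.2 hf.2.2, h1, localEnergy_comm, h4]
  ring

/-- Strong locality for bounded functions of the domain. -/
theorem RegularWithJumps.localEnergy_eq_zero (h : D.RegularWithJumps j) (hχ : D.MemCore χ)
    (hf : D.MemBdd f) (hg : D.MemBdd g) {G : Set X} (hG : IsOpen G) (hχG : tsupport χ ⊆ G) {c : ℝ}
    (hgc : ∀ᵐ x ∂m.restrict G, g x = c) : D.localEnergy j (f * χ) g = 0 := by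
  obtain ⟨w, hw, hwf, -⟩ := exists_bounded_seq_core h.regular hf
  have h1 := h.tendsto_localEnergy (hwf.mul (BoundedConvergence.const hχ.memBdd)) hg.1
  refine (tendsto_nhds_unique (tendsto_const_nhds.congr fun n => ?_) h1).symm
  exact (h.localEnergy_eq_zero_of_core ((hw n).mul hχ) hg hG
    ((tsupport_mul_subset_right).trans hχG) hgc).symm

/-- Cutoffs supported in shrinking neighbourhoods of `K` converge pointwise to its indicator. -/
theorem setIntegral_nonneg_of_core (hreg : D.IsRegular) {G : Set X} (hG : IsOpen G)
    (hu : Integrable u m)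
    (hf : ∀ f, D.MemCore f → (∀ x, 0 ≤ f x) → tsupport f ⊆ G → 0 ≤ ∫ x, f x * u x ∂m)
    {K : Set X} (hK : IsCompact K) (hKG : K ⊆ G) : 0 ≤ ∫ x in K, u x ∂m := by
  choose χ hχ hχI hχG V hV hKV hχV using fun n : ℕ => exists_cutoff (D := D) hreg hK
    (hG.inter (Metric.isOpen_thickening (δ := 1 / ((n : ℝ) + 1)) (E := K)))
    (subset_inter hKG (Metric.self_subset_thickening (by positivity) K))
  have hlim : Tendsto (fun n => ∫ x, χ n x * u x ∂m) atTop (𝓝 (∫ x, K.indicator u x ∂m)) := by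
    refine tendsto_integral_of_dominated_convergence (fun x => ‖u x‖)
      (fun n => (hχ n).1.aestronglyMeasurable.mul hu.1) hu.norm (fun n => ae_of_all _ fun x => ?_)
      (ae_of_all _ fun x => ?_)
    · rw [norm_mul]
      refine mul_le_of_le_one_left (norm_nonneg _) ?_
      rw [Real.norm_eq_abs, abs_of_nonneg (hχI n x).1]
      exact (hχI n x).2
    · by_cases hx : x ∈ K
      · rw [indicator_of_mem hx]
        refine tendsto_const_nhds.congr fun n => ?_
        rw [hχV n x (hKV n hx), one_mul]
      · rw [indicator_of_notMem hx]
        have h1 : x ∉ closure K := by rwa [hK.isClosed.closure_eq]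
        have h2 : ∃ δ > 0, x ∉ Metric.thickening δ K := by
          by_contra! hcon
          rw [Metric.closure_eq_iInter_thickening] at h1
          exact h1 (mem_iInter₂.2 hcon)
        obtain ⟨δ, hδ, hxδ⟩ := h2
        obtain ⟨N, hN⟩ := exists_nat_one_div_lt hδ
        refine tendsto_const_nhds.congr' ?_
        filter_upwards [eventually_ge_atTop N] with n hn
        have h3 : χ n x = 0 := by
          refine image_eq_zero_of_notMem_tsupport fun hx' => hxδ ?_
          refine Metric.thickening_mono ?_ K (hχG n hx').2
          refine le_trans ?_ hN.le
          gcongr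
        rw [h3, zero_mul]
  rw [integral_indicator hK.measurableSet] at hlim
  exact ge_of_tendsto' hlim fun n =>
    hf _ (hχ n) (fun x => (hχI n x).1) ((hχG n).trans inter_subset_left)

/-- An integrable function whose integrals against non-negative core functions supported in an open
set are non-negative is non-negative on that set. -/
theorem ae_nonneg_of_core (hreg : D.IsRegular) {G : Set X} (hG : IsOpen G)
    (hu : Integrable u m)
    (hf : ∀ f, D.MemCore f → (∀ x, 0 ≤ f x) → tsupport f ⊆ G → 0 ≤ ∫ x, f x * u x ∂m) :
    ∀ᵐ x ∂m.restrict G, 0 ≤ u x := by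
  obtain ⟨v, hv, huv⟩ := hu.1
  have hvm := hv.measurable
  have hmeas : ∀ n, MeasurableSet (G ∩ {x | v x < 0} ∩ compactCovering X n) := fun n =>
    (hG.measurableSet.inter (measurableSet_lt hvm measurable_const)).inter
      (isCompact_compactCovering X n).measurableSet
  have hnull : ∀ n, m (G ∩ {x | v x < 0} ∩ compactCovering X n) = 0 := by
    intro n
    by_contra hne
    have hfin : m (G ∩ {x | v x < 0} ∩ compactCovering X n) ≠ ⊤ :=
      ((measure_mono inter_subset_right).trans_lt
        (isCompact_compactCovering X n).measure_lt_top).ne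
    -- By inner regularity a non-null set of negativity contains a compact set of positive measure,
    -- over which the integral would be negative.
    obtain ⟨K, hKs, hK, hKpos⟩ := (hmeas n).exists_lt_isCompact_of_ne_top hfin
      (pos_iff_ne_zero.2 hne)
    have h1 := setIntegral_nonneg_of_core hreg hG hu hf hK fun x hx => (hKs hx).1.1
    have huv' : u =ᵐ[m.restrict K] v := ae_restrict_of_ae huv
    rw [integral_congr_ae huv'] at h1
    have hvi : IntegrableOn v K m := (hu.congr huv).integrableOn
    have h2 : 0 ≤ᵐ[m.restrict K] fun x => -v x := by
      filter_upwards [ae_restrict_mem hK.measurableSet] with x hx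
      have h4 : v x < 0 := (hKs hx).1.2
      simp only [Pi.zero_apply]
      linarith
    have h3 : ∫ x in K, -v x ∂m = 0 := by
      refine le_antisymm ?_ (integral_nonneg_of_ae h2)
      rw [integral_neg]; linarith
    rw [integral_eq_zero_iff_of_nonneg_ae h2 hvi.neg] at h3
    have h5 : ∀ᵐ x ∂m.restrict K, False := by
      filter_upwards [h3, ae_restrict_mem hK.measurableSet] with x h4 hx
      have h6 : v x < 0 := (hKs hx).1.2
      simp only [Pi.zero_apply] at h4
      linarith
    rw [ae_iff] at h5
    simp only [not_false_eq_true, ofPred_true, Measure.restrict_apply_univ] at h5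
    exact hKpos.ne' h5
  rw [ae_restrict_iff' hG.measurableSet]
  have hall : ∀ᵐ x ∂m, ∀ n, x ∉ G ∩ {x | v x < 0} ∩ compactCovering X n :=
    ae_all_iff.2 fun n => measure_eq_zero_iff_ae_notMem.1 (hnull n)
  filter_upwards [hall, huv] with x hx hxv hxG
  by_contra! hneg
  obtain ⟨n, hn⟩ := mem_iUnion.1 ((iUnion_compactCovering X).symm ▸ mem_univ x : x ∈ ⋃ n, compactCovering X n)
  exact hx n ⟨⟨hxG, show v x < 0 by rwa [← hxv]⟩, hn⟩

/-- Two integrable functions with equal integrals against the core functions supported in an open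
set agree on that set. -/
theorem ae_eq_of_core (hreg : D.IsRegular) {G : Set X} (hG : IsOpen G)
    (hu : Integrable u m) (hv : Integrable v m)
    (hf : ∀ f, D.MemCore f → tsupport f ⊆ G → ∫ x, f x * u x ∂m = ∫ x, f x * v x ∂m) :
    u =ᵐ[m.restrict G] v := by
  have hint : ∀ f, D.MemCore f → ∀ {w : X → ℝ}, Integrable w m → Integrable (fun x => f x * w x) m :=
    fun f hf w hw => by
      obtain ⟨M, -, hM⟩ := hf.exists_bound
      exact hw.bdd_mul hf.1.aestronglyMeasurable (ae_of_all _ hM)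
  have h1 := ae_nonneg_of_core hreg hG (hu.sub hv) fun f hf' _ hfG => by
    simp only [Pi.sub_apply, mul_sub]
    rw [integral_sub (hint f hf' hu) (hint f hf' hv), hf f hf' hfG, sub_self]
  have h2 := ae_nonneg_of_core hreg hG (hv.sub hu) fun f hf' _ hfG => by
    simp only [Pi.sub_apply, mul_sub]
    rw [integral_sub (hint f hf' hv) (hint f hf' hu), hf f hf' hfG, sub_self]
  filter_upwards [h1, h2] with x hx1 hx2
  simp only [Pi.sub_apply] at hx1 hx2
  linarith

end Core

end DirichletForm

namespace DirichletForm

/-! ### Locality and algebra of energy densities. -/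

section Densities

variable {X : Type*} [MetricSpace X] [ProperSpace X] [MeasurableSpace X] [BorelSpace X]
  {m : Measure X} [IsFiniteMeasureOnCompacts m] {D : DirichletForm m}
  {j : Kernel X X} [IsSFiniteKernel j] {u v u' v' f g g' k : X → ℝ}

theorem MemBdd.integrable_mul (hu : D.MemBdd u) (hg : Integrable g m) :
    Integrable (fun x => u x * g x) m := by
  obtain ⟨M, -, hM⟩ := hu.exists_bound
  exact hg.bdd_mul hu.1.memLp.1 hM

/-- Energy densities are local: they only depend on the functions up to constants. -/
theorem IsEnergyDensity.ae_eq_restrict (h : D.RegularWithJumps j) (hu : D.MemBdd u)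
    (hv : D.MemBdd v) (hu' : D.MemBdd u') (hv' : D.MemBdd v')
    (hg : D.IsEnergyDensity j u v g) (hg' : D.IsEnergyDensity j u' v' g') {G : Set X}
    (hG : IsOpen G) {c d : ℝ} (hc : ∀ᵐ x ∂m.restrict G, u' x - u x = c)
    (hd : ∀ᵐ x ∂m.restrict G, v' x - v x = d) : g' =ᵐ[m.restrict G] g := by
  refine ae_eq_of_core h.regular hG hg'.1 hg.1 fun f hf hfG => ?_
  rw [hg'.2 f hf, hg.2 f hf]
  have hfb := hf.memBdd
  -- On `supp f` strong locality discards constants in the second argument. The corrections left in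
  -- the first argument cancel those from `u'v' = uv + cv + du + cd`.
  have key : ∀ {a a' b b' : X → ℝ} {r s : ℝ}, D.MemBdd a → D.MemBdd a' → D.MemBdd b →
      D.MemBdd b' → (∀ᵐ x ∂m.restrict G, a' x - a x = r) →
      (∀ᵐ x ∂m.restrict G, b' x - b x = s) →
      D.localEnergy j (a' * f) b' = D.localEnergy j (a * f) b + r * D.localEnergy j f b := by
    intro a a' b b' r s ha ha' hb hb' hr hs
    have h1 : D.localEnergy j (a' * f) (b' - b) = 0 :=
      h.localEnergy_eq_zero hf ha' (hb'.sub hb) hG hfG hs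
    rw [h.localEnergy_sub_right hb'.1 hb.1 (ha'.mul hfb).1, sub_eq_zero] at h1
    have h2 : a' * f =ᵐ[m] a * f + r • f := by
      filter_upwards [(ae_restrict_iff' hG.measurableSet).1 hr] with x hx
      simp only [Pi.add_apply, Pi.mul_apply, Pi.smul_apply, smul_eq_mul]
      by_cases hxG : x ∈ G
      · rw [← hx hxG]; ring
      · rw [image_eq_zero_of_notMem_tsupport fun hx' => hxG (hfG hx')]; ring
    rw [h1, h.localEnergy_congr h2 .rfl,
      h.localEnergy_add_left (ha.mul hfb).1 (hf.2.2.smul r) hb.1,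
      h.localEnergy_smul_left r hf.2.2 hb.1]
  have h3 : D.localEnergy j f (u' * v' - (u * v + (c • v + d • u))) = 0 := by
    refine h.localEnergy_eq_zero_of_core hf ?_ hG hfG (c := c * d) ?_
    · exact (hu'.mul hv').sub ((hu.mul hv).add ((hv.smul c).add (hu.smul d)))
    · filter_upwards [hc, hd] with x h1 h2
      simp only [Pi.add_apply, Pi.sub_apply, Pi.mul_apply, Pi.smul_apply, smul_eq_mul]
      rw [← h1, ← h2]; ring
  have h4 := (hv.smul c).add (hu.smul d)
  rw [h.localEnergy_sub_right (hu'.mul hv').1 ((hu.mul hv).add h4).1 hf.2.2,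
    h.localEnergy_add_right (hu.mul hv).1 h4.1 hf.2.2,
    h.localEnergy_add_right (hv.smul c).1 (hu.smul d).1 hf.2.2,
    h.localEnergy_smul_right c hv.1 hf.2.2, h.localEnergy_smul_right d hu.1 hf.2.2] at h3
  rw [key hu hu' hv hv' hc hd, key hv hv' hu hu' hd hc, localEnergy_comm (u' * v') f,
    localEnergy_comm (u * v) f]
  linarith

theorem IsEnergyDensity.unique (h : D.RegularWithJumps j) (hu : D.MemBdd u) (hv : D.MemBdd v)
    (hg : D.IsEnergyDensity j u v g) (hg' : D.IsEnergyDensity j u v g') : g' =ᵐ[m] g := by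
  have := IsEnergyDensity.ae_eq_restrict h hu hv hu hv hg hg' isOpen_univ (c := 0) (d := 0)
    (ae_of_all _ fun x => sub_self _) (ae_of_all _ fun x => sub_self _)
  rwa [Measure.restrict_univ] at this

theorem IsEnergyDensity.smul (h : D.RegularWithJumps j) (hu : D.MemBdd u) (c : ℝ)
    (hg : D.IsEnergyDensity j u u g) : D.IsEnergyDensity j (c • u) (c • u) (c ^ 2 • g) := by
  refine ⟨hg.1.smul _, fun f hf => ?_⟩
  have h1 := hg.2 f hf
  have h2 : ∫ x, f x * (c ^ 2 • g) x ∂m = c ^ 2 * ∫ x, f x * g x ∂m := by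
    rw [← integral_const_mul]
    congr 1; funext x; simp only [Pi.smul_apply, smul_eq_mul]; ring
  have huf := (hu.mul hf.memBdd).1
  have h3 : c • u * f = c • (u * f) := smul_mul_assoc _ _ _
  have h4 : c • u * c • u = c ^ 2 • (u * u) := by rw [smul_mul_smul_comm, pow_two]
  rw [h2, h1, h3, h4, h.localEnergy_smul_left c huf (hu.1.smul c),
    h.localEnergy_smul_right c hu.1 huf, h.localEnergy_smul_left _ (hu.mul hu).1 hf.2.2]
  ring

/-- The parallelogram law for energy densities. -/
theorem IsEnergyDensity.parallelogram (h : D.RegularWithJumps j) (hu : D.MemBdd u)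
    (hv : D.MemBdd v) (hg : D.IsEnergyDensity j u u g) (hk : D.IsEnergyDensity j v v k)
    (hg' : D.IsEnergyDensity j (u - v) (u - v) g') :
    D.IsEnergyDensity j (u + v) (u + v) ((2 : ℝ) • g + (2 : ℝ) • k - g') := by
  refine ⟨((hg.1.smul _).add (hk.1.smul _)).sub hg'.1, fun f hf => ?_⟩
  have hi : ∀ {w : X → ℝ}, Integrable w m → Integrable (fun x => f x * w x) m :=
    fun hw => hf.memBdd.integrable_mul hw
  have h1 : ∫ x, f x * ((2 : ℝ) • g + (2 : ℝ) • k - g') x ∂m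
      = 2 * ∫ x, f x * g x ∂m + 2 * ∫ x, f x * k x ∂m - ∫ x, f x * g' x ∂m := by
    have h2 : Integrable (fun x => 2 * (f x * g x) + 2 * (f x * k x)) m :=
      ((hi hg.1).const_mul 2).add ((hi hk.1).const_mul 2)
    rw [← integral_const_mul, ← integral_const_mul,
      ← integral_add ((hi hg.1).const_mul 2) ((hi hk.1).const_mul 2), ← integral_sub h2 (hi hg'.1)]
    congr 1; funext x
    simp only [Pi.sub_apply, Pi.add_apply, Pi.smul_apply, smul_eq_mul]; ring
  have huf := (hu.mul hf.memBdd).1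
  have hvf := (hv.mul hf.memBdd).1
  have huu := (hu.mul hu).1
  have hvv := (hv.mul hv).1
  have huv := (hu.mul hv).1
  have e1 : (u + v) * (u + v) = u * u + (v * v + (2 : ℝ) • (u * v)) := by
    funext x; simp only [Pi.add_apply, Pi.mul_apply, Pi.smul_apply, smul_eq_mul]; ring
  have e2 : (u - v) * (u - v) = u * u + (v * v - (2 : ℝ) • (u * v)) := by
    funext x
    simp only [Pi.add_apply, Pi.sub_apply, Pi.mul_apply, Pi.smul_apply, smul_eq_mul]; ring
  have hp : D.localEnergy j ((u + v) * (u + v)) f = D.localEnergy j (u * u) f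
      + (D.localEnergy j (v * v) f + 2 * D.localEnergy j (u * v) f) := by
    rw [e1, h.localEnergy_add_left huu (hvv.add (huv.smul 2)) hf.2.2,
      h.localEnergy_add_left hvv (huv.smul 2) hf.2.2, h.localEnergy_smul_left 2 huv hf.2.2]
  have hm : D.localEnergy j ((u - v) * (u - v)) f = D.localEnergy j (u * u) f
      + (D.localEnergy j (v * v) f - 2 * D.localEnergy j (u * v) f) := by
    rw [e2, h.localEnergy_add_left huu (hvv.sub (huv.smul 2)) hf.2.2,
      h.localEnergy_sub_left hvv (huv.smul 2) hf.2.2, h.localEnergy_smul_left 2 huv hf.2.2]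
  have hp' : D.localEnergy j ((u + v) * f) (u + v) = D.localEnergy j (u * f) u
      + D.localEnergy j (u * f) v + (D.localEnergy j (v * f) u + D.localEnergy j (v * f) v) := by
    rw [add_mul, h.localEnergy_add_left huf hvf (hu.add hv).1,
      h.localEnergy_add_right hu.1 hv.1 huf, h.localEnergy_add_right hu.1 hv.1 hvf]
  have hm' : D.localEnergy j ((u - v) * f) (u - v) = D.localEnergy j (u * f) u
      - D.localEnergy j (u * f) v - (D.localEnergy j (v * f) u - D.localEnergy j (v * f) v) := by
    rw [sub_mul, h.localEnergy_sub_left huf hvf (hu.sub hv).1,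
      h.localEnergy_sub_right hu.1 hv.1 huf, h.localEnergy_sub_right hu.1 hv.1 hvf]
  rw [h1, hg.2 f hf, hk.2 f hf, hg'.2 f hf, hp, hm, hp', hm']
  ring

/-- The defining identity of the energy density holds for all bounded functions of the domain. -/
theorem IsEnergyDensity.integral_mul (h : D.RegularWithJumps j) (hu : D.MemBdd u)
    (hv : D.MemBdd v) (hg : D.IsEnergyDensity j u v g) (hf : D.MemBdd f) :
    ∫ x, f x * g x ∂m =
      D.localEnergy j (u * f) v + D.localEnergy j (v * f) u - D.localEnergy j (u * v) f := by
  obtain ⟨w, hw, hwf, -, ⟨M, hM⟩, hae⟩ := exists_bounded_seq_core h.regular hf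
  -- The energies converge weakly along a bounded core sequence, the integral by dominated
  -- convergence.
  have h1 := h.tendsto_localEnergy ((BoundedConvergence.const hu).mul hwf) hv.1
  have h2 := h.tendsto_localEnergy ((BoundedConvergence.const hv).mul hwf) hu.1
  have h3 := h.tendsto_localEnergy hwf (hu.mul hv).1
  have h4 := (h1.add h2).sub h3
  rw [localEnergy_comm f] at h4
  refine tendsto_nhds_unique ?_ h4
  have h5 : Tendsto (fun n => ∫ x, w n x * g x ∂m) atTop (𝓝 (∫ x, f x * g x ∂m)) := by
    refine tendsto_integral_of_dominated_convergence (fun x => M * ‖g x‖)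
      (fun n => (hw n).1.aestronglyMeasurable.mul hg.1.1) (hg.1.norm.const_mul M)
      (fun n => ae_of_all _ fun x => ?_) ?_
    · rw [norm_mul]
      exact mul_le_mul_of_nonneg_right (hM n x) (norm_nonneg _)
    · filter_upwards [hae] with x hx
      exact hx.mul_const _
  refine h5.congr fun n => ?_
  rw [hg.2 _ (hw n), localEnergy_comm (w n) (u * v)]

theorem RegularWithJumps.integrable_mul_diff (h : D.RegularWithJumps j) {a : X → ℝ}
    (ha : MemLp a ⊤ m) (hu : D.Mem u) (hv : D.Mem v) :
    Integrable (fun p => a p.1 * (diff u p * diff v p)) (jumpMeasure m j) := by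
  have hq := quasiMeasurePreserving_fst_jumpMeasure (m := m) (j := j)
  have hbd : ∃ M : ℝ, ∀ᵐ x ∂m, ‖a x‖ ≤ M := by
    refine ⟨(eLpNorm a ⊤ m).toReal, ?_⟩
    filter_upwards [ae_le_eLpNormEssSup (f := a) (μ := m)] with x hx
    rw [← eLpNorm_exponent_top] at hx
    simpa using ENNReal.toReal_mono ha.2.ne hx
  obtain ⟨M, hM⟩ := hbd
  exact (h.integrable_diff_mul hu hv).bdd_mul (ha.1.comp_quasiMeasurePreserving hq) (hq.ae hM)

/-- Integrals of the jump part of the carré du champ. -/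
theorem RegularWithJumps.integral_mul_gammaJ (h : D.RegularWithJumps j) {a : X → ℝ}
    (ha : MemLp a ⊤ m) (hu : D.Mem u) (hv : D.Mem v) :
    Integrable (fun x => a x * gammaJ j u v x) m ∧
      ∫ x, a x * gammaJ j u v x ∂m = ∫ p, a p.1 * (diff u p * diff v p) ∂(jumpMeasure m j) := by
  obtain ⟨-, h2, h3⟩ := fubini_jumpMeasure (h.integrable_mul_diff ha hu hv)
  simp only [integral_const_mul] at h2 h3
  exact ⟨h2, h3.symm⟩

theorem RegularWithJumps.integrable_gammaJ (h : D.RegularWithJumps j) (hu : D.Mem u)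
    (hv : D.Mem v) : Integrable (gammaJ j u v) m := by
  have := (h.integral_mul_gammaJ (memLp_top_const (1 : ℝ)) hu hv).1
  simpa using this

/-- Pointwise the integrand on the left is `(f(x) + f(y))(u(x) - u(y))²`, and symmetry of `J`
identifies the two summands. -/
theorem RegularWithJumps.energy_measure_jumpEnergy (h : D.RegularWithJumps j) (hu : D.MemBdd u)
    (hf : D.MemBdd f) : 2 * jumpEnergy m j (u * f) u - jumpEnergy m j (u * u) f
      = 2 * ∫ x, f x * gammaJ j u u x ∂m := by
  rw [(h.integral_mul_gammaJ hf.2 hu.1 hu.1).2]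
  have hi := h.integrable_mul_diff hf.2 hu.1 hu.1
  have hs := integral_swap_jumpMeasure h.jumps.symm (fun p => f p.1 * (diff u p * diff u p))
  have hi' := integrable_swap_jumpMeasure h.jumps.symm hi
  have h1 := h.integrable_diff_mul (hu.mul hf).1 hu.1
  have h2 := h.integrable_diff_mul (hu.mul hu).1 hf.1
  have h3 : 2 * jumpEnergy m j (u * f) u - jumpEnergy m j (u * u) f
      = ∫ p, f p.1 * (diff u p * diff u p) ∂(jumpMeasure m j)
        + ∫ p, f p.swap.1 * (diff u p.swap * diff u p.swap) ∂(jumpMeasure m j) := by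
    rw [jumpEnergy_eq, jumpEnergy_eq, ← integral_const_mul, ← integral_sub (h1.const_mul 2) h2,
      ← integral_add hi hi']
    congr 1; funext p
    simp only [diff, Pi.mul_apply, Prod.fst_swap, Prod.snd_swap]; ring
  rw [h3, hs]; ring

/-- This is the density of the energy measure of the whole form, for which `energy_measure_nonneg`
applies. -/
theorem IsEnergyDensity.add_gammaJ_nonneg (h : D.RegularWithJumps j) (hu : D.MemBdd u)
    (hg : D.IsEnergyDensity j u u g) : ∀ᵐ x ∂m, 0 ≤ g x + 2 * gammaJ j u u x := by
  have hγ := h.integrable_gammaJ hu.1 hu.1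
  have := ae_nonneg_of_core h.regular isOpen_univ (hg.1.add (hγ.const_mul 2))
    fun f hf hf0 _ => by
      have h1 := energy_measure_nonneg hu hf.memBdd (ae_of_all _ hf0)
      have h2 := h.energy_measure_jumpEnergy hu hf.memBdd
      have h3 := hg.2 f hf
      simp only [localEnergy] at h3
      have h4 : ∫ x, f x * (g + fun x => 2 * gammaJ j u u x) x ∂m
          = ∫ x, f x * g x ∂m + 2 * ∫ x, f x * gammaJ j u u x ∂m := by
        rw [← integral_const_mul, ← integral_add (hf.memBdd.integrable_mul hg.1)
          ((hf.memBdd.integrable_mul hγ).const_mul 2)]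
        congr 1; funext x; simp only [Pi.add_apply]; ring
      rw [h4]
      linarith
  rwa [Measure.restrict_univ] at this

end Densities

end DirichletForm

namespace DirichletForm

/-! ### Positivity and total mass of the local energy densities. -/

theorem abs_tent_sub_le (s t : ℝ) : |tent s - tent t| ≤ 2 * |s - t| := by
  rcases le_total s (1 / 2) with h1 | h1 <;> rcases le_total t (1 / 2) with h2 | h2
  · rw [tent_of_le h1, tent_of_le h2, ← mul_sub, abs_mul, abs_two]
  · rw [tent_of_le h1, tent_of_ge h2, abs_le]
    rw [abs_of_nonpos (by linarith)]; constructor <;> linarith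
  · rw [tent_of_ge h1, tent_of_le h2, abs_le]
    rw [abs_of_nonneg (by linarith)]; constructor <;> linarith
  · rw [tent_of_ge h1, tent_of_ge h2]
    have : 2 - 2 * s - (2 - 2 * t) = -(2 * (s - t)) := by ring
    rw [this, abs_neg, abs_mul, abs_two]

theorem abs_iterate_tent_sub_le (n : ℕ) (s t : ℝ) :
    |tent^[n] s - tent^[n] t| ≤ 2 ^ n * |s - t| := by
  induction n with
  | zero => simp
  | succ n ih =>
    rw [Function.iterate_succ_apply', Function.iterate_succ_apply', pow_succ]
    linarith [abs_tent_sub_le (tent^[n] s) (tent^[n] t)]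

theorem continuous_tent : Continuous tent := by
  unfold tent; fun_prop

/-- Off the dyadic points the iterates of the tent map are locally affine of maximal slope. -/
theorem eventually_iterate_tent_eq (n : ℕ) (t : ℝ) (ht : ∀ k : ℤ, (2 : ℝ) ^ n * t ≠ k) :
    ∃ ε c : ℝ, ε ^ 2 = 1 ∧ ∀ᶠ s in 𝓝 t, tent^[n] s = ε * (2 ^ n * s) + c := by
  induction n generalizing t with
  | zero => exact ⟨1, 0, by norm_num, Eventually.of_forall fun s => by simp⟩
  | succ n ih =>
    have hne : t ≠ 1 / 2 := by
      intro h
      refine ht (2 ^ n) ?_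
      rw [h, pow_succ]; push_cast; ring
    rcases lt_or_gt_of_ne hne with hlt | hgt
    · obtain ⟨ε, c, hε, hev⟩ := ih (tent t) fun k hk => ht k (by
        rw [← hk, tent_of_le hlt.le, pow_succ]; ring)
      refine ⟨ε, c, hε, ?_⟩
      filter_upwards [continuous_tent.continuousAt.eventually hev, eventually_lt_nhds hlt]
        with s h1 h2
      rw [Function.iterate_succ_apply, h1, tent_of_le h2.le, pow_succ]; ring
    · obtain ⟨ε, c, hε, hev⟩ := ih (tent t) fun k hk => ht (2 * 2 ^ n - k) (by
        push_cast
        rw [← hk, tent_of_ge hgt.le, pow_succ]; ring)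
      refine ⟨-ε, c + 2 * ε * 2 ^ n, by rw [neg_sq, hε], ?_⟩
      filter_upwards [continuous_tent.continuousAt.eventually hev, eventually_gt_nhds hgt]
        with s h1 h2
      rw [Function.iterate_succ_apply, h1, tent_of_ge h2.le, pow_succ]; ring

section Positivity

variable {X : Type*} [MetricSpace X] [ProperSpace X] [MeasurableSpace X] [BorelSpace X]
  {m : Measure X} [IsFiniteMeasureOnCompacts m] {D : DirichletForm m}
  {j : Kernel X X} [IsSFiniteKernel j] {u v u' v' f g g' k : X → ℝ}

/-- The sawtooth function of slope `±1` and height `2⁻ⁿ`, applied to `v`. -/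
noncomputable def sawtooth (n : ℕ) (v : X → ℝ) : X → ℝ :=
  ((1 / 2 : ℝ) ^ n) • fun x => tent^[n] (v x)

theorem abs_sawtooth_sub_le (n : ℕ) (v : X → ℝ) (x y : X) :
    |sawtooth n v x - sawtooth n v y| ≤ |v x - v y| := by
  simp only [sawtooth, Pi.smul_apply, smul_eq_mul]
  rw [← mul_sub, abs_mul, abs_of_nonneg (by positivity)]
  calc (1 / 2 : ℝ) ^ n * |tent^[n] (v x) - tent^[n] (v y)|
      ≤ (1 / 2 : ℝ) ^ n * (2 ^ n * |v x - v y|) := by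
        gcongr; exact abs_iterate_tent_sub_le _ _ _
    _ = |v x - v y| := by rw [← mul_assoc, ← mul_pow]; norm_num

theorem sawtooth_mem_Icc (n : ℕ) (hv : ∀ x, v x ∈ Icc (0 : ℝ) 1) (x : X) :
    sawtooth n v x ∈ Icc 0 ((1 / 2 : ℝ) ^ n) := by
  have := iterate_tent_mem_Icc (hv x) n
  simp only [sawtooth, Pi.smul_apply, smul_eq_mul]
  exact ⟨mul_nonneg (by positivity) this.1, mul_le_of_le_one_right (by positivity) this.2⟩

theorem continuous_sawtooth (n : ℕ) (hv : Continuous v) : Continuous (sawtooth n v) :=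
  ((continuous_tent.iterate n).comp hv).const_smul _

/-- The jump part of the carré du champ of fine sawtooth functions is small. -/
theorem tendsto_gammaJ_sawtooth (h : D.RegularWithJumps j) (hv : D.MemBdd v) (hvc : Continuous v)
    (hvI : ∀ x, v x ∈ Icc (0 : ℝ) 1) :
    ∀ᵐ x ∂m, Tendsto (fun n => gammaJ j (sawtooth n v) (sawtooth n v) x) atTop (𝓝 0) := by
  filter_upwards [(fubini_jumpMeasure (h.integrable_diff_mul hv.1 hv.1)).1] with x hx
  have h0 : Tendsto (fun n => gammaJ j (sawtooth n v) (sawtooth n v) x) atTop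
      (𝓝 (∫ y in ({x}ᶜ : Set X), (0 : ℝ) ∂(j x))) := by
    refine tendsto_integral_of_dominated_convergence (fun y => diff v (x, y) * diff v (x, y))
      (fun n => ?_) hx (fun n => ae_of_all _ fun y => ?_) (ae_of_all _ fun y => ?_)
    · have := continuous_sawtooth n hvc
      exact Continuous.aestronglyMeasurable (by fun_prop)
    · rw [Real.norm_eq_abs, abs_mul, diff, ← abs_mul_abs_self (v x - v y)]
      have := abs_sawtooth_sub_le n v x y
      gcongr
    · have hz : ∀ z, Tendsto (fun n => sawtooth n v z) atTop (𝓝 0) := fun z =>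
        squeeze_zero (fun n => (sawtooth_mem_Icc n hvI z).1) (fun n => (sawtooth_mem_Icc n hvI z).2)
          (tendsto_pow_atTop_nhds_zero_of_lt_one (by norm_num) (by norm_num))
      have h1 := (hz x).sub (hz y)
      have h2 := h1.mul h1
      simpa using h2
  simpa using h0

/-- Positivity of the energy density off the dyadic levels of a continuous function. -/
theorem IsEnergyDensity.nonneg_off_dyadic (h : D.RegularWithJumps j) (hac : D.HasEnergyDensities j)
    (hv : D.MemBdd v) (hvc : Continuous v) (hvI : ∀ x, v x ∈ Icc (0 : ℝ) 1)
    (hg : D.IsEnergyDensity j v v g) :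
    ∀ᵐ x ∂m, (∀ (n : ℕ) (k : ℤ), (2 : ℝ) ^ n * v x ≠ k) → 0 ≤ g x := by
  have hs : ∀ n, D.MemBdd (sawtooth n v) := fun n =>
    (hv.iterate_tent (ae_of_all _ hvI) n).smul _
  choose γ hγ using fun n => hac _ _ (hs n) (hs n)
  -- Near such a point the sawtooth is `±v` plus a constant, so by locality it has the density of
  -- `v`. Positivity of the full density for each sawtooth then becomes `0 ≤ g` as its jump part
  -- vanishes.
  have hloc : ∀ n, ∀ᵐ x ∂m, (∀ k : ℤ, (2 : ℝ) ^ n * v x ≠ k) → γ n x = g x := by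
    intro n
    rw [ae_iff]
    refine measure_null_of_locally_null _ fun x hx => ?_
    have hx' : ∀ k : ℤ, (2 : ℝ) ^ n * v x ≠ k := by
      by_contra hcon
      exact hx fun h => absurd h hcon
    obtain ⟨ε, c, hε, hev⟩ := eventually_iterate_tent_eq n (v x) hx'
    obtain ⟨U, hU, hUo, hxU⟩ := eventually_nhds_iff.1 (hvc.continuousAt.eventually hev)
    have hεv := hg.smul h hv ε
    rw [hε, one_smul] at hεv
    have heq := IsEnergyDensity.ae_eq_restrict h (hv.smul ε) (hv.smul ε) (hs n) (hs n) hεv (hγ n)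
      hUo (c := (1 / 2 : ℝ) ^ n * c) (d := (1 / 2 : ℝ) ^ n * c)
    have hcst : ∀ᵐ x ∂m.restrict U, sawtooth n v x - (ε • v) x = (1 / 2 : ℝ) ^ n * c := by
      filter_upwards [ae_restrict_mem hUo.measurableSet] with y hy
      simp only [sawtooth, Pi.smul_apply, smul_eq_mul]
      rw [hU y hy, mul_add, mul_left_comm, ← mul_assoc ((1 / 2 : ℝ) ^ n), ← mul_pow]
      norm_num
    have h2 := (ae_restrict_iff' hUo.measurableSet).1 (heq hcst hcst)
    refine ⟨_, inter_mem_nhdsWithin _ (hUo.mem_nhds hxU), ?_⟩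
    refine measure_mono_null ?_ (ae_iff.1 h2)
    rintro y ⟨hy1, hy2⟩ hy3
    exact hy1 fun _ => hy3 hy2
  filter_upwards [ae_all_iff.2 hloc, ae_all_iff.2 fun n => (hγ n).add_gammaJ_nonneg h (hs n),
    tendsto_gammaJ_sawtooth h hv hvc hvI] with x h1 h2 h3 hx
  have h4 : Tendsto (fun n => g x + 2 * gammaJ j (sawtooth n v) (sawtooth n v) x) atTop
      (𝓝 (g x + 2 * 0)) := (h3.const_mul 2).const_add _
  rw [mul_zero, add_zero] at h4
  refine ge_of_tendsto' h4 fun n => ?_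
  rw [← h1 n (hx n)]
  exact h2 n

/-- If `a` and `a + 1/3` were both dyadic, so would be `1/3`, and 3 would divide a power of 2. -/
theorem forall_ne_int_or (a : ℝ) : (∀ (n : ℕ) (k : ℤ), (2 : ℝ) ^ n * a ≠ k) ∨
    ∀ (n : ℕ) (k : ℤ), (2 : ℝ) ^ n * (a + 1 / 3) ≠ k := by
  by_contra! hcon
  obtain ⟨⟨n, k, hk⟩, n', k', hk'⟩ := hcon
  have h1 : (2 : ℝ) ^ (n + n') = 3 * (2 ^ n * k' - 2 ^ n' * k) := by
    rw [← hk, ← hk', pow_add]; ring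
  have h2 : (2 : ℤ) ^ (n + n') = 3 * (2 ^ n * k' - 2 ^ n' * k) := by exact_mod_cast h1
  have h3 : (3 : ℤ) ∣ 2 ^ (n + n') := ⟨_, h2⟩
  have h4 := Int.Prime.dvd_pow' Nat.prime_three h3
  norm_num at h4

/-- On a ball, two core functions `w` and `w'` with values in `[0, 1]` differ from a multiple of `u`
by constants, and from each other by `1/3`. Each point of the ball is off the dyadic levels of at
least one, and both have locally the density of that multiple. -/
theorem IsEnergyDensity.nonneg_of_core (h : D.RegularWithJumps j) (hac : D.HasEnergyDensities j)
    (hu : D.MemCore u) (hg : D.IsEnergyDensity j u u g) : ∀ᵐ x ∂m, 0 ≤ g x := by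
  obtain ⟨M, hM, hub⟩ := hu.exists_bound
  rw [ae_iff]
  refine measure_null_of_locally_null _ fun x0 _ => ?_
  set G := Metric.ball x0 1 with hGdef
  have hG : IsOpen G := Metric.isOpen_ball
  obtain ⟨χ, hχ, hχI, -, V, -, hKV, hχV⟩ :=
    exists_cutoff h.regular (isCompact_closedBall x0 1) isOpen_univ (subset_univ _)
  have hχG : ∀ x ∈ G, χ x = 1 := fun x hx => hχV x (hKV (Metric.ball_subset_closedBall hx))
  -- This scale puts `w` in `[0, 1/2]`, leaving room for the shift by `1/3`.
  set a : ℝ := 1 / (4 * M) with ha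
  have ha0 : 0 < a := by positivity
  have haM : a * M = 1 / 4 := by rw [ha]; field_simp
  set w : X → ℝ := a • fun x => max 0 ((u + M • χ) x) with hw
  have hwc : D.MemCore w := ((hu.add (hχ.smul M)).posPart).smul a
  set w' : X → ℝ := w + (1 / 3 : ℝ) • χ with hw'
  have hwc' : D.MemCore w' := hwc.add (hχ.smul _)
  have hwI : ∀ x, w x ∈ Icc (0 : ℝ) (1 / 2) := fun x => by
    simp only [hw, Pi.smul_apply, Pi.add_apply, smul_eq_mul]
    refine ⟨by positivity, ?_⟩
    have h1 : max 0 (u x + M * χ x) ≤ 2 * M :=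
      max_le (by positivity) (by nlinarith [le_of_abs_le (hub x), (hχI x).2])
    nlinarith
  have hwI1 : ∀ x, w x ∈ Icc (0 : ℝ) 1 := fun x => ⟨(hwI x).1, by linarith [(hwI x).2]⟩
  have hwI' : ∀ x, w' x ∈ Icc (0 : ℝ) 1 := fun x => by
    simp only [hw', Pi.smul_apply, Pi.add_apply, smul_eq_mul]
    constructor <;> linarith [(hwI x).1, (hwI x).2, (hχI x).1, (hχI x).2]
  have hwG : ∀ x ∈ G, w x - (a • u) x = 1 / 4 := fun x hx => by
    simp only [hw, Pi.smul_apply, Pi.add_apply, smul_eq_mul]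
    rw [hχG x hx, max_eq_right (by linarith [neg_le_of_abs_le (hub x)]), ← haM]; ring
  have hwG' : ∀ x ∈ G, w' x - (a • u) x = 1 / 4 + 1 / 3 := fun x hx => by
    simp only [hw', Pi.smul_apply, Pi.add_apply, smul_eq_mul]
    rw [hχG x hx, ← hwG x hx]; simp only [Pi.smul_apply, smul_eq_mul]; ring
  obtain ⟨γ, hγ⟩ := hac _ _ hwc.memBdd hwc.memBdd
  obtain ⟨γ', hγ'⟩ := hac _ _ hwc'.memBdd hwc'.memBdd
  have hau := hg.smul h hu.memBdd a
  have hau' := hu.memBdd.smul a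
  have h1 := IsEnergyDensity.ae_eq_restrict h hau' hau' hwc.memBdd hwc.memBdd hau hγ hG
    ((ae_restrict_mem hG.measurableSet).mono hwG) ((ae_restrict_mem hG.measurableSet).mono hwG)
  have h2 := IsEnergyDensity.ae_eq_restrict h hau' hau' hwc'.memBdd hwc'.memBdd hau hγ' hG
    ((ae_restrict_mem hG.measurableSet).mono hwG') ((ae_restrict_mem hG.measurableSet).mono hwG')
  have h3 := hγ.nonneg_off_dyadic h hac hwc.memBdd hwc.1 hwI1
  have h4 := hγ'.nonneg_off_dyadic h hac hwc'.memBdd hwc'.1 hwI'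
  have h5 : ∀ᵐ x ∂m, x ∈ G → 0 ≤ g x := by
    filter_upwards [(ae_restrict_iff' hG.measurableSet).1 h1,
      (ae_restrict_iff' hG.measurableSet).1 h2, h3, h4] with x e1 e2 e3 e4 hxG
    have hpos : 0 ≤ (a ^ 2 • g) x := by
      rcases forall_ne_int_or (w x) with hn | hn
      · rw [← e1 hxG]; exact e3 hn
      · rw [← e2 hxG]
        refine e4 ?_
        have : w' x = w x + 1 / 3 := by
          simp only [hw', Pi.smul_apply, Pi.add_apply, smul_eq_mul]
          rw [hχG x hxG, mul_one]
        rwa [this]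
    simp only [Pi.smul_apply, smul_eq_mul] at hpos
    exact nonneg_of_mul_nonneg_right hpos (by positivity)
  refine ⟨_, inter_mem_nhdsWithin _ (hG.mem_nhds (Metric.mem_ball_self one_pos)), ?_⟩
  refine measure_mono_null ?_ (ae_iff.1 h5)
  rintro y ⟨hy1, hy2⟩ hy3
  exact hy1 (hy3 hy2)

/-- Continuity of the energy measure along sequences converging in energy. -/
theorem tendsto_energy_measure (h : D.RegularWithJumps j) {w : ℕ → X → ℝ}
    (hw : D.BoundedConvergence w u)
    (he : Tendsto (fun n => D.energy (w n - u) (w n - u)) atTop (𝓝 0)) (hf : D.MemBdd f) :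
    Tendsto (fun n => D.localEnergy j (w n * f) (w n) + D.localEnergy j (w n * f) (w n)
        - D.localEnergy j (w n * w n) f) atTop
      (𝓝 (D.localEnergy j (u * f) u + D.localEnergy j (u * f) u - D.localEnergy j (u * u) f)) := by
  have hwf := hw.mul (BoundedConvergence.const hf)
  have h1 := h.tendsto_localEnergy hwf hw.limit.1
  have h2 := h.tendsto_localEnergy (hw.mul hw) hf.1
  -- Both arguments of `E^(c)(w n * f, w n)` vary, so weak convergence is not enough; strong
  -- convergence in energy disposes of this remainder.
  have h3 : Tendsto (fun n => D.localEnergy j (w n * f) (w n - u)) atTop (𝓝 0) := by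
    obtain ⟨C, hC⟩ := hwf.energy_le
    have h4 := (he.const_mul C).sqrt
    rw [mul_zero, Real.sqrt_zero] at h4
    refine squeeze_zero_norm (fun n => ?_) h4
    rw [Real.norm_eq_abs]
    have hd := (hw.mem n).sub hw.limit.1
    refine Real.abs_le_sqrt ((h.localEnergy_sq_le (hwf.mem n) hd).trans ?_)
    exact mul_le_mul ((localEnergy_self_le _).trans (hC n)) (localEnergy_self_le _)
      (h.localEnergy_self_nonneg hd) ((energy_self_nonneg _).trans (hC n))
  have h5 := h1.add h3
  rw [add_zero] at h5
  have h6 : Tendsto (fun n => D.localEnergy j (w n * f) (w n)) atTop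
      (𝓝 (D.localEnergy j (u * f) u)) := by
    refine h5.congr fun n => ?_
    rw [h.localEnergy_sub_right (hw.mem n) hw.limit.1 (hwf.mem n)]; ring
  exact (h6.add h6).sub h2

theorem exists_exhausting_cutoffs (hreg : D.IsRegular) {K : Set X} (hK : IsCompact K) :
    ∃ χ : ℕ → X → ℝ, (∀ n, D.MemCore (χ n)) ∧ (∀ n x, χ n x ∈ Icc (0 : ℝ) 1) ∧
      (∀ n, ∃ V, IsOpen V ∧ K ⊆ V ∧ ∀ x ∈ V, χ n x = 1) ∧
      ∀ g : X → ℝ, Integrable g m →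
        Tendsto (fun n => ∫ x, χ n x * g x ∂m) atTop (𝓝 (∫ x, g x ∂m)) := by
  choose χ hχ hχI _ V hV hKV hχV using fun n : ℕ => exists_cutoff (D := D) hreg
    (hK.union (isCompact_compactCovering X n)) isOpen_univ (subset_univ _)
  refine ⟨χ, hχ, hχI, fun n => ⟨V n, hV n, subset_union_left.trans (hKV n), hχV n⟩,
    fun g hg => ?_⟩
  refine tendsto_integral_of_dominated_convergence (fun x => ‖g x‖)
    (fun n => (hχ n).1.aestronglyMeasurable.mul hg.1) hg.norm (fun n => ae_of_all _ fun x => ?_)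
    (ae_of_all _ fun x => ?_)
  · rw [norm_mul]
    refine mul_le_of_le_one_left (norm_nonneg _) ?_
    rw [Real.norm_eq_abs, abs_of_nonneg (hχI n x).1]
    exact (hχI n x).2
  · obtain ⟨N, hN⟩ := exists_mem_compactCovering x
    refine tendsto_const_nhds.congr' ?_
    filter_upwards [eventually_ge_atTop N] with n hn
    rw [hχV n x (hKV n (Or.inr (compactCovering_subset X hn hN))), one_mul]

/-- For a cutoff `χ` equal to 1 near `supp u` one has `uχ = u`, and `E^(c)(u², χ) = 0` by strong
locality. -/
theorem IsEnergyDensity.integral_of_core (h : D.RegularWithJumps j) (hu : D.MemCore u)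
    (hg : D.IsEnergyDensity j u u g) : ∫ x, g x ∂m = 2 * D.localEnergy j u u := by
  obtain ⟨χ, hχ, -, hχV, hlim⟩ := exists_exhausting_cutoffs (D := D) h.regular hu.2.1.isCompact
  refine tendsto_nhds_unique (hlim g hg.1) (tendsto_const_nhds.congr fun n => ?_)
  obtain ⟨V, hV, hKV, h1⟩ := hχV n
  have h2 : u * χ n = u := by
    funext x
    rw [Pi.mul_apply]
    by_cases hx : x ∈ tsupport u
    · rw [h1 x (hKV hx), mul_one]
    · rw [image_eq_zero_of_notMem_tsupport hx, zero_mul]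
  have h3 : D.localEnergy j (u * u) (χ n) = 0 :=
    h.jumps.stronglyLocal _ _ (hu.mul hu) (hχ n)
      ⟨1, V, hV, tsupport_mul_subset_left.trans hKV, h1⟩
  rw [hg.2 _ (hχ n), h2, h3]; ring

/-- The total mass of the energy measure of the strongly local part. -/
theorem IsEnergyDensity.integral_eq (h : D.RegularWithJumps j) (hac : D.HasEnergyDensities j)
    (hu : D.MemBdd u) (hg : D.IsEnergyDensity j u u g) :
    ∫ x, g x ∂m = 2 * D.localEnergy j u u := by
  -- Mass may be lost when core functions approximate `u`, but positivity bounds each tested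
  -- integral `∫ χ γ` by the full mass `2 E^(c)(w k, w k)`.
  have hle : ∀ {u g : X → ℝ}, D.MemBdd u → D.IsEnergyDensity j u u g →
      ∫ x, g x ∂m ≤ 2 * D.localEnergy j u u := by
    intro u g hu hg
    obtain ⟨χ, hχ, hχI, -, hlim⟩ := exists_exhausting_cutoffs (D := D) h.regular isCompact_empty
    refine le_of_tendsto' (hlim g hg.1) fun n => ?_
    obtain ⟨w, hw, hwu, hwe, -⟩ := exists_bounded_seq_core h.regular hu
    choose γ hγ using fun k => hac _ _ (hw k).memBdd (hw k).memBdd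
    rw [hg.2 _ (hχ n)]
    have h1 := tendsto_energy_measure h hwu hwe (hχ n).memBdd
    have h2 : Tendsto (fun k => 2 * (D.energy (w k) (w k) + 0)) atTop
        (𝓝 (2 * (D.energy u u + 0))) :=
      ((tendsto_energy_self hwu.mem hu.1 hwe).add_const _).const_mul 2
    have h3 : Tendsto (fun k => D.localEnergy j (w k) (w k)) atTop (𝓝 (D.localEnergy j u u)) := by
      have h4 := h.tendsto_localEnergy hwu hu.1
      have h5 : Tendsto (fun k => D.localEnergy j (w k - u) (w k - u)) atTop (𝓝 0) :=
        squeeze_zero (fun k => h.localEnergy_self_nonneg ((hwu.mem k).sub hu.1))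
          (fun k => localEnergy_self_le _) hwe
      have h6 := (h5.add (h4.const_mul 2)).sub_const (D.localEnergy j u u)
      rw [show 0 + 2 * D.localEnergy j u u - D.localEnergy j u u = D.localEnergy j u u by ring]
        at h6
      refine h6.congr fun k => ?_
      rw [h.localEnergy_sub_left (hwu.mem k) hu.1 ((hwu.mem k).sub hu.1),
        h.localEnergy_sub_right (hwu.mem k) hu.1 (hwu.mem k),
        h.localEnergy_sub_right (hwu.mem k) hu.1 hu.1, localEnergy_comm u (w k)]
      ring
    refine le_of_tendsto_of_tendsto' h1 (h3.const_mul 2) fun k => ?_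
    rw [← (hγ k).2 _ (hχ n), ← (hγ k).integral_of_core h (hw k)]
    refine integral_mono_ae ((hχ n).memBdd.integrable_mul (hγ k).1) (hγ k).1 ?_
    filter_upwards [(hγ k).nonneg_of_core h hac (hw k)] with x hx
    exact mul_le_of_le_one_left hx (hχI n x).2
  refine le_antisymm (hle hu hg) ?_
  obtain ⟨w, hw, hwu, hwe, -⟩ := exists_bounded_seq_core h.regular hu
  -- For the reverse inequality put `d = u - w k`. The parallelogram laws for the densities and for
  -- `E^(c)`, with `hle` for `d - w k` and `∫ γd ≥ 0`, give `2 E^(c)(u,u) ≤ ∫ g + 4 E^(c)(d,d)`.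
  have h0 : Tendsto (fun k => 4 * D.energy (w k - u) (w k - u) + ∫ x, g x ∂m) atTop
      (𝓝 (4 * 0 + ∫ x, g x ∂m)) := (hwe.const_mul 4).add_const _
  rw [mul_zero, zero_add] at h0
  refine ge_of_tendsto' h0 fun k => ?_
  have hd := hu.sub (hw k).memBdd
  have hd' := hd.sub (hw k).memBdd
  obtain ⟨γ, hγ⟩ := hac _ _ (hw k).memBdd (hw k).memBdd
  obtain ⟨γd, hγd⟩ := hac _ _ hd hd
  obtain ⟨γ', hγ'⟩ := hac _ _ hd' hd'
  have hp := hγd.parallelogram h hd (hw k).memBdd hγ hγ'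
  rw [sub_add_cancel] at hp
  have hp1 := integral_congr_ae (IsEnergyDensity.unique h hu hu hg hp)
  have hp2 : ∫ x, ((2 : ℝ) • γd + (2 : ℝ) • γ - γ') x ∂m
      = 2 * ∫ x, γd x ∂m + 2 * ∫ x, γ x ∂m - ∫ x, γ' x ∂m := by
    have hi : Integrable (fun x => 2 * γd x + 2 * γ x) m :=
      (hγd.1.const_mul 2).add (hγ.1.const_mul 2)
    rw [← integral_const_mul, ← integral_const_mul,
      ← integral_add (hγd.1.const_mul 2) (hγ.1.const_mul 2), ← integral_sub hi hγ'.1]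
    rfl
  have hw2 := hγ.integral_of_core h (hw k)
  have h1 := hle hd' hγ'
  have hγd0 : 0 ≤ ∫ x, γd x ∂m := by
    obtain ⟨y, hy, hyd, hye, -⟩ := exists_bounded_seq_core h.regular hd
    obtain ⟨χ, hχ, hχI, -, hlim⟩ := exists_exhausting_cutoffs (D := D) h.regular isCompact_empty
    refine ge_of_tendsto' (hlim γd hγd.1) fun n => ?_
    choose β hβ using fun i => hac _ _ (hy i).memBdd (hy i).memBdd
    rw [hγd.2 _ (hχ n)]
    refine ge_of_tendsto' (tendsto_energy_measure h hyd hye (hχ n).memBdd) fun i => ?_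
    rw [← (hβ i).2 _ (hχ n)]
    refine integral_nonneg_of_ae ?_
    filter_upwards [(hβ i).nonneg_of_core h hac (hy i)] with x hx
    exact mul_nonneg (hχI n x).1 hx
  have e1 : D.localEnergy j (u - w k) (u - w k) ≤ D.energy (w k - u) (w k - u) := by
    refine (localEnergy_self_le _).trans_eq ?_
    rw [← neg_sub, energy_neg_self ((hw k).2.2.sub hu.1)]
  have e2 : D.localEnergy j (u - w k - w k) (u - w k - w k) + D.localEnergy j u u
      = 2 * D.localEnergy j (u - w k) (u - w k) + 2 * D.localEnergy j (w k) (w k) := by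
    have hu1 := hu.1
    have hwk := (hw k).2.2
    have hd1 := hd.1
    rw [h.localEnergy_sub_left hd1 hwk (hd1.sub hwk), h.localEnergy_sub_right hd1 hwk hd1,
      h.localEnergy_sub_right hd1 hwk hwk, h.localEnergy_sub_left hu1 hwk hd1,
      h.localEnergy_sub_right hu1 hwk hu1, h.localEnergy_sub_right hu1 hwk hwk,
      h.localEnergy_sub_left hu1 hwk hwk, localEnergy_comm (w k) u]
    ring
  have hp1' : ∫ x, ((2 : ℝ) • γd + (2 : ℝ) • γ - γ') x ∂m = ∫ x, g x ∂m := hp1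
  linarith

end Positivity

end DirichletForm

namespace DirichletForm

/-! ### The product rule. -/

section ProductRule

variable {X : Type*} [MetricSpace X] [ProperSpace X] [MeasurableSpace X] [BorelSpace X]
  {m : Measure X} [IsFiniteMeasureOnCompacts m] {D : DirichletForm m}
  {j : Kernel X X} [IsSFiniteKernel j] {u v u' v' f g g' k φ ψ : X → ℝ}

/-- A bounded local function that is constant outside a compact set differs from a constant by a
bounded function of the domain. -/
theorem MemLoc.exists_memBdd (hreg : D.IsRegular) (hφ : D.MemLoc φ) (hφb : MemLp φ ⊤ m)
    {K : Set X} {c : ℝ} (hK : IsCompact K) (hc : ∀ᵐ x ∂m, x ∉ K → φ x = c) :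
    ∃ ψ, D.MemBdd ψ ∧ φ =ᵐ[m] fun x => ψ x + c := by
  obtain ⟨L, hL, hKL, -⟩ := exists_compact_between hK isOpen_univ (subset_univ K)
  obtain ⟨w, hw, hφw⟩ := hφ.2 (interior L) isOpen_interior
    (hL.of_isClosed_subset isClosed_closure (closure_minimal interior_subset hL.isClosed))
  obtain ⟨χ, hχ, -, hχL, V, -, hKV, hχV⟩ := exists_cutoff hreg hK isOpen_interior hKL
  have hbd : ∃ M : ℝ, 0 < M ∧ ∀ᵐ x ∂m, |φ x| ≤ M := by
    refine ⟨(eLpNorm φ ⊤ m).toReal + 1, by positivity, ?_⟩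
    filter_upwards [ae_le_eLpNormEssSup (f := φ) (μ := m)] with x hx
    rw [← eLpNorm_exponent_top] at hx
    have := ENNReal.toReal_mono hφb.2.ne hx
    rw [toReal_enorm, Real.norm_eq_abs] at this
    linarith
  obtain ⟨M, hM, hφM⟩ := hbd
  -- `w` may be unbounded, so its truncation to `[-M, M]` is taken as a difference of two clamps.
  have hT := (hw.clamp hM).1.sub (hw.neg.clamp hM).1
  set T : X → ℝ := (fun x => min (max 0 (w x)) M) - fun x => min (max 0 ((-w) x)) M with hTdef
  have hTb : D.MemBdd T := hT.memBdd (M := M) (ae_of_all _ fun x => by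
    simp only [hTdef, Pi.sub_apply]
    have h1 : 0 ≤ min (max 0 (w x)) M := le_min (le_max_left _ _) hM.le
    have h2 : 0 ≤ min (max 0 ((-w) x)) M := le_min (le_max_left _ _) hM.le
    exact abs_le.2 ⟨by linarith [min_le_right (max 0 ((-w) x)) M],
      by linarith [min_le_right (max 0 (w x)) M]⟩)
  have hTw : ∀ x, |w x| ≤ M → T x = w x := fun x hx => by
    simp only [hTdef, Pi.sub_apply, Pi.neg_apply]
    rw [min_eq_left (max_le hM.le (le_of_abs_le hx)),
      min_eq_left (max_le hM.le (by linarith [neg_le_of_abs_le hx]))]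
    rcases le_total 0 (w x) with h | h
    · rw [max_eq_right h, max_eq_left (neg_nonpos.2 h), sub_zero]
    · rw [max_eq_left h, max_eq_right (neg_nonneg.2 h)]; ring
  -- This is `(φ - c)χ` in disguise: `χ = 1` on `K`, and `φ = c` elsewhere.
  refine ⟨T * χ - c • χ, (hTb.mul hχ.memBdd).sub (hχ.memBdd.smul c), ?_⟩
  filter_upwards [hφM, hc, (ae_restrict_iff' isOpen_interior.measurableSet).1 hφw] with x h1 h2 h3
  simp only [Pi.sub_apply, Pi.mul_apply, Pi.smul_apply, smul_eq_mul]
  by_cases hxL : x ∈ interior L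
  · rw [hTw x (by rwa [← h3 hxL]), ← h3 hxL]
    by_cases hxK : x ∈ K
    · rw [hχV x (hKV hxK)]; ring
    · rw [h2 hxK]; ring
  · rw [image_eq_zero_of_notMem_tsupport fun h => hxL (hχL h), h2 fun h => hxL (hKL h)]; ring

/-- The density `Γ^(c)(u, φ)` when `φ` differs from a function of the domain by a constant. -/
theorem gammaC_ae_eq (h : D.RegularWithJumps j) (hac : D.HasEnergyDensities j) (hu : D.MemBdd u)
    (hψ : D.MemBdd ψ) {c : ℝ} (hφ : φ =ᵐ[m] fun x => ψ x + c) (hg : D.IsEnergyDensity j u ψ g) :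
    D.gammaC j u φ =ᵐ[m] g := by
  have hloc : D.IsLocalEnergyDensity j u φ g := by
    refine ⟨hg.1.1, fun G hG _ w₁ w₂ k hw₁ hw₂ hu₁ hφ₂ hk => ?_⟩
    refine (IsEnergyDensity.ae_eq_restrict h hu hψ hw₁ hw₂ hg hk hG (c := 0) (d := c) ?_ ?_).symm
    · filter_upwards [hu₁] with x hx
      rw [hx, sub_self]
    · filter_upwards [hφ₂, ae_restrict_of_ae hφ] with x h1 h2
      rw [← h1, h2, add_sub_cancel_left]
  have hex : ∃ g, D.IsLocalEnergyDensity j u φ g := ⟨g, hloc⟩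
  rw [gammaC, dif_pos hex]
  set γ := hex.choose
  have hγ : D.IsLocalEnergyDensity j u φ γ := hex.choose_spec
  change ∀ᵐ x ∂m, γ x = g x
  -- `gammaC` is an arbitrary choice among local densities, so it is compared with `g` on unit
  -- balls, where `φ` agrees with `ψ + c • χ`, an element of `F ∩ L^∞`.
  rw [ae_iff]
  refine measure_null_of_locally_null _ fun x0 _ => ?_
  set G := Metric.ball x0 1
  have hG : IsOpen G := Metric.isOpen_ball
  obtain ⟨χ, hχ, -, -, V, -, hKV, hχV⟩ :=
    exists_cutoff h.regular (isCompact_closedBall x0 1) isOpen_univ (subset_univ _)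
  have hw := hψ.add (hχ.memBdd.smul c)
  obtain ⟨k, hk⟩ := hac _ _ hu hw
  have hGc : IsCompact (closure G) := (isCompact_closedBall x0 1).of_isClosed_subset
    isClosed_closure Metric.closure_ball_subset_closedBall
  have hφw : φ =ᵐ[m.restrict G] ψ + c • χ := by
    filter_upwards [ae_restrict_of_ae hφ, ae_restrict_mem hG.measurableSet] with x h1 h2
    simp only [Pi.add_apply, Pi.smul_apply, smul_eq_mul]
    rw [h1, hχV x (hKV (Metric.ball_subset_closedBall h2)), mul_one]
  have h1 := (hγ.2 G hG hGc _ _ _ hu hw .rfl hφw hk).trans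
    (hloc.2 G hG hGc _ _ _ hu hw .rfl hφw hk).symm
  have h2 := (ae_restrict_iff' hG.measurableSet).1 h1
  refine ⟨_, inter_mem_nhdsWithin _ (hG.mem_nhds (Metric.mem_ball_self one_pos)), ?_⟩
  refine measure_mono_null ?_ (ae_iff.1 h2)
  rintro y ⟨hy1, hy2⟩ hy3
  exact hy1 (hy3 hy2)

/-- The product rule for the strongly local part. -/
theorem two_mul_localEnergy_mul (h : D.RegularWithJumps j) (hu : D.MemBdd u) (hψ : D.MemBdd ψ)
    (hg : D.IsEnergyDensity j u ψ g) (hk : D.IsEnergyDensity j u u k) :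
    2 * D.localEnergy j u (u * ψ) = ∫ x, u x * g x ∂m + ∫ x, ψ x * k x ∂m := by
  -- The terms `E^(c)(u², ψ)` cancel and two copies of `E^(c)(uψ, u)` remain.
  rw [hg.integral_mul h hu hψ hu, hk.integral_mul h hu hu hψ, mul_comm ψ u,
    localEnergy_comm u (u * ψ)]
  ring

/-- The product rule for the jump part. -/
theorem RegularWithJumps.jumpEnergy_mul (h : D.RegularWithJumps j) (hu : D.MemBdd u)
    (hψ : D.MemBdd ψ) : jumpEnergy m j u (u * ψ)
      = ∫ x, u x * gammaJ j u ψ x ∂m + ∫ x, ψ x * gammaJ j u u x ∂m := by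
  rw [(h.integral_mul_gammaJ hu.2 hu.1 hψ.1).2, (h.integral_mul_gammaJ hψ.2 hu.1 hu.1).2]
  have h1 := h.integrable_mul_diff hu.2 hu.1 hψ.1
  have h2 := h.integrable_mul_diff hψ.2 hu.1 hu.1
  rw [← integral_add h1 h2]
  -- Symmetrizing, `F(x,y) + F(y,x) = 2(u(x) - u(y))((uψ)(x) - (uψ)(y))`.
  set F : X × X → ℝ := fun p => u p.1 * (diff u p * diff ψ p) + ψ p.1 * (diff u p * diff u p)
    with hF
  have hFi : Integrable F (jumpMeasure m j) := h1.add h2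
  have hs := integral_swap_jumpMeasure h.jumps.symm F
  have h3 : 2 * jumpEnergy m j u (u * ψ)
      = ∫ p, F p ∂(jumpMeasure m j) + ∫ p, F p.swap ∂(jumpMeasure m j) := by
    rw [jumpEnergy_eq, ← integral_const_mul,
      ← integral_add hFi (integrable_swap_jumpMeasure h.jumps.symm hFi)]
    congr 1; funext p
    simp only [hF, diff, Pi.mul_apply, Prod.fst_swap, Prod.snd_swap]; ring
  linarith

theorem RegularWithJumps.integral_gammaJ (h : D.RegularWithJumps j) (hu : D.Mem u) :
    ∫ x, gammaJ j u u x ∂m = jumpEnergy m j u u := by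
  have := (h.integral_mul_gammaJ (memLp_top_const (1 : ℝ)) hu hu).2
  simpa [jumpEnergy_eq] using this

/-- The product rule for functions that differ from a bounded function of the domain by a
constant. -/
theorem energy_mul_eq_integral_gamma (h : D.RegularWithJumps j) (hac : D.HasEnergyDensities j)
    (hu : D.MemBdd u) (hψ : D.MemBdd ψ) {c : ℝ} (hφ : φ =ᵐ[m] fun x => ψ x + c) :
    D.Mem (u * φ) ∧
    Integrable (fun x => u x * D.gamma j u φ x) m ∧
    Integrable (fun x => φ x * D.gamma j u u x) m ∧
    D.energy u (u * φ) = ∫ x, u x * D.gamma j u φ x ∂m + ∫ x, φ x * D.gamma j u u x ∂m := by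
  obtain ⟨g, hg⟩ := hac _ _ hu hψ
  obtain ⟨k, hk⟩ := hac _ _ hu hu
  have hprod : u * φ =ᵐ[m] u * ψ + c • u := by
    filter_upwards [hφ] with x hx
    simp only [Pi.mul_apply, Pi.add_apply, Pi.smul_apply, smul_eq_mul, hx]; ring
  have huψ := (hu.mul hψ).1
  have hγφ : D.gamma j u φ =ᵐ[m] fun x => 1 / 2 * g x + gammaJ j u ψ x := by
    filter_upwards [gammaC_ae_eq h hac hu hψ hφ hg,
      gammaJ_congr h.jumps.symm (.rfl : u =ᵐ[m] u) hφ] with x h1 h2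
    rw [gamma, h1, h2]
    simp only [gammaJ, add_sub_add_right_eq_sub]
  have hγu : D.gamma j u u =ᵐ[m] fun x => 1 / 2 * k x + gammaJ j u u x := by
    filter_upwards [gammaC_ae_eq (φ := u) h hac hu hu (c := 0) (ae_of_all _ fun x => (add_zero _).symm) hk] with x h1
    rw [gamma, h1]
  have e1 : (fun x => u x * D.gamma j u φ x)
      =ᵐ[m] fun x => 1 / 2 * (u x * g x) + u x * gammaJ j u ψ x := by
    filter_upwards [hγφ] with x hx
    rw [hx]; ring
  have e2 : (fun x => φ x * D.gamma j u u x) =ᵐ[m] fun x => 1 / 2 * (ψ x * k x)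
      + ψ x * gammaJ j u u x + c * (1 / 2 * k x + gammaJ j u u x) := by
    filter_upwards [hγu, hφ] with x hx hx'
    rw [hx, hx']; ring
  have i1 := (hu.integrable_mul hg.1).const_mul (1 / 2)
  have i2 := (h.integral_mul_gammaJ hu.2 hu.1 hψ.1).1
  have i3 := (hψ.integrable_mul hk.1).const_mul (1 / 2)
  have i4 := (h.integral_mul_gammaJ hψ.2 hu.1 hu.1).1
  have i5 := hk.1.const_mul (1 / 2)
  have i6 := h.integrable_gammaJ hu.1 hu.1
  have i34 : Integrable (fun x => 1 / 2 * (ψ x * k x) + ψ x * gammaJ j u u x) m := i3.add i4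
  have i56 : Integrable (fun x => 1 / 2 * k x + gammaJ j u u x) m := i5.add i6
  refine ⟨(huψ.add (hu.1.smul c)).congr hprod.symm, (i1.add i2).congr e1.symm,
    (i34.add (i56.const_mul c)).congr e2.symm, ?_⟩
  -- The first two identities give `E(u, uψ)`; the two total masses give the contribution `c E(u,
  -- u)` of the constant.
  have hlocal := two_mul_localEnergy_mul h hu hψ hg hk
  have hjump := h.jumpEnergy_mul hu hψ
  have hmass := hk.integral_eq h hac hu
  have hjmass := h.integral_gammaJ hu.1
  rw [integral_congr_ae e1, integral_congr_ae e2, integral_add i1 i2,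
    integral_add i34 (i56.const_mul c), integral_add i3 i4, integral_const_mul c,
    integral_add i5 i6, integral_const_mul, integral_const_mul, integral_const_mul,
    energy_congr .rfl hprod, energy_add_right huψ (hu.1.smul c) hu.1,
    energy_smul_right c hu.1 hu.1, hmass, hjmass]
  simp only [localEnergy] at hlocal ⊢
  linarith

end ProductRule

end DirichletForm

theorem lemma2p3 {X : Type*} [MetricSpace X] [ProperSpace X] [MeasurableSpace X] [BorelSpace X]
    (m : Measure X) [IsFiniteMeasureOnCompacts m] [m.IsOpenPosMeasure]
    (D : DirichletForm m) (hreg : D.IsRegular)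
    (j : Kernel X X) [IsSFiniteKernel j]
    (hj : D.HasJumpKernel j) (hac : D.HasEnergyDensities j)
    (hrange : HasBoundedJumpRange j)
    (u φ : X → ℝ) (hu : D.MemBdd u)
    (hφ : D.MemLoc φ) (hφb : MemLp φ ⊤ m)
    (hφc : ∃ (K : Set X) (c : ℝ), IsCompact K ∧ ∀ᵐ x ∂m, x ∉ K → φ x = c) :
    D.Mem (u * φ) ∧
    Integrable (fun x => u x * D.gamma j u φ x) m ∧
    Integrable (fun x => φ x * D.gamma j u u x) m ∧
    D.energy u (u * φ) = ∫ x, u x * D.gamma j u φ x ∂m + ∫ x, φ x * D.gamma j u u x ∂m := by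
  obtain ⟨K, c, hK, hc⟩ := hφc
  obtain ⟨ψ, hψ, hφψ⟩ := hφ.exists_memBdd hreg hφb hK hc
  exact DirichletForm.energy_mul_eq_integral_gamma ⟨hreg, hj⟩ hac hu hψ hφψ
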